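/- **Theorem 1.** Consider the problem *Vertex Cover Above Tight Lower Bound-1* (VCL1): an instance consists of a positive integer $B$, a positive integer $k$ and a finite simple graph $G$ with $n$ vertices and $m$ edges in which every vertex has degree at most $B$; the question is whether $G$ has a vertex cover (a set of vertices that meets every edge) with at most $m/B+k$ vertices. VCL1 can be solved in time $O(2^{kB}n^{O(1)})$. Precisely: there are an algorithm (a program for a random access machine with logarithmic cost, given $n$, $B$, $k$ and the adjacency matrix of $G$) and absolute constants $a,e$ such that on every instance the algorithm halts with the correct answer after time at most $a\cdot 2^{kB}(n+1)^{e}$. In particular, VCL1 is fixed-parameter tractable with respect to the two parameters $k$ and $B$: it is decided by one algorithm in time $O(f(k,B)\,|I|^{O(1)})$ with a computable function $f$, where $|I|$ is the size of the instance in bits. -/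

import Mathlib

/-! ### Random access machines with logarithmic cost

The registers `R 0, R 1, R 2, …` hold natural numbers. A program is a finite list of instructions;
the machine halts when the program counter leaves the list. Every instruction is charged the
total bit length of the addresses and the numbers it handles. -/

namespace RAM

/-- The instructions. `sub` is truncated subtraction; there is no multiplication. -/
inductive Instr : Type
  /-- `R d := c` -/
  | const (d c : ℕ)
  /-- `R d := R s` -/
  | copy (d s : ℕ)
  /-- `R d := R d + 1` -/
  | succ (d : ℕ)
  /-- `R d := R a + R b` -/
  | add (d a b : ℕ)
  /-- `R d := R a - R b` -/
  | sub (d a b : ℕ)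
  /-- `R d := R (R a)` -/
  | load (d a : ℕ)
  /-- `R (R a) := R s` -/
  | store (a s : ℕ)
  /-- continue at instruction number `l` -/
  | jump (l : ℕ)
  /-- continue at instruction number `l` if `R a = 0`, else at the next instruction -/
  | jzero (a l : ℕ)

/-- A program is a finite list of instructions, numbered from `0`. -/
abbrev Program : Type := List Instr

/-- A configuration: the program counter and the contents of all registers. -/
@[ext] structure Config : Type where
  pc : ℕ
  reg : ℕ → ℕ

/-- The charge for handling the number `x`: its bit length plus one. -/
def len (x : ℕ) : ℕ := Nat.size x + 1

/-- The configuration after executing an instruction. -/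
def Instr.exec (i : Instr) (c : Config) : Config :=
  match i with
  | .const d v => ⟨c.pc + 1, Function.update c.reg d v⟩
  | .copy d s => ⟨c.pc + 1, Function.update c.reg d (c.reg s)⟩
  | .succ d => ⟨c.pc + 1, Function.update c.reg d (c.reg d + 1)⟩
  | .add d a b => ⟨c.pc + 1, Function.update c.reg d (c.reg a + c.reg b)⟩
  | .sub d a b => ⟨c.pc + 1, Function.update c.reg d (c.reg a - c.reg b)⟩
  | .load d a => ⟨c.pc + 1, Function.update c.reg d (c.reg (c.reg a))⟩
  | .store a s => ⟨c.pc + 1, Function.update c.reg (c.reg a) (c.reg s)⟩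
  | .jump l => ⟨l, c.reg⟩
  | .jzero a l => ⟨if c.reg a = 0 then l else c.pc + 1, c.reg⟩

/-- The logarithmic cost of executing an instruction. -/
def Instr.cost (i : Instr) (c : Config) : ℕ :=
  match i with
  | .const d v => len d + len v
  | .copy d s => len d + len s + len (c.reg s)
  | .succ d => len d + len (c.reg d)
  | .add d a b => len d + len a + len b + len (c.reg a) + len (c.reg b)
  | .sub d a b => len d + len a + len b + len (c.reg a) + len (c.reg b)
  | .load d a => len d + len a + len (c.reg a) + len (c.reg (c.reg a))
  | .store a s => len a + len s + len (c.reg a) + len (c.reg s)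
  | .jump l => len l
  | .jzero a l => len a + len l + len (c.reg a)

/-- `Runs P c t c'`: the program `P` leads from `c` to `c'` with total cost `t`. -/
inductive Runs (P : Program) : Config → ℕ → Config → Prop
  | refl (c : Config) : Runs P c 0 c
  | step {c c' : Config} {i : Instr} {t : ℕ} (hi : P[c.pc]? = some i)
      (h : Runs P (i.exec c) t c') : Runs P c (i.cost c + t) c'

/-- The initial configuration: the input stands in the registers `0, 1, …`, all others are `0`. -/
def init (input : List ℕ) : Config := ⟨0, fun i => input.getD i 0⟩

/-- Started on `input`, the program `P` halts within time `T` and leaves `1` in register `0` if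
`A` holds and `0` if `A` does not hold. -/
def DecidesWithin (P : Program) (input : List ℕ) (A : Prop) (T : ℕ) : Prop :=
  ∃ (t : ℕ) (c : Config), Runs P (init input) t c ∧ P.length ≤ c.pc ∧ t ≤ T ∧
    ((A ∧ c.reg 0 = 1) ∨ (¬ A ∧ c.reg 0 = 0))

/-- The size of an input: the total length of its numbers in binary. -/
def inputSize (input : List ℕ) : ℕ := (input.map len).sum

/-- Fixed-parameter tractability of the problem `yes` on instances `I`, written down for the
machine by `enc`, with two parameters `κ`: one program decides all instances `x` in time
`O(f(κ x) |x|^{O(1)})` for a computable function `f`. -/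
def FPT {I : Type} (enc : I → List ℕ) (κ : I → ℕ × ℕ) (yes : I → Prop) : Prop :=
  ∃ f : ℕ × ℕ → ℕ, Computable f ∧ ∃ (P : Program) (a e : ℕ), ∀ x : I,
    DecidesWithin P (enc x) (yes x) (a * f (κ x) * inputSize (enc x) ^ e)

end RAM

/-! ### Vertex Cover Above Tight Lower Bound-1 -/

open scoped Classical in
/-- An instance: positive integers `B` and `k` and a graph on `n` vertices all of whose degrees are
at most `B`. -/
structure VCL1 : Type where
  n : ℕ
  B : ℕ
  k : ℕ
  B_pos : 0 < B
  k_pos : 0 < k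
  G : SimpleGraph (Fin n)
  degree_le : ∀ v, G.degree v ≤ B

namespace VCL1

open scoped Classical in
/-- The question: does `G` have a vertex cover with at most `m / B + k` vertices, where `m` is the
number of edges and `/` is the division of rational numbers? -/
def IsYes (x : VCL1) : Prop :=
  ∃ C : Finset (Fin x.n), x.G.IsVertexCover (C : Set (Fin x.n)) ∧
    (C.card : ℚ) ≤ (x.G.edgeFinset.card : ℚ) / (x.B : ℚ) + (x.k : ℚ)

open scoped Classical in
/-- The input for the machine: `n`, `B`, `k` and the rows of the adjacency matrix of `G`. -/
noncomputable def encode (x : VCL1) : List ℕ :=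
  [x.n, x.B, x.k] ++ (List.finRange x.n).flatMap fun i =>
    (List.finRange x.n).map fun j => if x.G.Adj i j then 1 else 0

end VCL1

/-!
Let `τ` be twice the half-integral vertex cover number. It equals the size of a maximum matching of
the bipartite double cover, so it can be computed in polynomial time. The algorithm goes through
the vertices one after another and puts either a vertex or all its remaining neighbours into the
cover. If one of the two choices keeps the half-integral optimum tight, then it may be taken by
persistency; otherwise a bit of an answer string decides. For a bound `b` on the size of the cover,
each bit used up lowers `2 * b - 2 * c - τ`, where `c` is the number of vertices chosen so far and
`τ` refers to the remaining graph. Since all degrees are at most `B`, at the start `2 * m ≤ B * τ`,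
so with `b` the integral part of `m / B + k` at most `2 * k` bits are needed, and all `4 ^ k`
answer strings can be tried.

A cover with `m` vertices always exists, so there is nothing to search if `m ≤ b`. Otherwise
`2 ≤ B`, and `4 ^ k ≤ 2 ^ (k * B)`.
-/

/-! ### Half-integral vertex covers and persistency -/

namespace HalfCover

open Finset

variable {α : Type*} {G : SimpleGraph α} {S S' C : Finset α} {z : α → ℕ} {v w : α}

/-- `C` meets every edge inside `S`, that is, it is a vertex cover of the graph induced on `S`
(except that it may have members outside `S`). -/
def Covers (G : SimpleGraph α) (S C : Finset α) : Prop :=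
  ∀ u ∈ S, ∀ w ∈ S, G.Adj u w → u ∈ C ∨ w ∈ C

/-- `z / 2` is a half-integral vertex cover of the graph induced on `S`. -/
def Feasible (G : SimpleGraph α) (S : Finset α) (z : α → ℕ) : Prop :=
  ∀ u ∈ S, ∀ w ∈ S, G.Adj u w → 2 ≤ z u + z w

/-- Twice the least weight of a half-integral vertex cover of the graph induced on `S`. -/
noncomputable def tau (G : SimpleGraph α) (S : Finset α) : ℕ :=
  sInf {t | ∃ z, Feasible G S z ∧ ∑ v ∈ S, z v = t}

theorem tau_le (hz : Feasible G S z) : tau G S ≤ ∑ v ∈ S, z v :=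
  Nat.sInf_le ⟨z, hz, rfl⟩

theorem exists_sum_eq_tau (G : SimpleGraph α) (S : Finset α) :
    ∃ z, Feasible G S z ∧ ∑ v ∈ S, z v = tau G S :=
  Nat.sInf_mem (s := {t | ∃ z, Feasible G S z ∧ ∑ v ∈ S, z v = t})
    ⟨_, fun _ => 2, fun _ _ _ _ _ => by norm_num, rfl⟩

theorem tau_mono (h : S' ⊆ S) : tau G S' ≤ tau G S := by
  obtain ⟨z, hz, hsum⟩ := exists_sum_eq_tau G S
  rw [← hsum]
  exact (tau_le fun u hu w hw => hz u (h hu) w (h hw)).trans (sum_le_sum_of_subset h)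

theorem Covers.tau_le_two_mul_card (hC : Covers G S C) : tau G S ≤ 2 * C.card := by
  classical
  refine (tau_le (z := fun v => if v ∈ C then 2 else 0) fun u hu w hw huw => ?_).trans ?_
  · rcases hC u hu w hw huw with h | h <;> simp [h]
  · rw [← sum_filter, sum_const, smul_eq_mul, mul_comm]
    exact Nat.mul_le_mul_left _ (card_le_card fun v hv => (mem_filter.1 hv).2)

section Persistency

variable [DecidableEq α]

/-- The half-integral cover `z` moved by a half towards the cover `C`: where `z` vanishes on `C` it
is raised to `1`, and outside of `C` the values above `1` are lowered by `1`. -/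
def shift (C : Finset α) (z : α → ℕ) (v : α) : ℕ :=
  if v ∈ C then (if z v = 0 then 1 else z v) else (if 2 ≤ z v then z v - 1 else z v)

/-- The cover obtained from `C` by dropping the vertices where `z` vanishes and adding those where
`z` is at least `2`. -/
def switch (S C : Finset α) (z : α → ℕ) : Finset α :=
  S.filter fun v => (v ∈ C ∧ z v ≠ 0) ∨ 2 ≤ z v

theorem Feasible.shift (hz : Feasible G S z) (hC : Covers G S C) :
    Feasible G S (shift C z) := by
  intro u hu w hw huw
  have h1 := hz u hu w hw huw
  have h2 := hC u hu w hw huw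
  simp only [HalfCover.shift]
  split_ifs <;> first | omega | (exfalso; tauto)

theorem sum_shift_add_card (S C : Finset α) (z : α → ℕ) :
    ∑ v ∈ S, shift C z v + #{v ∈ S | v ∉ C ∧ 2 ≤ z v} =
      ∑ v ∈ S, z v + #{v ∈ S | v ∈ C ∧ z v = 0} := by
  simp only [card_filter, ← sum_add_distrib]
  refine sum_congr rfl fun v _ => ?_
  simp only [shift]
  split_ifs <;> first | omega | (exfalso; tauto)

theorem card_switch_add_card_le (S C : Finset α) (z : α → ℕ) :
    #(switch S C z) + #{v ∈ S | v ∈ C ∧ z v = 0} ≤ #C + #{v ∈ S | v ∉ C ∧ 2 ≤ z v} := by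
  have hsub : switch S C z ⊆
      (C \ {v ∈ S | v ∈ C ∧ z v = 0}) ∪ {v ∈ S | v ∉ C ∧ 2 ≤ z v} := by
    intro v hv
    simp only [switch, mem_filter, mem_union, mem_sdiff] at hv ⊢
    by_cases hvC : v ∈ C <;> simp only [hvC] <;> grind
  have hdiff := card_sdiff_add_card_eq_card
    (show {v ∈ S | v ∈ C ∧ z v = 0} ⊆ C from fun v hv => (mem_filter.1 hv).2.1)
  have := (card_le_card hsub).trans (card_union_le _ _)
  omega

theorem Covers.switch (hC : Covers G S C) (hz : Feasible G S z) : Covers G S (switch S C z) := by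
  intro u hu w hw huw
  have h1 := hz u hu w hw huw
  have h2 := hC u hu w hw huw
  simp only [HalfCover.switch, mem_filter, hu, hw, true_and]
  by_cases hu0 : z u = 0
  · right; right; omega
  by_cases hw0 : z w = 0
  · left; right; omega
  tauto

end Persistency

/-- Persistency (Nemhauser and Trotter): since shifting an optimal `z` towards `C` does not gain
anything, switching `C` according to `z` does not lose anything. -/
theorem Covers.persistency (hC : Covers G S C) (hz : Feasible G S z)
    (hmin : ∑ v ∈ S, z v ≤ tau G S) :
    ∃ D, Covers G S D ∧ #D ≤ #C ∧ ∀ v ∈ S, 2 ≤ z v → v ∈ D := by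
  classical
  refine ⟨HalfCover.switch S C z, hC.switch hz, ?_, fun v hv h => mem_filter.2 ⟨hv, Or.inr h⟩⟩
  have h1 := hmin.trans (tau_le (hz.shift hC))
  have h2 := sum_shift_add_card S C z
  have h3 := card_switch_add_card_le S C z
  omega

/-! ### Deciding on a vertex -/

/-- The neighbours of `v` in `S`. -/
noncomputable def nbrs (G : SimpleGraph α) (S : Finset α) (v : α) : Finset α :=
  open scoped Classical in S.filter (G.Adj v)

@[simp]
theorem mem_nbrs : w ∈ nbrs G S v ↔ w ∈ S ∧ G.Adj v w := by
  simp only [nbrs, mem_filter]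

variable [DecidableEq α]

/-- The vertices of `S` other than `v` and its neighbours: what remains to be covered when `v` is
left out of the cover. -/
noncomputable def rest (G : SimpleGraph α) (S : Finset α) (v : α) : Finset α :=
  (S.erase v) \ nbrs G S v

theorem mem_rest : w ∈ rest G S v ↔ w ∈ S ∧ w ≠ v ∧ ¬ G.Adj v w := by
  simp only [rest, mem_sdiff, mem_erase, mem_nbrs]
  tauto

theorem Covers.erase (hC : Covers G S C) (v : α) : Covers G (S.erase v) (C.erase v) := by
  intro u hu w hw huw
  have := hC u (mem_of_mem_erase hu) w (mem_of_mem_erase hw) huw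
  simp only [mem_erase] at hu hw ⊢
  tauto

theorem Covers.sdiff_nbrs (hC : Covers G S C) (v : α) :
    Covers G (rest G S v) (C \ nbrs G S v) := by
  intro u hu w hw huw
  rw [mem_rest] at hu hw
  have := hC u hu.1 w hw.1 huw
  simp only [mem_sdiff, mem_nbrs]
  tauto

theorem Covers.insert (hC : Covers G (S.erase v) C) : Covers G S (insert v C) := by
  intro u hu w hw huw
  have := hC u
  simp only [mem_erase, mem_insert] at this ⊢
  grind

theorem Covers.nbrs_union (hC : Covers G (rest G S v) C) : Covers G S (nbrs G S v ∪ C) := by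
  intro u hu w hw huw
  simp only [mem_union, mem_nbrs, hu, hw, true_and]
  by_cases hvu : G.Adj v u
  · tauto
  by_cases hvw : G.Adj v w
  · tauto
  have := hC u (mem_rest.2 ⟨hu, fun h => hvw (h ▸ huw), hvu⟩) w
    (mem_rest.2 ⟨hw, fun h => hvu (h ▸ huw.symm), hvw⟩) huw
  tauto

theorem exists_feasible_of_erase (G : SimpleGraph α) (hv : v ∈ S) :
    ∃ z, Feasible G S z ∧ ∑ u ∈ S, z u = tau G (S.erase v) + 2 ∧ z v = 2 := by
  obtain ⟨z, hz, hsum⟩ := exists_sum_eq_tau G (S.erase v)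
  refine ⟨Function.update z v 2, fun u hu w hw huw => ?_, ?_, Function.update_self ..⟩
  · by_cases h1 : u = v
    · simp [h1]
    by_cases h2 : w = v
    · simp [h2]
    rw [Function.update_of_ne h1, Function.update_of_ne h2]
    exact hz u (mem_erase.2 ⟨h1, hu⟩) w (mem_erase.2 ⟨h2, hw⟩) huw
  · rw [← sum_erase_add _ _ hv, Function.update_self, ← hsum]
    congr 1
    exact sum_congr rfl fun u hu => Function.update_of_ne (ne_of_mem_erase hu) ..

open scoped Classical in
theorem Feasible.extend_rest (hz : Feasible G (rest G S v) z) :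
    Feasible G S fun u => if u = v then 0 else if G.Adj v u then 2 else z u := by
  intro u hu w hw huw
  have h1 := hz u
  have h2 := huw.symm
  simp only [mem_rest] at h1
  have h3 : ¬ G.Adj v v := G.loopless.irrefl v
  grind

theorem exists_feasible_of_rest (G : SimpleGraph α) (hv : v ∈ S) :
    ∃ z, Feasible G S z ∧ ∑ u ∈ S, z u = tau G (rest G S v) + 2 * #(nbrs G S v) ∧
      ∀ u ∈ nbrs G S v, z u = 2 := by
  classical
  obtain ⟨z, hz, hsum⟩ := exists_sum_eq_tau G (rest G S v)
  have hnbrs : ∀ u ∈ nbrs G S v, (if u = v then 0 else if G.Adj v u then 2 else z u) = 2 := by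
    intro u hu
    have hadj := (mem_nbrs.1 hu).2
    rw [if_neg hadj.ne', if_pos hadj]
  refine ⟨_, hz.extend_rest, ?_, hnbrs⟩
  have hsub : nbrs G S v ⊆ S.erase v := fun u hu =>
    mem_erase.2 ⟨(mem_nbrs.1 hu).2.ne', (mem_nbrs.1 hu).1⟩
  rw [← sum_erase_add _ _ hv, if_pos rfl, add_zero, ← sum_sdiff hsub, sum_congr rfl hnbrs,
    sum_const, smul_eq_mul, mul_comm, ← hsum]
  congr 1
  refine sum_congr rfl fun u hu => ?_
  obtain ⟨-, h1, h2⟩ := mem_rest.1 hu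
  rw [if_neg h1, if_neg h2]

theorem tau_le_tau_erase_add_two (G : SimpleGraph α) (hv : v ∈ S) :
    tau G S ≤ tau G (S.erase v) + 2 := by
  obtain ⟨z, hz, hsum, -⟩ := exists_feasible_of_erase G hv
  exact hsum ▸ tau_le hz

theorem tau_le_tau_rest_add (G : SimpleGraph α) (hv : v ∈ S) :
    tau G S ≤ tau G (rest G S v) + 2 * #(nbrs G S v) := by
  obtain ⟨z, hz, hsum, -⟩ := exists_feasible_of_rest G hv
  exact hsum ▸ tau_le hz

theorem Covers.exists_erase (hC : Covers G S C) (hv : v ∈ S)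
    (h : tau G (S.erase v) + 2 ≤ tau G S) : ∃ D, Covers G (S.erase v) D ∧ #D + 1 ≤ #C := by
  obtain ⟨z, hz, hsum, hzv⟩ := exists_feasible_of_erase G hv
  obtain ⟨D, hD, hcard, hmem⟩ := hC.persistency hz (hsum ▸ h)
  exact ⟨D.erase v, hD.erase v, by rwa [card_erase_add_one (hmem v hv hzv.ge)]⟩

theorem Covers.exists_rest (hC : Covers G S C) (hv : v ∈ S)
    (h : tau G (rest G S v) + 2 * #(nbrs G S v) ≤ tau G S) :
    ∃ D, Covers G (rest G S v) D ∧ #D + #(nbrs G S v) ≤ #C := by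
  obtain ⟨z, hz, hsum, hzn⟩ := exists_feasible_of_rest G hv
  obtain ⟨D, hD, hcard, hmem⟩ := hC.persistency hz (hsum ▸ h)
  refine ⟨D \ nbrs G S v, hD.sdiff_nbrs v, ?_⟩
  rwa [card_sdiff_add_card_eq_card fun u hu => hmem u (mem_nbrs.1 hu).1 (hzn u hu).ge]

/-! ### The branching procedure -/

open scoped Classical in
/-- Go through the vertices `vs`, putting each one that is still in `S` into the cover, or else its
neighbours. The choice is made by persistency where `tau` allows it; `b` answers the remaining
questions, in order. The result is the number of vertices put into the cover in addition to `c`. -/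
noncomputable def branch (G : SimpleGraph α) : List α → Finset α → ℕ → (ℕ → Prop) → ℕ
  | [], _, c, _ => c
  | v :: vs, S, c, b =>
    if v ∈ S then
      if tau G (S.erase v) + 2 ≤ tau G S then branch G vs (S.erase v) (c + 1) b
      else if tau G (rest G S v) + 2 * #(nbrs G S v) ≤ tau G S then
        branch G vs (rest G S v) (c + #(nbrs G S v)) b
      else if b 0 then branch G vs (rest G S v) (c + #(nbrs G S v)) fun i => b (i + 1)
      else branch G vs (S.erase v) (c + 1) fun i => b (i + 1)
    else branch G vs S c b

theorem exists_covers_le_branch (G : SimpleGraph α) (vs : List α) (S : Finset α) (c : ℕ)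
    (b : ℕ → Prop) (hS : ∀ v ∈ S, v ∈ vs) : ∃ C, Covers G S C ∧ c + #C ≤ branch G vs S c b := by
  induction vs generalizing S c b with
  | nil => exact ⟨∅, fun u hu => absurd (hS u hu) List.not_mem_nil, by simp [branch]⟩
  | cons v vs ih =>
    have put_in (b') : ∃ C, Covers G S C ∧ c + #C ≤ branch G vs (S.erase v) (c + 1) b' := by
      obtain ⟨C, hC, hc⟩ := ih (S.erase v) (c + 1) b' fun w hw =>
        (List.mem_cons.1 (hS w (mem_of_mem_erase hw))).resolve_left (ne_of_mem_erase hw)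
      exact ⟨insert v C, hC.insert, by have := card_insert_le v C; omega⟩
    have leave_out (b') :
        ∃ C, Covers G S C ∧ c + #C ≤ branch G vs (rest G S v) (c + #(nbrs G S v)) b' := by
      obtain ⟨C, hC, hc⟩ := ih (rest G S v) (c + #(nbrs G S v)) b' fun w hw =>
        (List.mem_cons.1 (hS w (mem_rest.1 hw).1)).resolve_left (mem_rest.1 hw).2.1
      exact ⟨nbrs G S v ∪ C, hC.nbrs_union, by have := card_union_le (nbrs G S v) C; omega⟩
    rw [branch]
    split_ifs with hv
    · exact put_in _
    · exact leave_out _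
    · exact leave_out _
    · exact put_in _
    · exact ih S c b fun w hw =>
        (List.mem_cons.1 (hS w hw)).resolve_left fun h => hv (h ▸ hw)

/-- Each answered question lowers `2 * bound - 2 * c - tau G S`, because neither choice was forced;
this many good answers are therefore enough. -/
theorem exists_answers_branch_le (G : SimpleGraph α) (bound : ℕ) (vs : List α) (S C : Finset α)
    (c μ : ℕ) (hC : Covers G S C) (hc : c + #C ≤ bound) (hμ : 2 * bound ≤ μ + 2 * c + tau G S) :
    ∃ g : ℕ → Prop, ∀ b : ℕ → Prop, (∀ i < μ, b i ↔ g i) → branch G vs S c b ≤ bound := by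
  induction vs generalizing S C c μ with
  | nil => exact ⟨fun _ => True, fun b _ => by rw [branch]; omega⟩
  | cons v vs ih =>
    by_cases hv : v ∈ S
    swap
    · simpa only [branch, hv, if_false] using ih S C c μ hC hc hμ
    simp only [branch, hv, if_true]
    by_cases hin : tau G (S.erase v) + 2 ≤ tau G S
    · obtain ⟨D, hD, hcard⟩ := hC.exists_erase hv hin
      have := tau_le_tau_erase_add_two G hv
      simpa only [hin, if_true] using ih _ D _ _ hD (by omega) (by omega)
    by_cases hout : tau G (rest G S v) + 2 * #(nbrs G S v) ≤ tau G S
    · obtain ⟨D, hD, hcard⟩ := hC.exists_rest hv hout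
      have := tau_le_tau_rest_add G hv
      simpa only [hin, hout, if_false, if_true] using ih _ D _ _ hD (by omega) (by omega)
    simp only [hin, hout, if_false]
    by_cases hvC : v ∈ C
    · have hcard := card_erase_add_one hvC
      have hle := (hC.erase v).tau_le_two_mul_card
      obtain ⟨g, hg⟩ := ih _ _ (c + 1) (μ - 1) (hC.erase v) (by omega) (by omega)
      refine ⟨fun i => i ≠ 0 ∧ g (i - 1), fun b hb => ?_⟩
      have h0 : ¬ b 0 := fun h => ((hb 0 (by omega)).1 h).1 rfl
      rw [if_neg h0]
      exact hg _ fun i hi => by simpa using hb (i + 1) (by omega)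
    · have hcard : #(C \ nbrs G S v) + #(nbrs G S v) = #C := card_sdiff_add_card_eq_card fun u hu =>
        (hC v hv u (mem_nbrs.1 hu).1 (mem_nbrs.1 hu).2).resolve_left hvC
      have hle := (hC.sdiff_nbrs v).tau_le_two_mul_card
      obtain ⟨g, hg⟩ :=
        ih _ _ (c + #(nbrs G S v)) (μ - 1) (hC.sdiff_nbrs v) (by omega) (by omega)
      refine ⟨fun i => i ≠ 0 → g (i - 1), fun b hb => ?_⟩
      have h0 : b 0 := (hb 0 (by omega)).2 fun h => absurd rfl h
      rw [if_pos h0]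
      exact hg _ fun i hi => by simpa using hb (i + 1) (by omega)

end HalfCover

/-! ### The auction -/

namespace HalfCover

open Finset

/-- The state of an auction in which the vertices of `U` have been bidding for their neighbours in
`T`: `p` are the prices, at most `L`, and the vertices `w` with positive price are sold to `mate w`.
It computes a largest matching of the bipartite double cover of the graph induced on `T`. -/
structure Auction {α : Type*} (G : SimpleGraph α) (T : Finset α) (L : ℕ) (p : α → ℕ)
    (mate : α → α) (U : Finset α) : Prop where
  price_le : ∀ w ∈ T, p w ≤ L
  mate_mem : ∀ w ∈ T, 0 < p w → mate w ∈ U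
  mate_adj : ∀ w ∈ T, 0 < p w → G.Adj (mate w) w
  mate_inj : ∀ w ∈ T, ∀ w' ∈ T, 0 < p w → 0 < p w' → mate w = mate w' → w = w'
  slack : ∀ w ∈ T, 0 < p w → ∀ w' ∈ T, G.Adj (mate w) w' → p w ≤ p w' + 1
  placed : ∀ u ∈ U, (∃ w ∈ T, 0 < p w ∧ mate w = u) ∨ ∀ w ∈ T, G.Adj u w → L ≤ p w

namespace Auction

variable {α : Type*} {G : SimpleGraph α} {T U U' : Finset α} {L l : ℕ} {p z : α → ℕ}
  {mate : α → α} {u w : α}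

theorem start (hp : ∀ w ∈ T, p w = 0) : Auction G T L p mate ∅ where
  price_le w hw := by simp [hp w hw]
  mate_mem w hw h := by simp [hp w hw] at h
  mate_adj w hw h := by simp [hp w hw] at h
  mate_inj w hw _ _ h := by simp [hp w hw] at h
  slack w hw h := by simp [hp w hw] at h
  placed u hu := by simp at hu

theorem give_up [DecidableEq α] (h : Auction G T L p mate U) (hu : ∀ w ∈ T, G.Adj u w → L ≤ p w) :
    Auction G T L p mate (insert u U) where
  __ := h
  mate_mem w hw h0 := mem_insert_of_mem (h.mate_mem w hw h0)
  placed u' hu' := by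
    rcases mem_insert.1 hu' with rfl | hu'
    · exact Or.inr hu
    · exact h.placed u' hu'

/-- The bid of `u` for a cheapest neighbour `w`. The vertex which loses `w`, if any, has to bid
again. -/
theorem bid [DecidableEq α] (h : Auction G T L p mate U) (huU : u ∉ U) (hw : w ∈ T)
    (huw : G.Adj u w) (hL : p w < L) (hmin : ∀ w' ∈ T, G.Adj u w' → p w ≤ p w')
    (hU' : ∀ x, x ∈ U' ↔ x = u ∨ x ∈ U ∧ ¬ (0 < p w ∧ x = mate w)) :
    Auction G T L (Function.update p w (p w + 1)) (Function.update mate w u) U' where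
  price_le x hx := by
    have := h.price_le x hx
    grind [Function.update_apply]
  mate_mem x hx h0 := by
    have hinj := h.mate_inj x hx w hw
    have hmem := h.mate_mem x hx
    grind [Function.update_apply]
  mate_adj x hx h0 := by
    have := h.mate_adj x hx
    grind [Function.update_apply]
  mate_inj x hx y hy hx0 hy0 hxy := by
    have hinj := h.mate_inj x hx y hy
    have hmx := h.mate_mem x hx
    have hmy := h.mate_mem y hy
    grind [Function.update_apply]
  slack x hx hx0 y hy hxy := by
    have hslack := h.slack x hx
    have hmin' := hmin y hy
    grind [Function.update_apply]
  placed x hx := by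
    rcases (hU' x).1 hx with rfl | ⟨hxU, hx1⟩
    · exact Or.inl ⟨w, hw, by simp, by simp⟩
    rcases h.placed x hxU with ⟨y, hy, hy0, hyx⟩ | h1
    · have : y ≠ w := by
        rintro rfl
        exact hx1 ⟨hy0, hyx.symm⟩
      exact Or.inl ⟨y, hy, by simpa [this] using hy0, by simpa [this] using hyx⟩
    · refine Or.inr fun y hy hxy => ?_
      have := h1 y hy hxy
      grind [Function.update_apply]

/-- The sold vertices and their mates are a matching, which bounds fractional covers from below. -/
theorem card_sold_le_sum (h : Auction G T L p mate T) (hz : Feasible G T z) :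
    #{w ∈ T | 0 < p w} ≤ ∑ v ∈ T, z v := by
  classical
  set M := {w ∈ T | 0 < p w} with hM
  have hinj : Set.InjOn mate (M : Set α) := by
    intro w hw w' hw' e
    rw [mem_coe, hM, mem_filter] at hw hw'
    exact h.mate_inj w hw.1 w' hw'.1 hw.2 hw'.2 e
  have h1 : ∑ w ∈ M, z w ≤ ∑ v ∈ T, z v := sum_le_sum_of_subset (filter_subset _ _)
  have h2 : ∑ w ∈ M, z (mate w) ≤ ∑ v ∈ T, z v := by
    rw [← sum_image (f := z) hinj]
    refine sum_le_sum_of_subset (image_subset_iff.2 fun w hw => ?_)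
    exact h.mate_mem w (mem_filter.1 hw).1 (mem_filter.1 hw).2
  have h3 : ∑ w ∈ M, 2 ≤ ∑ w ∈ M, (z (mate w) + z w) := sum_le_sum fun w hw => by
    obtain ⟨hwT, hw0⟩ := mem_filter.1 hw
    exact hz _ (h.mate_mem w hwT hw0) _ hwT (h.mate_adj w hwT hw0)
  rw [sum_add_distrib, sum_const, smul_eq_mul] at h3
  omega

theorem exists_price_gap (p : α → ℕ) (hL : #T < L) : ∃ l, 0 < l ∧ l ≤ L ∧ ∀ w ∈ T, p w ≠ l := by
  classical
  obtain ⟨l, hl, hgap⟩ : ∃ l ∈ Icc 1 L, l ∉ T.image p := by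
    by_contra! hcon
    have := card_le_card (s := Icc 1 L) (t := T.image p) hcon
    have := card_image_le (s := T) (f := p)
    rw [Nat.card_Icc] at *
    omega
  rw [mem_Icc] at hl
  exact ⟨l, hl.1, hl.2, fun w hw e => hgap (mem_image.2 ⟨w, hw, e⟩)⟩

/-- The dual solution: no edge leads from a vertex outside the buyers below a price gap `l` to a
vertex below the gap. -/
theorem mem_image_mate_or_lt [DecidableEq α] (h : Auction G T L p mate T) (hl : l ≤ L)
    (hgap : ∀ w ∈ T, p w ≠ l) (hu : u ∈ T) (hw : w ∈ T) (huw : G.Adj u w) :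
    u ∈ {w ∈ T | 0 < p w ∧ p w < l}.image mate ∨ l < p w := by
  by_cases hlt : l < p w
  · exact Or.inr hlt
  have hne := hgap w hw
  left
  rcases h.placed u hu with ⟨y, hy, hy0, rfl⟩ | h1
  · have hslack := h.slack y hy hy0 w hw huw
    have hney := hgap y hy
    exact mem_image_of_mem _ (mem_filter.2 ⟨hy, hy0, by omega⟩)
  · have := h1 w hw huw
    omega

/-- When all vertices have been placed, matching and dual solution have the same size. -/
theorem card_sold_eq_tau (h : Auction G T L p mate T) (hL : #T < L) :
    #{w ∈ T | 0 < p w} = tau G T := by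
  classical
  refine le_antisymm ?_ ?_
  · obtain ⟨z, hz, hsum⟩ := exists_sum_eq_tau G T
    exact hsum ▸ h.card_sold_le_sum hz
  obtain ⟨l, hl0, hlL, hgap⟩ := exists_price_gap p hL
  set X := {w ∈ T | 0 < p w ∧ p w < l}.image mate with hX
  have hXT : X ⊆ T := image_subset_iff.2 fun w hw =>
    h.mate_mem w (mem_filter.1 hw).1 (mem_filter.1 hw).2.1
  refine (tau_le (z := fun v => (if v ∈ X then 1 else 0) + (if l < p v then 1 else 0))
    fun u hu w hw huw => ?_).trans ?_
  · have h1 := h.mem_image_mate_or_lt hlL hgap hu hw huw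
    have h2 := h.mem_image_mate_or_lt hlL hgap hw hu huw.symm
    rw [← hX] at h1 h2
    dsimp only
    split_ifs <;> first | omega | (exfalso; tauto)
  · rw [sum_add_distrib, sum_ite_mem, inter_eq_right.2 hXT, sum_const, smul_eq_mul, mul_one,
      ← card_filter]
    refine (Nat.add_le_add_right card_image_le _).trans ?_
    rw [← card_union_of_disjoint (disjoint_filter.2 fun w _ h1 h2 => by omega)]
    refine card_le_card fun w hw => ?_
    simp only [mem_union, mem_filter] at hw ⊢
    exact hw.elim (fun h => ⟨h.1, h.2.1⟩) fun h => ⟨h.1, by omega⟩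

end Auction

end HalfCover

/-! ### A language of bounded loops -/

/-- The commands of a small programming language over variables `V` and infinite arrays `A` of
natural numbers, in which the algorithm is written before it is compiled for the machine. -/
inductive Cmd (V A : Type) : Type
  | skip
  /-- `x := c` -/
  | const (x : V) (c : ℕ)
  /-- `x := y` -/
  | copy (x y : V)
  /-- `x := x + 1` -/
  | succ (x : V)
  /-- `x := y - z` -/
  | sub (x y z : V)
  /-- `x := c[i]` -/
  | load (x : V) (c : A) (i : V)
  /-- `c[i] := y` -/
  | store (c : A) (i y : V)
  | seq (s t : Cmd V A)
  /-- `s` if `x = 0`, else `t` -/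
  | ifz (x : V) (s t : Cmd V A)
  /-- repeat `s` as often as the value of `x` says before the loop -/
  | loop (x : V) (s : Cmd V A)

/-- The state of a program: the values of the variables and the arrays. -/
@[ext] structure Store (V A : Type) : Type where
  v : V → ℕ
  a : A → ℕ → ℕ

namespace Cmd

variable {V A : Type}

/-- The command which runs the commands of a list one after the other. -/
def block (l : List (Cmd V A)) : Cmd V A := l.foldr seq skip

variable [DecidableEq V] [DecidableEq A]

/-- The effect of a command. -/
def eval : Cmd V A → Store V A → Store V A
  | skip, σ => σ
  | const x c, σ => ⟨Function.update σ.v x c, σ.a⟩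
  | copy x y, σ => ⟨Function.update σ.v x (σ.v y), σ.a⟩
  | succ x, σ => ⟨Function.update σ.v x (σ.v x + 1), σ.a⟩
  | sub x y z, σ => ⟨Function.update σ.v x (σ.v y - σ.v z), σ.a⟩
  | load x c i, σ => ⟨Function.update σ.v x (σ.a c (σ.v i)), σ.a⟩
  | store c i y, σ => ⟨σ.v, Function.update σ.a c (Function.update (σ.a c) (σ.v i) (σ.v y))⟩
  | seq s t, σ => t.eval (s.eval σ)
  | ifz x s t, σ => if σ.v x = 0 then s.eval σ else t.eval σ
  | loop x s, σ => s.eval^[σ.v x] σ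

/-- The running time of a command. -/
def steps : Cmd V A → Store V A → ℕ
  | skip, _ => 0
  | const _ _, _ => 1
  | copy _ _, _ => 1
  | succ _, _ => 1
  | sub _ _ _, _ => 1
  | load _ _ _, _ => 1
  | store _ _ _, _ => 1
  | seq s t, σ => s.steps σ + t.steps (s.eval σ)
  | ifz x s t, σ => 1 + if σ.v x = 0 then s.steps σ else t.steps σ
  | loop x s, σ => 1 + ∑ i ∈ Finset.range (σ.v x), (1 + s.steps (s.eval^[i] σ))

section Eval

variable (σ : Store V A)

@[simp] theorem eval_skip : (skip : Cmd V A).eval σ = σ := rfl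

@[simp] theorem eval_const (x : V) (c : ℕ) :
    (const x c).eval σ = ⟨Function.update σ.v x c, σ.a⟩ := rfl

@[simp] theorem eval_copy (x y : V) :
    (copy x y).eval σ = ⟨Function.update σ.v x (σ.v y), σ.a⟩ := rfl

@[simp] theorem eval_succ (x : V) :
    (succ x).eval σ = ⟨Function.update σ.v x (σ.v x + 1), σ.a⟩ := rfl

@[simp] theorem eval_sub (x y z : V) :
    (sub x y z).eval σ = ⟨Function.update σ.v x (σ.v y - σ.v z), σ.a⟩ := rfl

@[simp] theorem eval_load (x : V) (c : A) (i : V) :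
    (load x c i).eval σ = ⟨Function.update σ.v x (σ.a c (σ.v i)), σ.a⟩ := rfl

@[simp] theorem eval_store (c : A) (i y : V) : (store c i y).eval σ =
    ⟨σ.v, Function.update σ.a c (Function.update (σ.a c) (σ.v i) (σ.v y))⟩ := rfl

@[simp] theorem eval_ifz (x : V) (s t : Cmd V A) :
    (ifz x s t).eval σ = if σ.v x = 0 then s.eval σ else t.eval σ := rfl

@[simp] theorem eval_block_nil : (block ([] : List (Cmd V A))).eval σ = σ := rfl

@[simp] theorem eval_block_cons (s : Cmd V A) (l : List (Cmd V A)) :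
    (block (s :: l)).eval σ = (block l).eval (s.eval σ) := rfl

end Eval

section Loop

variable {x : V} {s : Cmd V A} {σ : Store V A}

theorem eval_loop_induction (I : ℕ → Store V A → Prop) (h0 : I 0 σ)
    (hs : ∀ i τ, i < σ.v x → I i τ → I (i + 1) (s.eval τ)) : I (σ.v x) ((loop x s).eval σ) := by
  suffices ∀ m ≤ σ.v x, I m (s.eval^[m] σ) from this _ le_rfl
  intro m
  induction m with
  | zero => exact fun _ => h0
  | succ m ih =>
    intro hm
    rw [Function.iterate_succ_apply']
    exact hs m _ hm (ih (by omega))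

theorem steps_loop_le (I : ℕ → Store V A → Prop) (f : ℕ → ℕ) (h0 : I 0 σ)
    (hs : ∀ i τ, I i τ → I (i + 1) (s.eval τ)) (hf : ∀ i τ, I i τ → s.steps τ ≤ f i) :
    (loop x s).steps σ ≤ 1 + ∑ i ∈ Finset.range (σ.v x), (1 + f i) := by
  have hI (i : ℕ) : I i (s.eval^[i] σ) := by
    induction i with
    | zero => exact h0
    | succ i ih => rw [Function.iterate_succ_apply']; exact hs i _ ih
  rw [steps]
  exact Nat.add_le_add_left (Finset.sum_le_sum fun i _ => Nat.add_le_add_left (hf i _ (hI i)) 1) 1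

end Loop

/-! ### What a command leaves unchanged -/

/-- Whether the command assigns to the variable `x`. -/
def writesVar : Cmd V A → V → Bool
  | const y _, x | copy y _, x | succ y, x | sub y _ _, x | load y _ _, x => x = y
  | seq s t, x | ifz _ s t, x => s.writesVar x || t.writesVar x
  | loop _ s, x => s.writesVar x
  | _, _ => false

/-- Whether the command assigns to the array `c`. -/
def writesArr : Cmd V A → A → Bool
  | store d _ _, c => c = d
  | seq s t, c | ifz _ s t, c => s.writesArr c || t.writesArr c
  | loop _ s, c => s.writesArr c
  | _, _ => false

theorem eval_v_of_not_writesVar {s : Cmd V A} {x : V} (h : s.writesVar x = false)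
    (σ : Store V A) : (s.eval σ).v x = σ.v x := by
  induction s generalizing σ with
  | seq s t ihs iht =>
    simp only [writesVar, Bool.or_eq_false_iff] at h
    rw [eval, iht h.2, ihs h.1]
  | ifz y s t ihs iht =>
    simp only [writesVar, Bool.or_eq_false_iff] at h
    rw [eval]
    split_ifs
    · exact ihs h.1 σ
    · exact iht h.2 σ
  | loop y s ih =>
    exact eval_loop_induction (fun _ τ => τ.v x = σ.v x) rfl fun _ τ _ hτ => (ih h τ).trans hτ
  | _ => simp_all [writesVar, eval]

theorem eval_a_of_not_writesArr {s : Cmd V A} {c : A} (h : s.writesArr c = false)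
    (σ : Store V A) : (s.eval σ).a c = σ.a c := by
  induction s generalizing σ with
  | seq s t ihs iht =>
    simp only [writesArr, Bool.or_eq_false_iff] at h
    rw [eval, iht h.2, ihs h.1]
  | ifz y s t ihs iht =>
    simp only [writesArr, Bool.or_eq_false_iff] at h
    rw [eval]
    split_ifs
    · exact ihs h.1 σ
    · exact iht h.2 σ
  | loop y s ih =>
    exact eval_loop_induction (fun _ τ => τ.a c = σ.a c) rfl fun _ τ _ hτ => (ih h τ).trans hτ
  | _ => simp_all [writesArr, eval]

theorem eval_loop_succ (σ : Store V A) (x y : V) :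
    (loop y (succ x)).eval σ = ⟨Function.update σ.v x (σ.v x + σ.v y), σ.a⟩ :=
  eval_loop_induction (fun i τ => τ = ⟨Function.update σ.v x (σ.v x + i), σ.a⟩) (by simp) (by
    rintro i τ - rfl
    simp [add_assoc])

theorem eval_loop_loop_induction {x : V} {s : Cmd V A} {σ : Store V A} {m : ℕ}
    (I : ℕ → Store V A → Prop) (hm : σ.v x = m) (hx : s.writesVar x = false) (h0 : I 0 σ)
    (hs : ∀ i τ, i < m * m → I i τ → I (i + 1) (s.eval τ)) :
    I (m * m) ((loop x (loop x s)).eval σ) := by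
  subst hm
  refine (eval_loop_induction (fun i τ => τ.v x = σ.v x ∧ I (i * σ.v x) τ) ⟨rfl, by simpa⟩ ?_).2
  rintro i τ hi ⟨hτ, hI⟩
  have hloop := eval_loop_induction (x := x) (fun j τ' => I (i * σ.v x + j) τ') hI
    fun j τ' hj h => hs _ _ (by
      rw [hτ] at hj
      calc i * σ.v x + j < (i + 1) * σ.v x := by rw [add_mul]; omega
        _ ≤ σ.v x * σ.v x := Nat.mul_le_mul_right _ hi) h
  rw [hτ] at hloop
  exact ⟨(eval_v_of_not_writesVar (s := loop x s) hx τ).trans hτ, by rwa [add_mul, one_mul]⟩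

/-! ### Polynomial running time -/

/-- Whether all loops of the command are governed by variables in `Z`, which are never assigned
to. -/
def loopsIn (Z : V → Bool) : Cmd V A → Bool
  | const y _ | copy y _ | succ y | sub y _ _ | load y _ _ => !Z y
  | seq s t | ifz _ s t => s.loopsIn Z && t.loopsIn Z
  | loop x s => Z x && s.loopsIn Z
  | _ => true

/-- A bound for the running time when no loop is repeated more than `N` times. -/
def bound (N : ℕ) : Cmd V A → ℕ
  | skip => 0
  | seq s t => s.bound N + t.bound N
  | ifz _ s t => 1 + (s.bound N + t.bound N)
  | loop _ s => 1 + N * (1 + s.bound N)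
  | _ => 1

omit [DecidableEq A] in
theorem writesVar_eq_false_of_loopsIn {Z : V → Bool} {s : Cmd V A} (h : s.loopsIn Z = true)
    {x : V} (hx : Z x = true) : s.writesVar x = false := by
  induction s with
  | seq s t ihs iht | ifz _ s t ihs iht =>
    simp only [loopsIn, Bool.and_eq_true] at h
    simp [writesVar, ihs h.1, iht h.2]
  | loop y s ih =>
    simp only [loopsIn, Bool.and_eq_true] at h
    exact ih h.2
  | skip | store => rfl
  | _ =>
    simp only [loopsIn, Bool.not_eq_true'] at h
    simp only [writesVar, decide_eq_false_iff_not]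
    rintro rfl
    simp [h] at hx

theorem steps_le_bound {Z : V → Bool} {N : ℕ} {s : Cmd V A} (h : s.loopsIn Z = true)
    (σ : Store V A) (hσ : ∀ x, Z x = true → σ.v x ≤ N) : s.steps σ ≤ s.bound N := by
  induction s generalizing σ with
  | seq s t ihs iht =>
    simp only [loopsIn, Bool.and_eq_true] at h
    refine Nat.add_le_add (ihs h.1 σ hσ) (iht h.2 _ fun x hx => ?_)
    rw [eval_v_of_not_writesVar (writesVar_eq_false_of_loopsIn h.1 hx)]
    exact hσ x hx
  | ifz y s t ihs iht =>
    simp only [loopsIn, Bool.and_eq_true] at h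
    have h1 := ihs h.1 σ hσ
    have h2 := iht h.2 σ hσ
    simp only [steps, bound]
    split_ifs <;> omega
  | loop y s ih =>
    simp only [loopsIn, Bool.and_eq_true] at h
    refine (steps_loop_le (fun _ τ => ∀ x, Z x = true → τ.v x ≤ N) (fun _ => s.bound N) hσ
      (fun _ τ hτ x hx => ?_) fun _ τ hτ => ih h.2 τ hτ).trans ?_
    · rw [eval_v_of_not_writesVar (writesVar_eq_false_of_loopsIn h.2 hx)]
      exact hτ x hx
    · rw [Finset.sum_const, Finset.card_range, smul_eq_mul]
      exact Nat.add_le_add_left (Nat.mul_le_mul_right _ (hσ y h.1)) 1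
  | _ => simp [steps, bound]

theorem pow_add_pow_le_pow {b : ℕ} (hb : 2 ≤ b) (e f : ℕ) : b ^ e + b ^ f ≤ b ^ (e + f + 1) := by
  have he : b ^ e ≤ b ^ (e + f) := Nat.pow_le_pow_right (by omega) (by omega)
  have hf : b ^ f ≤ b ^ (e + f) := Nat.pow_le_pow_right (by omega) (by omega)
  calc b ^ e + b ^ f ≤ b ^ (e + f) * 2 := by omega
    _ ≤ b ^ (e + f + 1) := Nat.mul_le_mul_left _ hb

omit [DecidableEq V] [DecidableEq A] in
theorem exists_bound_le_pow (s : Cmd V A) : ∃ e, ∀ N, s.bound N ≤ (N + 2) ^ e := by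
  have hadd (N e f : ℕ) := pow_add_pow_le_pow (b := N + 2) (by omega) e f
  induction s with
  | skip => exact ⟨0, fun N => Nat.zero_le _⟩
  | seq s t ihs iht =>
    obtain ⟨e, he⟩ := ihs
    obtain ⟨f, hf⟩ := iht
    exact ⟨_, fun N => (Nat.add_le_add (he N) (hf N)).trans (hadd N e f)⟩
  | ifz x s t ihs iht =>
    obtain ⟨e, he⟩ := ihs
    obtain ⟨f, hf⟩ := iht
    exact ⟨_, fun N => (Nat.add_le_add_left ((Nat.add_le_add (he N) (hf N)).trans (hadd N e f))
      1).trans (hadd N 0 _)⟩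
  | loop x s ih =>
    obtain ⟨e, he⟩ := ih
    refine ⟨0 + (0 + e + 1 + 1) + 1, fun N => le_trans ?_ (hadd N 0 _)⟩
    rw [pow_zero, pow_succ _ (0 + e + 1), mul_comm (_ ^ _)]
    exact Nat.add_le_add_left (Nat.mul_le_mul (by omega)
      ((Nat.add_le_add_left (he N) 1).trans (hadd N 0 e))) 1
  | _ => exact ⟨0, fun N => le_rfl⟩

end Cmd

/-! ### Compiling commands for the machine -/

namespace RAM

theorem len_mono {x y : ℕ} (h : x ≤ y) : len x ≤ len y :=
  Nat.add_le_add_right (Nat.size_le_size h) 1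

/-- The sum of the numbers that occur in an instruction. -/
def Instr.weight : Instr → ℕ
  | .const d v => d + v
  | .copy d s => d + s
  | .succ d => d
  | .add d a b => d + a + b
  | .sub d a b => d + a + b
  | .load d a => d + a
  | .store a s => a + s
  | .jump l => l
  | .jzero a l => a + l

theorem Instr.cost_le {i : Instr} {c : Config} {U : ℕ} (hi : i.weight < U)
    (hc : ∀ r, c.reg r < U) : i.cost c ≤ 5 * len U := by
  have hlen (x : ℕ) (hx : x < U) : len x ≤ len U := len_mono hx.le
  have hreg (r : ℕ) := hlen _ (hc r)
  cases i with (simp only [weight] at hi; simp only [cost])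
  | const d v => linarith [hlen d (by omega), hlen v (by omega)]
  | copy d s => linarith [hlen d (by omega), hlen s (by omega), hreg s]
  | succ d => linarith [hlen d (by omega), hreg d]
  | add d a b | sub d a b =>
    linarith [hlen d (by omega), hlen a (by omega), hlen b (by omega), hreg a, hreg b]
  | load d a => linarith [hlen d (by omega), hlen a (by omega), hreg a, hreg (c.reg a)]
  | store a s => linarith [hlen a (by omega), hlen s (by omega), hreg a, hreg s]
  | jump l => linarith [hlen l (by omega)]
  | jzero a l => linarith [hlen a (by omega), hlen l (by omega), hreg a]

theorem update_lt {reg : ℕ → ℕ} {M d x : ℕ} (hreg : ∀ r, reg r < M) (hx : x < M) (r : ℕ) :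
    Function.update reg d x r < M := by
  rcases eq_or_ne r d with rfl | hr
  · rwa [Function.update_self]
  · rw [Function.update_of_ne hr]
    exact hreg r

theorem Instr.exec_reg_lt {i : Instr} {c : Config} {M : ℕ} (hi : i.weight < M)
    (hc : ∀ r, c.reg r < M) : ∀ r, (i.exec c).reg r < 2 * M := by
  have hc2 (r : ℕ) : c.reg r < 2 * M := by linarith [hc r]
  cases i with
  | const d v => exact update_lt hc2 (by simp only [weight] at hi; omega)
  | copy d s => exact update_lt hc2 (hc2 s)
  | succ d => exact update_lt hc2 (by linarith [hc d])
  | add d a b => exact update_lt hc2 (by linarith [hc a, hc b])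
  | sub d a b => exact update_lt hc2 ((Nat.sub_le _ _).trans_lt (hc2 a))
  | load d a => exact update_lt hc2 (hc2 _)
  | store a s => exact update_lt hc2 (hc2 s)
  | jump l | jzero a l => exact hc2

/-- `Reaches P U c t c'`: the program `P` leads from `c` to `c'` in at most `t` steps, and the
registers hold numbers below `U` before each of them. -/
inductive Reaches (P : Program) (U : ℕ) : Config → ℕ → Config → Prop
  | refl (c : Config) (t : ℕ) : Reaches P U c t c
  | step {c c' : Config} {i : Instr} {t : ℕ} (hc : ∀ r, c.reg r < U) (hi : P[c.pc]? = some i)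
      (h : Reaches P U (i.exec c) t c') : Reaches P U c (t + 1) c'

section Reaches

variable {P : Program} {U M : ℕ} {c c' c'' : Config} {t t' : ℕ} {i : Instr} {l l' : List Instr}

theorem Reaches.mono (h : Reaches P U c t c') (ht : t ≤ t') : Reaches P U c t' c' := by
  induction h generalizing t' with
  | refl c => exact .refl c t'
  | step hc hi _ ih =>
    obtain ⟨k, rfl⟩ := Nat.exists_eq_add_of_le' ht
    exact .step hc hi (ih (Nat.le_add_left _ k))

theorem Reaches.trans (h : Reaches P U c t c') (h' : Reaches P U c' t' c'') :
    Reaches P U c (t + t') c'' := by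
  induction h with
  | refl c t => exact h'.mono (by omega)
  | step hc hi _ ih =>
    rw [add_right_comm]
    exact .step hc hi (ih h')

theorem Reaches.exists_runs (h : Reaches P U c t c') (hP : ∀ i ∈ P, i.weight < U) :
    ∃ T ≤ t * (5 * len U), Runs P c T c' := by
  induction h with
  | refl c t => exact ⟨0, Nat.zero_le _, .refl c⟩
  | step hc hi _ ih =>
    obtain ⟨T, hT, h⟩ := ih
    refine ⟨_, ?_, .step hi h⟩
    rw [add_mul, one_mul, add_comm]
    exact Nat.add_le_add hT (Instr.cost_le (hP _ (List.mem_of_getElem? hi)) hc)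

/-- The instructions `l` stand in the program `P` from number `o` on. -/
def CodeAt (P : Program) (o : ℕ) (l : List Instr) : Prop := l <+: P.drop o

namespace CodeAt

variable {o : ℕ}

theorem left (h : CodeAt P o (l ++ l')) : CodeAt P o l :=
  (l.prefix_append l').trans h

theorem right (h : CodeAt P o (l ++ l')) : CodeAt P (o + l.length) l' := by
  obtain ⟨l₂, h⟩ := h
  refine ⟨l₂, ?_⟩
  rw [← List.drop_drop, ← h, List.append_assoc, List.drop_left]

theorem head (h : CodeAt P o (i :: l)) : P[o]? = some i := by
  obtain ⟨l₂, h⟩ := h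
  rw [← o.add_zero, ← List.getElem?_drop, ← h, List.cons_append, List.getElem?_cons_zero]

theorem tail (h : CodeAt P o (i :: l)) : CodeAt P (o + 1) l :=
  right (l := [i]) h

theorem reaches_straight (h : CodeAt P c.pc l) (hl : ∀ i ∈ l, ∀ c, (i.exec c).pc = c.pc + 1)
    (hP : ∀ i ∈ P, i.weight < M) (hc : ∀ r, c.reg r < M) (hU : 2 ^ l.length * M ≤ U) :
    Reaches P U c l.length ⟨c.pc + l.length, (l.foldl (fun c i => i.exec c) c).reg⟩ := by
  induction l generalizing c M with
  | nil => exact .refl c 0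
  | cons i l ih =>
    have hpc : (i.exec c).pc = c.pc + 1 := hl i List.mem_cons_self c
    have hM : M ≤ 2 ^ (i :: l).length * M := Nat.le_mul_of_pos_left M (by positivity)
    have hrest := ih (c := i.exec c) (M := 2 * M) (by rw [hpc]; exact h.tail)
      (fun j hj => hl j (List.mem_cons_of_mem i hj)) (fun j hj => by linarith [hP j hj])
      (Instr.exec_reg_lt (hP i (List.mem_of_getElem? h.head)) hc)
      (by rwa [← mul_assoc, ← pow_succ])
    rw [hpc, add_assoc, add_comm 1] at hrest
    exact .step (fun r => (hc r).trans_le (hM.trans hU)) h.head hrest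

end CodeAt

/-- Repeat `body`, whose first instruction gets the number `o + 1`, as often as register `r` says;
register `2` is used for the subtraction. -/
def countdown (r o : ℕ) (body : List Instr) : List Instr :=
  .jzero r (o + body.length + 4) :: body ++ [.const 2 1, .sub r r 2, .jump o]

theorem CodeAt.reaches_countdown {r o m : ℕ} {body : List Instr} {reg : ℕ → ℕ}
    (h : CodeAt P o (countdown r o body)) (hr : r ≠ 2) (hU : 1 < U) (I : ℕ → (ℕ → ℕ) → Prop)
    (f : ℕ → ℕ) (hI : ∀ j ≤ m, ∀ reg, I j reg → reg r = m - j ∧ ∀ q, reg q < U) (h0 : I 0 reg)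
    (hs : ∀ j < m, ∀ reg, I j reg → ∃ reg', Reaches P U ⟨o + 1, reg⟩ (f j)
      ⟨o + 1 + body.length, reg'⟩ ∧ (∀ q, reg' q < U) ∧
      I (j + 1) (Function.update (Function.update reg' 2 1) r (reg' r - 1))) :
    ∃ reg', Reaches P U ⟨o, reg⟩ (∑ j ∈ Finset.range m, (f j + 4) + 1) ⟨o + body.length + 4, reg'⟩ ∧
      I m reg' := by
  have hend := h.tail.right
  suffices ∀ j ≤ m, ∃ reg', Reaches P U ⟨o, reg⟩ (∑ j ∈ Finset.range j, (f j + 4)) ⟨o, reg'⟩ ∧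
      I j reg' by
    obtain ⟨reg', hrun, hm⟩ := this m le_rfl
    obtain ⟨hzero, hlt⟩ := hI m le_rfl _ hm
    refine ⟨reg', hrun.trans (.step hlt h.head ?_), hm⟩
    rw [Instr.exec, if_pos (by simpa using hzero)]
    exact .refl _ _
  intro j
  induction j with
  | zero => exact fun _ => ⟨reg, .refl _ _, h0⟩
  | succ j ih =>
    intro hj
    obtain ⟨reg₁, hrun, h1⟩ := ih (by omega)
    obtain ⟨hcount, hlt⟩ := hI j (by omega) _ h1
    obtain ⟨reg₂, hbody, hlt₂, h2⟩ := hs j hj _ h1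
    refine ⟨_, ?_, h2⟩
    rw [Finset.sum_range_succ]
    refine hrun.trans (.step hlt h.head ?_)
    rw [Instr.exec, if_neg (by simp only [hcount]; omega)]
    refine hbody.trans (.step hlt₂ hend.head (.step (update_lt hlt₂ hU) hend.tail.head ?_))
    refine .step (update_lt (update_lt hlt₂ hU) ?_) hend.tail.tail.head ?_
    · exact (Nat.sub_le _ _).trans_lt (update_lt hlt₂ hU r)
    · simp only [Instr.exec, Function.update_self, Function.update_of_ne hr]
      exact .refl _ _

end Reaches

end RAM

namespace RAM

/-- A numbering of the variables and arrays, which fixes their places in the registers: variable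
number `j` stands in register `16 * j`, and entry `i` of array number `j` in register
`16 * i + 3 + j`. The registers with address `1` modulo `16` are left for loop counters, those with
address `2` modulo `16` for auxiliary calculations. -/
structure Layout (V A : Type) : Type where
  var : V → ℕ
  arr : A → ℕ
  var_inj : Function.Injective var
  arr_inj : Function.Injective arr
  arr_lt : ∀ c, arr c < 13

namespace Layout

variable {V A : Type} (Λ : Layout V A)

/-- The values of the variables and arrays that stand in the registers. -/
def view (reg : ℕ → ℕ) : Store V A :=
  ⟨fun x => reg (16 * Λ.var x), fun c i => reg (16 * i + 3 + Λ.arr c)⟩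

theorem view_v (reg : ℕ → ℕ) (x : V) : (Λ.view reg).v x = reg (16 * Λ.var x) := rfl

theorem view_a (reg : ℕ → ℕ) (c : A) (i : ℕ) : (Λ.view reg).a c i = reg (16 * i + 3 + Λ.arr c) :=
  rfl

theorem view_update_of_mod (reg : ℕ → ℕ) {d : ℕ} (hd : d % 16 = 1 ∨ d % 16 = 2) (m : ℕ) :
    Λ.view (Function.update reg d m) = Λ.view reg := by
  ext y
  · rw [view_v, view_v, Function.update_of_ne (by omega)]
  · have := Λ.arr_lt y
    rw [view_a, view_a, Function.update_of_ne (by omega)]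

theorem view_update_var [DecidableEq V] (reg : ℕ → ℕ) (x : V) (m : ℕ) :
    Λ.view (Function.update reg (16 * Λ.var x) m) =
      ⟨Function.update (Λ.view reg).v x m, (Λ.view reg).a⟩ := by
  ext y
  · simp [view, Function.update_apply, Λ.var_inj.eq_iff]
  · have := Λ.arr_lt y
    simp only [view]
    rw [Function.update_of_ne (by omega)]

theorem view_update_arr [DecidableEq A] (reg : ℕ → ℕ) (c : A) (i m : ℕ) :
    Λ.view (Function.update reg (16 * i + 3 + Λ.arr c) m) =
      ⟨(Λ.view reg).v, Function.update (Λ.view reg).a c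
        (Function.update ((Λ.view reg).a c) i m)⟩ := by
  have hc := Λ.arr_lt c
  ext y j
  · simp only [view]
    rw [Function.update_of_ne (by omega)]
  · have hy := Λ.arr_lt y
    have hadd : 16 * j + 3 + Λ.arr y = 16 * i + 3 + Λ.arr c ↔ j = i ∧ y = c := by
      rw [← Λ.arr_inj.eq_iff]
      omega
    by_cases hyc : y = c
    · subst hyc
      simp [view, Function.update_apply]
    · simp [view, Function.update_apply, hadd, hyc]

/-- Compute the address of `c[i]` in register `2`. -/
def address (c : A) (i : V) : List Instr :=
  [.copy 2 (16 * Λ.var i), .add 2 2 2, .add 2 2 2, .add 2 2 2, .add 2 2 2,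
    .const 18 (3 + Λ.arr c), .add 2 2 18]

/-- The number of instructions of a compiled command. -/
def size : Cmd V A → ℕ
  | .skip => 0
  | .load _ _ _ | .store _ _ _ => 10
  | .seq s t => size s + size t
  | .ifz _ s t => size t + size s + 2
  | .loop _ s => size s + 5
  | _ => 1

/-- The code for a command inside `d` loops, to be placed from instruction number `o` on. -/
def code : Cmd V A → ℕ → ℕ → List Instr
  | .skip, _, _ => []
  | .const x c, _, _ => [.const (16 * Λ.var x) c]
  | .copy x y, _, _ => [.copy (16 * Λ.var x) (16 * Λ.var y)]
  | .succ x, _, _ => [.succ (16 * Λ.var x)]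
  | .sub x y z, _, _ => [.sub (16 * Λ.var x) (16 * Λ.var y) (16 * Λ.var z)]
  | .load x c i, _, _ => Λ.address c i ++ [.load (16 * Λ.var x) 2, .const 2 0, .const 18 0]
  | .store c i y, _, _ => Λ.address c i ++ [.store 2 (16 * Λ.var y), .const 2 0, .const 18 0]
  | .seq s t, d, o => code s d o ++ code t d (o + size s)
  | .ifz x s t, d, o => .jzero (16 * Λ.var x) (o + size t + 2) :: code t d (o + 1) ++
      .jump (o + size t + size s + 2) :: code s d (o + size t + 2)
  | .loop x s, d, o =>
      .copy (16 * d + 1) (16 * Λ.var x) :: countdown (16 * d + 1) (o + 1) (code s (d + 1) (o + 2))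

theorem length_code (s : Cmd V A) (d o : ℕ) : (Λ.code s d o).length = size s := by
  induction s generalizing d o with
  | seq s t ihs iht => simp [code, size, ihs, iht]
  | ifz x s t ihs iht => simp [code, size, ihs, iht]; omega
  | loop x s ih => simp [code, countdown, size, ih]
  | _ => simp [code, size, address]

variable [DecidableEq V] [DecidableEq A]

/-- The code of the command `s` has the effect of `s` wherever it stands in the program `P`, takes
time proportional to the running time of `s`, and preserves the counters of the loops around it, as
long as `U` exceeds all relevant numbers by a certain factor. -/
def Compiles (P : Program) (U : ℕ) (s : Cmd V A) : Prop :=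
  ∀ (d o v : ℕ) (reg : ℕ → ℕ), CodeAt P o (Λ.code s d o) → (∀ i ∈ P, i.weight < v) →
    (∀ r, reg r < v) → 2 ^ 10 * (v + s.steps (Λ.view reg)) ≤ U →
    ∃ reg', Reaches P U ⟨o, reg⟩ (12 * s.steps (Λ.view reg)) ⟨o + size s, reg'⟩ ∧
      Λ.view reg' = s.eval (Λ.view reg) ∧ (∀ r, reg' r < v + s.steps (Λ.view reg)) ∧
      ∀ d' < d, reg' (16 * d' + 1) = reg (16 * d' + 1)

variable {Λ} {P : Program} {U d o v : ℕ} {reg : ℕ → ℕ} {s t : Cmd V A}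

omit [DecidableEq A] in
theorem exists_reaches_assign {i : Instr} {x : V} {m : ℕ} (hi : P[o]? = some i)
    (hexec : i.exec ⟨o, reg⟩ = ⟨o + 1, Function.update reg (16 * Λ.var x) m⟩)
    (hreg : ∀ r, reg r < v) (hm : m < v + 1) (hU : 2 ^ 10 * (v + 1) ≤ U) :
    ∃ reg', Reaches P U ⟨o, reg⟩ 12 ⟨o + 1, reg'⟩ ∧
      Λ.view reg' = ⟨Function.update (Λ.view reg).v x m, (Λ.view reg).a⟩ ∧
      (∀ r, reg' r < v + 1) ∧ ∀ d' < d, reg' (16 * d' + 1) = reg (16 * d' + 1) := by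
  refine ⟨_, .step (fun r => (hreg r).trans_le (by omega)) hi (hexec ▸ .refl _ _),
    Λ.view_update_var _ _ _, update_lt (fun r => (hreg r).trans (Nat.lt_succ_self v)) hm,
    fun d' _ => ?_⟩
  rw [Function.update_of_ne (by omega)]

theorem compiles_const {x : V} {c : ℕ} : Λ.Compiles P U (.const x c) := by
  intro d o v reg h hP hreg hU
  have hc : 16 * Λ.var x + c < v := hP _ (List.mem_of_getElem? h.head)
  exact exists_reaches_assign h.head rfl hreg (by omega) hU

theorem compiles_copy {x y : V} : Λ.Compiles P U (.copy x y) :=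
  fun _ _ _ _ h _ hreg hU => exists_reaches_assign h.head rfl hreg ((hreg _).trans (by omega)) hU

theorem compiles_succ {x : V} : Λ.Compiles P U (.succ x) :=
  fun _ _ _ _ h _ hreg hU => exists_reaches_assign h.head rfl hreg (Nat.succ_lt_succ (hreg _)) hU

theorem compiles_sub {x y z : V} : Λ.Compiles P U (.sub x y z) :=
  fun _ _ _ _ h _ hreg hU => exists_reaches_assign h.head rfl hreg
    ((Nat.sub_le _ _).trans_lt ((hreg _).trans (by omega))) hU

/-- The registers after the address of `c[i]` has been computed. -/
def addressed (Λ : Layout V A) (c : A) (i : V) (reg : ℕ → ℕ) : ℕ → ℕ :=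
  Function.update (Function.update reg 18 (3 + Λ.arr c)) 2 (16 * (Λ.view reg).v i + 3 + Λ.arr c)

omit [DecidableEq V] [DecidableEq A] in
theorem foldl_exec_address (c : A) (i : V) (o : ℕ) (reg : ℕ → ℕ) :
    (Λ.address c i).foldl (fun c i => i.exec c) ⟨o, reg⟩ = ⟨o + 7, Λ.addressed c i reg⟩ := by
  simp only [address, addressed, Instr.exec, List.foldl_cons, List.foldl_nil, view_v,
    Function.update_self, Function.update_idem, Config.mk.injEq, true_and]
  funext r
  simp only [Function.update_apply]
  split_ifs <;> omega

omit [DecidableEq V] [DecidableEq A] in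
theorem exists_reaches_access {c : A} {i : V} {j : Instr} {a m : ℕ}
    (h : CodeAt P o (Λ.address c i ++ [j, .const 2 0, .const 18 0]))
    (hP : ∀ i ∈ P, i.weight < v) (hreg : ∀ r, reg r < v) (hU : 2 ^ 10 * (v + 1) ≤ U)
    (hj : ∀ c, (j.exec c).pc = c.pc + 1) (ha : a % 16 ≠ 1 ∧ a % 16 ≠ 2) (hm : m < v)
    (hexec : (j.exec ⟨o + 7, Λ.addressed c i reg⟩).reg =
      Function.update (Λ.addressed c i reg) a m) :
    ∃ reg', Reaches P U ⟨o, reg⟩ 12 ⟨o + 10, reg'⟩ ∧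
      Λ.view reg' = Λ.view (Function.update reg a m) ∧
      (∀ r, reg' r < v + 1) ∧ ∀ d' < d, reg' (16 * d' + 1) = reg (16 * d' + 1) := by
  have hstraight : ∀ k ∈ Λ.address c i ++ [j, .const 2 0, .const 18 0], ∀ c,
      (k.exec c).pc = c.pc + 1 := by
    simp only [address, List.cons_append, List.nil_append, List.forall_mem_cons, hj]
    simp [Instr.exec]
  have hrun := h.reaches_straight (c := ⟨o, reg⟩) hstraight hP hreg
    (le_trans (by simp [address]) hU)
  have hfinal : ((Λ.address c i ++ [j, .const 2 0, .const 18 0]).foldl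
      (fun c (i : Instr) => i.exec c) ⟨o, reg⟩).reg =
      Function.update (Function.update (Function.update reg a m) 2 0) 18 0 := by
    rw [List.foldl_append, foldl_exec_address]
    change Function.update (Function.update (j.exec ⟨o + 7, Λ.addressed c i reg⟩).reg 2 0) 18 0 = _
    rw [hexec, addressed]
    funext r
    simp only [Function.update_apply]
    split_ifs <;> rfl
  rw [hfinal] at hrun
  refine ⟨_, hrun.mono (by simp [address]), ?_, ?_, fun d' _ => ?_⟩
  · rw [view_update_of_mod _ _ (by omega), view_update_of_mod _ _ (by omega)]
  · have hv (r : ℕ) := (hreg r).trans (Nat.lt_succ_self v)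
    exact update_lt (update_lt (update_lt hv (by omega)) (by omega)) (by omega)
  · rw [Function.update_of_ne (by omega), Function.update_of_ne (by omega),
      Function.update_of_ne (by omega)]

theorem compiles_load {x : V} {c : A} {i : V} : Λ.Compiles P U (.load x c i) := by
  intro d o v reg h hP hreg hU
  have hc := Λ.arr_lt c
  obtain ⟨reg', hrun, hview, hrest⟩ := exists_reaches_access (d := d) (a := 16 * Λ.var x) h hP hreg
    hU (fun _ => rfl) (by omega) (hreg (16 * (Λ.view reg).v i + 3 + Λ.arr c)) (by
      simp only [Instr.exec, addressed, Function.update_self]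
      rw [Function.update_of_ne (a := 16 * _ + 3 + _) (by omega),
        Function.update_of_ne (a := 16 * _ + 3 + _) (by omega)])
  exact ⟨reg', hrun, hview.trans (Λ.view_update_var _ _ _), hrest⟩

theorem compiles_store {c : A} {i y : V} : Λ.Compiles P U (.store c i y) := by
  intro d o v reg h hP hreg hU
  have hc := Λ.arr_lt c
  obtain ⟨reg', hrun, hview, hrest⟩ := exists_reaches_access (d := d)
    (a := 16 * (Λ.view reg).v i + 3 + Λ.arr c) h hP hreg hU (fun _ => rfl) (by omega)
    (hreg (16 * Λ.var y)) (by
      simp only [Instr.exec, addressed, Function.update_self]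
      rw [Function.update_of_ne (a := 16 * Λ.var y) (by omega),
        Function.update_of_ne (a := 16 * Λ.var y) (by omega)])
  exact ⟨reg', hrun, hview.trans (Λ.view_update_arr _ _ _ _), hrest⟩

theorem Compiles.seq (hs : Λ.Compiles P U s) (ht : Λ.Compiles P U t) :
    Λ.Compiles P U (.seq s t) := by
  intro d o v reg h hP hreg hU
  simp only [Cmd.steps] at hU ⊢
  obtain ⟨reg₁, hrun₁, hview₁, hreg₁, hcount₁⟩ := hs d o v reg h.left hP hreg (by omega)
  have hcode := h.right
  rw [length_code] at hcode
  obtain ⟨reg₂, hrun₂, hview₂, hreg₂, hcount₂⟩ := ht d _ _ reg₁ hcode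
    (fun i hi => (hP i hi).trans_le (Nat.le_add_right _ _)) hreg₁ (by rw [hview₁]; omega)
  rw [hview₁] at hrun₂ hview₂ hreg₂
  refine ⟨reg₂, ?_, hview₂, by rwa [← add_assoc],
    fun d' hd => (hcount₂ d' hd).trans (hcount₁ d' hd)⟩
  rw [mul_add, size, ← add_assoc]
  exact hrun₁.trans hrun₂

theorem Compiles.ifz {x : V} (hs : Λ.Compiles P U s) (ht : Λ.Compiles P U t) :
    Λ.Compiles P U (.ifz x s t) := by
  intro d o v reg h hP hreg hU
  rw [code, List.cons_append] at h
  have hjump := h.tail.right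
  rw [length_code] at hjump
  have hregU (r : ℕ) : reg r < U := (hreg r).trans_le (by omega)
  by_cases hx : (Λ.view reg).v x = 0 <;>
    simp only [Cmd.steps, Cmd.eval, hx, if_true, if_false] at hU ⊢
  · obtain ⟨reg₁, hrun, hview, hreg₁, hcount⟩ := hs d (o + size t + 2) v reg
      (by convert hjump.tail using 1; omega) hP hreg (by omega)
    refine ⟨reg₁, .mono (.step hregU h.head ?_) (t := 12 * s.steps (Λ.view reg) + 1) (by omega),
      hview, fun r => (hreg₁ r).trans_le (by omega), hcount⟩
    rw [view_v] at hx
    rw [Instr.exec, if_pos hx]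
    convert hrun using 2
    simp only [size]
    omega
  · obtain ⟨reg₁, hrun, hview, hreg₁, hcount⟩ := ht d (o + 1) v reg h.tail.left hP hreg (by omega)
    refine ⟨reg₁, .mono (.step hregU h.head ?_) (t := 12 * t.steps (Λ.view reg) + 1 + 1) (by omega),
      hview, fun r => (hreg₁ r).trans_le (by omega), hcount⟩
    rw [view_v] at hx
    rw [Instr.exec, if_neg hx]
    refine hrun.trans (.step (fun r => (hreg₁ r).trans_le (by omega)) hjump.head ?_)
    have hpc : o + size (.ifz x s t) = o + size t + size s + 2 := by simp only [size]; omega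
    rw [hpc]
    exact .refl _ 0

/-- The invariant of the compiled loop over `s` at depth `d`, started with the registers `reg` and
the counter `m`, after `j` rounds. -/
def LoopInvariant (Λ : Layout V A) (s : Cmd V A) (d v m : ℕ) (reg : ℕ → ℕ) (j : ℕ)
    (reg' : ℕ → ℕ) : Prop :=
  Λ.view reg' = s.eval^[j] (Λ.view reg) ∧
    (∀ r, reg' r < v + ∑ i ∈ Finset.range j, (1 + s.steps (s.eval^[i] (Λ.view reg)))) ∧
    reg' (16 * d + 1) = m - j ∧ ∀ d' < d, reg' (16 * d' + 1) = reg (16 * d' + 1)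

theorem Compiles.exists_reaches_loopInvariant {m j : ℕ} {reg₁ : ℕ → ℕ} (hs : Λ.Compiles P U s)
    (h : CodeAt P o (Λ.code s (d + 1) o)) (hP : ∀ i ∈ P, i.weight < v)
    (hI : Λ.LoopInvariant s d v m reg j reg₁)
    (hU : 2 ^ 10 * (v + ∑ i ∈ Finset.range (j + 1), (1 + s.steps (s.eval^[i] (Λ.view reg)))) ≤ U) :
    ∃ reg₂, Reaches P U ⟨o, reg₁⟩ (12 * s.steps (s.eval^[j] (Λ.view reg))) ⟨o + size s, reg₂⟩ ∧
      (∀ r, reg₂ r < U) ∧ Λ.LoopInvariant s d v m reg (j + 1)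
        (Function.update (Function.update reg₂ 2 1) (16 * d + 1) (reg₂ (16 * d + 1) - 1)) := by
  obtain ⟨hview, hlt, hcounter, hcount⟩ := hI
  rw [Finset.sum_range_succ] at hU
  obtain ⟨reg₂, hrun, hview₂, hlt₂, hcount₂⟩ := hs (d + 1) o _ reg₁ h
    (fun i hi => (hP i hi).trans_le (Nat.le_add_right _ _)) hlt (by rw [hview]; omega)
  rw [hview] at hrun hview₂ hlt₂
  have hlt₃ (r : ℕ) : reg₂ r < v + ∑ i ∈ Finset.range (j + 1),
      (1 + s.steps (s.eval^[i] (Λ.view reg))) := by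
    rw [Finset.sum_range_succ]
    exact (hlt₂ r).trans_le (by omega)
  have hone : 1 < v + ∑ i ∈ Finset.range (j + 1), (1 + s.steps (s.eval^[i] (Λ.view reg))) := by
    have := hlt 0
    rw [Finset.sum_range_succ]
    omega
  refine ⟨reg₂, hrun, fun r => (hlt₂ r).trans_le (by omega), ?_,
    update_lt (update_lt hlt₃ hone) ((Nat.sub_le _ _).trans_lt (hlt₃ _)), ?_, fun d' hd => ?_⟩
  · rw [view_update_of_mod _ _ (by omega), view_update_of_mod _ _ (by omega), hview₂,
      Function.iterate_succ_apply']
  · rw [Function.update_self, hcount₂ d (by omega), hcounter, Nat.sub_sub]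
  · rw [Function.update_of_ne (by omega), Function.update_of_ne (by omega), hcount₂ d' (by omega),
      hcount d' hd]

theorem Compiles.loop {x : V} (hs : Λ.Compiles P U s) : Λ.Compiles P U (.loop x s) := by
  intro d o v reg h hP hreg hU
  set σ := Λ.view reg
  set T : ℕ → ℕ := fun j => ∑ i ∈ Finset.range j, (1 + s.steps (s.eval^[i] σ)) with hT
  have hTmono {j : ℕ} (hj : j ≤ σ.v x) : T j ≤ T (σ.v x) :=
    Finset.sum_le_sum_of_subset (Finset.range_subset_range.2 hj)
  have hTsum : ∑ j ∈ Finset.range (σ.v x), (12 * s.steps (s.eval^[j] σ) + 4) ≤ 12 * T (σ.v x) := by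
    rw [hT, Finset.mul_sum]
    exact Finset.sum_le_sum fun j _ => by omega
  change 2 ^ 10 * (v + (1 + T (σ.v x))) ≤ U at hU
  have hpos : 0 < v := (Nat.zero_le _).trans_lt (hreg 0)
  have hinit : Λ.LoopInvariant s d v (σ.v x) reg 0
      (Function.update reg (16 * d + 1) (σ.v x)) :=
    ⟨Λ.view_update_of_mod _ (by omega) _, update_lt hreg (hreg _), Function.update_self ..,
      fun d' hd => Function.update_of_ne (by omega) ..⟩
  obtain ⟨reg', hrun, hview, hlt, -, hcount⟩ := h.tail.reaches_countdown (U := U) (by omega)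
    (by omega) (Λ.LoopInvariant s d v (σ.v x) reg) (fun j => 12 * s.steps (s.eval^[j] σ))
    (fun j hj _ hI => ⟨hI.2.2.1, fun q => (hI.2.1 q).trans_le
      (show v + T j ≤ U by have := hTmono hj; omega)⟩)
    hinit fun j hj reg₁ hI => by
      rw [length_code]
      exact hs.exists_reaches_loopInvariant h.tail.tail.left hP hI
        (show 2 ^ 10 * (v + T (j + 1)) ≤ U by have : T (j + 1) ≤ _ := hTmono hj; omega)
  have hpc : o + 1 + size s + 4 = o + size (.loop x s) := by simp only [size]; omega
  rw [length_code, hpc] at hrun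
  have htime : 12 * T (σ.v x) + 1 + 1 ≤ 12 * (1 + T (σ.v x)) := by omega
  exact ⟨reg', .mono (.step (fun r => (hreg r).trans_le (by omega)) h.head
    (hrun.mono (t' := 12 * T (σ.v x) + 1) (by omega))) htime, hview,
    fun q => (hlt q).trans_le (show v + T (σ.v x) ≤ v + (1 + T (σ.v x)) by omega), hcount⟩

theorem compiles (s : Cmd V A) : Λ.Compiles P U s := by
  induction s with
  | skip =>
    intro d o v reg _ _ hreg _
    exact ⟨reg, .refl _ _, rfl, hreg, fun _ _ => rfl⟩
  | const x c => exact compiles_const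
  | copy x y => exact compiles_copy
  | succ x => exact compiles_succ
  | sub x y z => exact compiles_sub
  | load x c i => exact compiles_load
  | store c i y => exact compiles_store
  | seq s t hs ht => exact hs.seq ht
  | ifz x s t hs ht => exact hs.ifz ht
  | loop x s hs => exact hs.loop

end Layout

end RAM

namespace RAM

/-! ### Spreading out the input -/

/-- Move the contents of the registers `1` and `2` to the registers `n + 4` and `2 * n + 5`, where
`n` stands in register `0`. In the input these hold the entries `(1, 1)` and `(2, 2)` of the
adjacency matrix, about which there is nothing to remember. -/
def stow : List Instr :=
  [.copy 3 0, .succ 3, .succ 3, .succ 3, .succ 3, .store 3 1, .add 3 3 0, .succ 3, .store 3 2,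
    .copy 1 0]

/-- The registers after the contents of the registers `1` and `2` have been moved. -/
def stowed (reg : ℕ → ℕ) : ℕ → ℕ :=
  Function.update (Function.update reg (reg 0 + 4) (reg 1)) (2 * reg 0 + 5) (reg 2)

/-- Move the contents of register `3 + q` to register `16 * q + 3`, where `q` stands in
register `3`. -/
def relocate : List Instr :=
  [.const 2 3, .add 2 2 3, .load 1 2, .copy 2 3, .add 2 2 2, .add 2 2 2, .add 2 2 2, .add 2 2 2,
    .succ 2, .succ 2, .succ 2, .store 2 1]

/-- Started with `n` in register `0`, move the contents of register `3 + i` to register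
`16 * i + 3` for `i ≤ n * n + 2 * n + 5`. -/
def spread : List Instr :=
  stow ++ (countdown 1 10 [.add 3 3 0] ++ countdown 3 15 relocate)

variable {P : Program} {U M o : ℕ} {reg : ℕ → ℕ}

theorem foldl_exec_stow (reg : ℕ → ℕ) : stow.foldl (fun c i => i.exec c) ⟨0, reg⟩ =
    ⟨10, Function.update (Function.update (stowed reg) 3 (2 * reg 0 + 5)) 1 (reg 0)⟩ := by
  simp only [stow, stowed, List.foldl_cons, List.foldl_nil, Instr.exec, Function.update_self,
    Function.update_idem, Config.mk.injEq, true_and]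
  funext r
  grind [Function.update_apply]

theorem foldl_exec_relocate (reg : ℕ → ℕ) :
    (relocate.foldl (fun c (i : Instr) => i.exec c) ⟨o, reg⟩).reg =
      Function.update (Function.update (Function.update reg 1 (reg (3 + reg 3))) 2 (16 * reg 3 + 3))
        (16 * reg 3 + 3) (reg (3 + reg 3)) := by
  simp only [relocate, List.foldl_cons, List.foldl_nil, Instr.exec, Function.update_self,
    Function.update_idem]
  funext r
  grind [Function.update_apply]

theorem exists_reaches_add_mul {m n : ℕ} (h : CodeAt P o (countdown 1 o [.add 3 3 0]))
    (hreg : ∀ r, reg r < M) (h1 : reg 1 = m) (h0 : reg 0 = n) (hM : reg 3 + m * n < M)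
    (hU : M ≤ U) (hM1 : 1 < M) :
    ∃ reg', Reaches P U ⟨o, reg⟩ (5 * m + 1) ⟨o + 5, reg'⟩ ∧ reg' 3 = reg 3 + m * n ∧
      (∀ r, reg' r < M) ∧ ∀ r, r ≠ 1 → r ≠ 2 → r ≠ 3 → reg' r = reg r := by
  obtain ⟨reg', hrun, h3, -, hlt, hrest⟩ := h.reaches_countdown (by omega) (hM1.trans_le hU)
    (fun j reg' => reg' 3 = reg 3 + j * n ∧ reg' 1 = m - j ∧ (∀ r, reg' r < M) ∧
      ∀ r, r ≠ 1 → r ≠ 2 → r ≠ 3 → reg' r = reg r) (fun _ => 1)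
    (fun j _ _ hI => ⟨hI.2.1, fun r => (hI.2.2.1 r).trans_le hU⟩)
    ⟨by omega, by omega, hreg, fun _ _ _ _ => rfl⟩ fun j hj reg₁ ⟨h3, h1, hlt, hrest⟩ => by
      have hmul : (j + 1) * n ≤ m * n := Nat.mul_le_mul_right n hj
      have hsum : reg₁ 3 + reg₁ 0 = reg 3 + (j + 1) * n := by
        rw [h3, hrest 0 (by omega) (by omega) (by omega), h0, add_mul, one_mul, add_assoc]
      have hlt₂ : ∀ r, Function.update reg₁ 3 (reg₁ 3 + reg₁ 0) r < M :=
        update_lt hlt (by omega)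
      refine ⟨_, .step (fun r => (hlt r).trans_le hU) h.tail.head (.refl _ 0),
        fun r => (hlt₂ r).trans_le hU, ?_, ?_, update_lt (update_lt hlt₂ hM1)
          ((Nat.sub_le _ _).trans_lt (hlt₂ _)), fun r hr₁ hr₂ hr₃ => ?_⟩
      · simpa using hsum
      · simp [h1, Nat.sub_sub]
      · simp [hr₁, hr₂, hr₃, hrest r hr₁ hr₂ hr₃]
  exact ⟨reg', hrun.mono (by simp [mul_comm]), h3, hlt, hrest⟩

/-- The state after the registers `N + 3, …, N + 4 - j` have been relocated. -/
structure Relocated (M N : ℕ) (reg : ℕ → ℕ) (j : ℕ) (reg' : ℕ → ℕ) : Prop where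
  zero : reg' 0 = reg 0
  counter : reg' 3 = N - j
  lt : ∀ r, reg' r < M
  below : ∀ r, 4 ≤ r → r ≤ 3 + (N - j) → reg' r = reg r
  above : ∀ i, N - j < i → i ≤ N → reg' (16 * i + 3) = reg (3 + i)

theorem Relocated.exists_reaches {N j : ℕ} {reg₁ : ℕ → ℕ} (hI : Relocated M N reg j reg₁)
    (hj : j < N) (h : CodeAt P o relocate) (hP : ∀ i ∈ P, i.weight < M) (hM : 16 * N + 3 < M)
    (hU : 2 ^ 12 * M ≤ U) :
    ∃ reg₂, Reaches P U ⟨o, reg₁⟩ 12 ⟨o + relocate.length, reg₂⟩ ∧ (∀ r, reg₂ r < U) ∧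
      Relocated M N reg (j + 1)
        (Function.update (Function.update reg₂ 2 1) 3 (reg₂ 3 - 1)) := by
  have hcounter := hI.counter
  have hrun := h.reaches_straight (c := ⟨o, reg₁⟩) (by simp [relocate, Instr.exec]) hP hI.lt hU
  rw [foldl_exec_relocate] at hrun
  have hlt₂ : ∀ r, Function.update (Function.update (Function.update reg₁ 1 (reg₁ (3 + reg₁ 3))) 2
      (16 * reg₁ 3 + 3)) (16 * reg₁ 3 + 3) (reg₁ (3 + reg₁ 3)) r < M :=
    update_lt (update_lt (update_lt hI.lt (hI.lt _)) (by omega)) (hI.lt _)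
  refine ⟨_, hrun, fun r => (hlt₂ r).trans_le (by omega), ?_, ?_,
    update_lt (update_lt hlt₂ (by omega)) ((Nat.sub_le _ _).trans_lt (hlt₂ _)),
    fun r hr hle => ?_, fun i hi hle => ?_⟩
  · simp [hI.zero]
  · rw [Function.update_self, Function.update_of_ne (by omega), Function.update_of_ne (by omega),
      Function.update_of_ne (by omega), hcounter, Nat.sub_sub]
  · rw [Function.update_of_ne (by omega), Function.update_of_ne (by omega),
      Function.update_of_ne (by omega), Function.update_of_ne (by omega),
      Function.update_of_ne (by omega), hI.below r hr (by omega)]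
  · rw [Function.update_of_ne (by omega), Function.update_of_ne (by omega)]
    obtain rfl | hne := eq_or_ne i (reg₁ 3)
    · rw [Function.update_self, hI.below _ (by omega) (by omega)]
    · rw [Function.update_of_ne (by omega), Function.update_of_ne (by omega),
        Function.update_of_ne (by omega), hI.above i (by omega) hle]

theorem exists_reaches_relocate {N : ℕ} (h : CodeAt P o (countdown 3 o relocate))
    (hP : ∀ i ∈ P, i.weight < M) (hreg : ∀ r, reg r < M) (h3 : reg 3 = N) (hM : 16 * N + 3 < M)
    (hU : 2 ^ 12 * M ≤ U) :
    ∃ reg', Reaches P U ⟨o, reg⟩ (16 * N + 1) ⟨o + 16, reg'⟩ ∧ Relocated M N reg N reg' := by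
  obtain ⟨reg', hrun, hI⟩ := h.reaches_countdown (by omega) (by omega) (Relocated M N reg)
    (fun _ => 12) (fun j _ _ hI => ⟨hI.counter, fun r => (hI.lt r).trans_le (by omega)⟩)
    ⟨rfl, h3, hreg, fun _ _ _ => rfl, fun i _ _ => by omega⟩
    fun j hj _ hI => hI.exists_reaches hj h.tail.left hP hM hU
  exact ⟨reg', hrun.mono (by simp [mul_comm]), hI⟩

theorem exists_reaches_spread {v n N : ℕ} (h : CodeAt P 0 spread) (hP : ∀ i ∈ P, i.weight < v)
    (hreg : ∀ r, reg r < v) (h0 : reg 0 = n) (hN : N = n * n + 2 * n + 5)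
    (hU : 2 ^ 12 * (v + 16 * N + 16) ≤ U) :
    ∃ reg', Reaches P U ⟨0, reg⟩ (22 * N) ⟨spread.length, reg'⟩ ∧ reg' 0 = n ∧ reg' 3 = 0 ∧
      (∀ r, reg' r < v + 16 * N + 16) ∧
      ∀ i, 1 ≤ i → i ≤ N → reg' (16 * i + 3) = stowed reg (3 + i) := by
  have hP' : ∀ i ∈ P, i.weight < v + 16 * N + 16 := fun i hi => (hP i hi).trans_le (by omega)
  have hlt (r : ℕ) : reg r < v + 16 * N + 16 := (hreg r).trans_le (by omega)
  have hstow := h.left.reaches_straight (c := ⟨0, reg⟩) (M := v + 16 * N + 16) (U := U)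
    (by simp [stow, Instr.exec]) hP' hlt (le_trans (by simp [stow]) hU)
  rw [foldl_exec_stow, h0] at hstow
  set reg₁ := Function.update (Function.update (stowed reg) 3 (2 * n + 5)) 1 n with hreg₁
  have hn : n < v := h0 ▸ hreg 0
  have hzero : reg₁ 0 = n := by simp [hreg₁, stowed, h0]
  have hone : reg₁ 1 = n := Function.update_self ..
  have hthree : reg₁ 3 = 2 * n + 5 := by simp [hreg₁]
  have hlt₁ : ∀ r, reg₁ r < v + 16 * N + 16 :=
    update_lt (update_lt (update_lt (update_lt hlt (hlt _)) (hlt _)) (by omega)) (by omega)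
  obtain ⟨reg₂, hmul, h3, hlt₂, hrest⟩ := exists_reaches_add_mul (U := U) h.right.left hlt₁
    hone hzero (by omega) (by omega) (by omega)
  have h3' : reg₂ 3 = N := by omega
  obtain ⟨reg₃, hrelocate, hI⟩ := exists_reaches_relocate h.right.right hP' hlt₂ h3' (by omega) hU
  refine ⟨reg₃, (hstow.trans (hmul.trans hrelocate)).mono ?_, ?_, ?_, hI.lt, fun i hi hle => ?_⟩
  · simp only [stow, List.length_cons, List.length_nil]
    nlinarith
  · rw [hI.zero, hrest 0 (by omega) (by omega) (by omega), hzero]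
  · rw [hI.counter, Nat.sub_self]
  · rw [hI.above i (by omega) hle, hrest _ (by omega) (by omega) (by omega), hreg₁,
      Function.update_of_ne (by omega), Function.update_of_ne (by omega)]

end RAM

/-! ### The algorithm -/

namespace VCL1.Algorithm

/-- The variables of the program. -/
inductive Var : Type
  | n | B | k | zero | one | level | rounds | twice | r | b | ans | bitCount | count | aux
  | s | t | w | ptr | cur | active | best | price | old | tau | u
  | v | c | out | cOut | gain | pos | tau₀ | tau₁ | carry
  deriving DecidableEq

/-- The arrays of the program: the adjacency matrix, the offsets of its rows, the indicator
functions of the vertices still to be covered and of those taking part in the auction, the prices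
and buyers of the vertices, and the answers. -/
inductive Arr : Type
  | adj | row | S | T | price | mate | bits
  deriving DecidableEq

open Cmd

/-- Compare the price of `w`, if it is a neighbour of `cur` in `T`, with the least price found. -/
def compare : Cmd Var Arr := block [
  load .t .adj .ptr,
  ifz .t skip (block [
    load .t .T .w,
    ifz .t skip (block [
      load .t .price .w,
      sub .s .price .t,
      ifz .s skip (block [copy .price .t, copy .best .w])])]),
  succ .w, succ .ptr]

/-- Find the cheapest neighbour of `cur` in `T` whose price is below `level`. -/
def findMin : Cmd Var Arr := block [
  copy .price .level, const .w 0, load .ptr .row .cur, loop .n compare]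

/-- Let `cur` bid for the vertex `best`. If it outbids another vertex, that one becomes `cur`. -/
def bid : Cmd Var Arr := block [
  sub .s .level .price,
  ifz .s (const .active 0) (block [
    load .old .mate .best,
    store .mate .best .cur,
    copy .t .price, succ .t,
    store .price .best .t,
    ifz .price (block [const .active 0, succ .tau]) (copy .cur .old)])]

/-- Let `cur` bid, if it is active. -/
def round : Cmd Var Arr := ifz .active skip (block [findMin, bid])

/-- Let `u`, if it is in `T`, join the auction. -/
def place : Cmd Var Arr := block [
  load .t .T .u,
  ifz .t skip (block [copy .cur .u, const .active 1, loop .rounds round]),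
  succ .u]

/-- Assign the value of `x` to the first `m` entries of the array `c`. -/
def fill (m : Var) (c : Arr) (x : Var) : Cmd Var Arr := block [
  const .w 0, loop m (block [store c .w x, succ .w])]

/-- Compute twice the least weight of a half-integral cover of the graph induced on `T`. -/
def auction : Cmd Var Arr := block [
  const .tau 0, fill .n .price .zero, const .u 0, loop .n place]

/-- Copy the first `n` entries of the array `d` to the array `c`. -/
def copyArr (c d : Arr) : Cmd Var Arr := block [
  const .w 0, loop .n (block [load .t d .w, store c .w .t, succ .w])]

/-- Remove the vertex `w` from `T` if it is a neighbour of `v`. -/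
def removeNbr : Cmd Var Arr := block [
  load .t .adj .ptr,
  ifz .t skip (block [
    load .t .T .w,
    ifz .t skip (block [store .T .w .zero, succ .gain, succ .gain, succ .cOut])]),
  succ .w, succ .ptr]

/-- Remove the neighbours of `v` from `T`. -/
def removeNbrs : Cmd Var Arr := block [
  const .w 0, load .ptr .row .v, const .gain 0, copy .cOut .c, loop .n removeNbr]

/-- Compute the values `tau₀`, `tau₁` and `tau` for the graphs on `S`, on `S` without `v`, and on
`S` without `v` and its neighbours. -/
def evaluate : Cmd Var Arr := block [
  copyArr .T .S,
  auction, copy .tau₀ .tau,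
  store .T .v .zero,
  auction, copy .tau₁ .tau,
  removeNbrs, auction]

/-- Decide whether `v` stays out of the cover. -/
def choose : Cmd Var Arr := block [
  sub .t .tau₀ .tau₁, sub .t .t .one,
  sub .s .tau₀ .tau, sub .s .gain .s,
  ifz .t (ifz .s (const .out 1) (block [load .out .bits .pos, succ .pos])) (const .out 0)]

/-- Put `v` or its neighbours in `S` into the cover. -/
def update : Cmd Var Arr :=
  ifz .out (block [store .S .v .zero, succ .c]) (block [copyArr .S .T, copy .c .cOut])

/-- Deal with `v`, if it is in `S`. -/
def visit : Cmd Var Arr := block [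
  load .t .S .v,
  ifz .t skip (block [evaluate, choose, update]),
  succ .v]

/-- Construct a cover following the answers in `bits`. -/
def attempt : Cmd Var Arr := block [
  fill .n .S .one,
  const .c 0, const .pos 0, const .v 0,
  loop .n visit,
  sub .t .c .b, ifz .t (const .ans 1) skip]

/-- Add the carry to the binary digit at `w`. -/
def addCarry : Cmd Var Arr := block [
  ifz .carry skip (block [
    load .t .bits .w,
    ifz .t (block [store .bits .w .one, const .carry 0]) (store .bits .w .zero)]),
  succ .w]

/-- Add one to the binary number in `bits`. -/
def increment : Cmd Var Arr := block [const .carry 1, const .w 0, loop .bitCount addCarry]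

/-- Try all answers. -/
def search : Cmd Var Arr := block [
  const .ans 0,
  fill .bitCount .bits .zero,
  loop .count (block [attempt, increment])]

/-- Double `count`. -/
def doubleCount : Cmd Var Arr := block [copy .aux .count, loop .aux (succ .count)]

/-- Compute `bitCount = 2 * k` and `count = 2 ^ bitCount`. -/
def prepare : Cmd Var Arr := block [
  const .bitCount 0, loop .k (block [succ .bitCount, succ .bitCount]),
  const .count 1, loop .bitCount doubleCount]

/-- Read `B` and `k` from the entries `(1, 1)` and `(2, 2)` of the matrix, and clear these
entries. -/
def readParams : Cmd Var Arr := block [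
  const .zero 0, const .one 1,
  copy .t .n, succ .t, load .B .adj .t, store .adj .t .zero,
  succ .t, loop .n (succ .t), load .k .adj .t, store .adj .t .zero]

/-- Compute the parameters of the auction and the positions of the rows of the matrix. -/
def initRows : Cmd Var Arr := block [
  copy .level .n, succ .level,
  const .rounds 1, loop .n (block [succ .rounds, loop .n (succ .rounds)]),
  const .t 0, const .w 0, loop .n (block [store .row .w .t, succ .w, loop .n (succ .t)])]

/-- Count the nonzero entries of the matrix. -/
def countEntries : Cmd Var Arr := block [
  const .ptr 0, const .twice 0,
  loop .n (loop .n (block [load .t .adj .ptr, ifz .t skip (succ .twice), succ .ptr]))]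

/-- Subtract `2 * B` from `r`, if possible, and count this in `b`. -/
def divide : Cmd Var Arr := block [
  copy .t .r, succ .t, sub .t .t .B, sub .t .t .B,
  ifz .t skip (block [sub .r .t .one, succ .b])]

/-- Compute the largest size `b` allowed for a cover, and compare it with the number of edges. -/
def computeBound : Cmd Var Arr := block [
  copy .b .k, copy .r .twice, loop .n (loop .n divide), sub .t .twice .b, sub .t .t .b]

/-- Read the input and compute the parameters of the search. -/
def setup : Cmd Var Arr := block [readParams, initRows, countEntries, computeBound]

/-- The whole program, to be started with `n` in the variable `n` and with the adjacency matrix in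
the array `adj`, in which the entries `(1, 1)` and `(2, 2)` are replaced by `B` and `k`. The answer
is left in the variable `n`. -/
def program : Cmd Var Arr := block [
  setup,
  ifz .t (const .ans 1) (block [prepare, search]),
  copy .n .ans]

end VCL1.Algorithm

/-! ### Correctness of the auction -/

namespace VCL1.Algorithm

open Cmd HalfCover

/-- The vertices below `n` marked in the array `f`. -/
def supp (n : ℕ) (f : ℕ → ℕ) : Finset ℕ := {w ∈ Finset.range n | f w ≠ 0}

variable {n i u : ℕ} {f g p : ℕ → ℕ} {G : SimpleGraph ℕ} {σ : Store Var Arr}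

@[simp] theorem mem_supp {w : ℕ} : w ∈ supp n f ↔ w < n ∧ f w ≠ 0 := by simp [supp]

theorem supp_congr (h : ∀ w < n, f w = g w) : supp n f = supp n g :=
  Finset.filter_congr fun w hw => by rw [h w (Finset.mem_range.1 hw)]

theorem supp_mono {m : ℕ} (h : m ≤ n) : supp m f ⊆ supp n f := fun w hw => by
  grind [mem_supp]

theorem card_supp_le (n : ℕ) (f : ℕ → ℕ) : (supp n f).card ≤ n :=
  (Finset.card_filter_le _ _).trans_eq (Finset.card_range n)

theorem supp_succ_of_eq_zero (h : f i = 0) : supp (i + 1) f = supp i f := by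
  grind [mem_supp]

theorem supp_succ_of_ne_zero (h : f i ≠ 0) : supp (i + 1) f = insert i (supp i f) := by
  grind [mem_supp]

theorem supp_update_zero (n : ℕ) (f : ℕ → ℕ) (v : ℕ) :
    supp n (Function.update f v 0) = (supp n f).erase v := by
  grind [mem_supp, Function.update_apply]

/-- The part of the state which remains unchanged after the setup. -/
structure Env (n : ℕ) (G : SimpleGraph ℕ) (σ : Store Var Arr) : Prop where
  n_eq : σ.v .n = n
  zero_eq : σ.v .zero = 0
  one_eq : σ.v .one = 1
  level_eq : σ.v .level = n + 1
  rounds_eq : σ.v .rounds = n * (n + 1) + 1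
  row_eq : ∀ u < n, σ.a .row u = u * n
  adj_iff : ∀ u < n, ∀ w < n, σ.a .adj (u * n + w) ≠ 0 ↔ G.Adj u w

theorem Env.eval {s : Cmd Var Arr} (h : Env n G σ)
    (hv : ∀ x ∈ [Var.n, .zero, .one, .level, .rounds], s.writesVar x = false := by decide)
    (ha : ∀ c ∈ [Arr.row, .adj], s.writesArr c = false := by decide) : Env n G (s.eval σ) := by
  have hv x hx := eval_v_of_not_writesVar (hv x hx) σ
  have ha c hc := eval_a_of_not_writesArr (ha c hc) σ
  constructor
  · rw [hv _ (by simp), h.n_eq]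
  · rw [hv _ (by simp), h.zero_eq]
  · rw [hv _ (by simp), h.one_eq]
  · rw [hv _ (by simp), h.level_eq]
  · rw [hv _ (by simp), h.rounds_eq]
  · rw [ha _ (by simp)]; exact h.row_eq
  · rw [ha _ (by simp)]; exact h.adj_iff

theorem fill_spec {m x : Var} {c : Arr} (hm : m ≠ .w) (hx : x ≠ .w) :
    ∀ w < σ.v m, ((fill m c x).eval σ).a c w = σ.v x := by
  have key := eval_loop_induction (x := m) (s := block [store c .w x, succ .w])
    (σ := (const Var.w 0 : Cmd Var Arr).eval σ) (fun i τ =>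
    τ.v .w = i ∧ τ.v x = σ.v x ∧ ∀ w < i, τ.a c w = σ.v x) ⟨by simp, by simp [hx], by simp⟩ ?_
  · simp only [eval_const, Function.update_of_ne hm] at key
    exact key.2.2
  · rintro i τ - ⟨hw, hτx, hc⟩
    refine ⟨by simp [hw], by simp [hτx, hx], fun w hwi => ?_⟩
    by_cases e : w = i
    · simp [hw, hτx, e]
    · simpa [hw, hτx, e] using hc w (by omega)

/-- `c` is the least price, below `L`, of a neighbour of `u` in `T`, and `b` is a neighbour offered
for it. If there is no such neighbour, then `c = L`. -/
structure Cheapest (G : SimpleGraph ℕ) (T : Finset ℕ) (p : ℕ → ℕ) (L u b c : ℕ) : Prop where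
  le_level : c ≤ L
  le_price : ∀ w ∈ T, G.Adj u w → c ≤ p w
  attained : c < L → b ∈ T ∧ G.Adj u b ∧ p b = c

section Cheapest

variable {T : Finset ℕ} {L b c w : ℕ}

theorem Cheapest.insert_of_le (h : Cheapest G T p L u b c) (hw : G.Adj u w → c ≤ p w) :
    Cheapest G (insert w T) p L u b c where
  le_level := h.le_level
  le_price := (Finset.forall_mem_insert ..).2 ⟨hw, h.le_price⟩
  attained hc := (h.attained hc).imp_left (Finset.mem_insert_of_mem)

theorem Cheapest.insert_of_lt (h : Cheapest G T p L u b c) (huw : G.Adj u w) (hw : p w < c) :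
    Cheapest G (insert w T) p L u w (p w) where
  le_level := hw.le.trans h.le_level
  le_price := (Finset.forall_mem_insert ..).2
    ⟨fun _ => le_rfl, fun w' hw' huw' => hw.le.trans (h.le_price w' hw' huw')⟩
  attained _ := ⟨Finset.mem_insert_self .., huw, rfl⟩

end Cheapest

theorem Cheapest.eval_compare (hadj : σ.a .adj (σ.v .ptr) ≠ 0 ↔ G.Adj u (σ.v .w))
    (h : Cheapest G (supp (σ.v .w) (σ.a .T)) (σ.a .price) (n + 1) u (σ.v .best) (σ.v .price)) :
    Cheapest G (supp (σ.v .w + 1) (σ.a .T)) (σ.a .price) (n + 1) u ((compare.eval σ).v .best)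
      ((compare.eval σ).v .price) := by
  by_cases hT : σ.a .T (σ.v .w) = 0
  · rw [supp_succ_of_eq_zero hT]
    by_cases huw : σ.a .adj (σ.v .ptr) = 0 <;> simpa [compare, hT, huw] using h
  rw [supp_succ_of_ne_zero hT]
  by_cases huw : σ.a .adj (σ.v .ptr) = 0
  · simpa [compare, huw] using h.insert_of_le fun huw' => absurd huw (hadj.2 huw')
  by_cases hlt : σ.v .price - σ.a .price (σ.v .w) = 0
  · simpa [compare, huw, hT, hlt] using h.insert_of_le fun _ => by omega
  · simpa [compare, huw, hT, hlt] using h.insert_of_lt (hadj.1 huw) (by omega)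

theorem findMin_spec (h : Env n G σ) (hcur : σ.v .cur < n) :
    Cheapest G (supp n (σ.a .T)) (σ.a .price) (n + 1) (σ.v .cur) ((findMin.eval σ).v .best)
      ((findMin.eval σ).v .price) := by
  let σ₀ := (block [copy .price .level, const .w 0, load .ptr .row .cur]).eval σ
  have key := eval_loop_induction (x := .n) (s := compare) (σ := σ₀) (fun i τ =>
    τ.a = σ.a ∧ τ.v .w = i ∧ τ.v .ptr = σ.v .cur * n + i ∧
      Cheapest G (supp i (σ.a .T)) (σ.a .price) (n + 1) (σ.v .cur) (τ.v .best) (τ.v .price))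
    ⟨rfl, by simp [σ₀], by simp [σ₀, h.row_eq _ hcur], by simp [σ₀, h.level_eq], by simp,
      by simp [σ₀, h.level_eq]⟩ ?_
  · rw [show σ₀.v .n = n by simp [σ₀, h.n_eq]] at key
    exact key.2.2.2
  · rintro i τ hi ⟨ha, rfl, hptr, hmin⟩
    have hi : τ.v .w < n := by simpa [σ₀, h.n_eq] using hi
    refine ⟨?_, ?_, ?_, ?_⟩
    · rw [← ha]
      exact funext fun c => eval_a_of_not_writesArr (by cases c <;> rfl) τ
    · simp (disch := decide) only [compare, eval_block_cons, eval_block_nil, eval_succ,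
        Function.update_of_ne, Function.update_self, eval_v_of_not_writesVar]
    · simp (disch := decide) only [compare, eval_block_cons, eval_block_nil, eval_succ,
        Function.update_of_ne, Function.update_self, eval_v_of_not_writesVar, hptr, add_assoc]
    · rw [← ha] at hmin ⊢
      exact hmin.eval_compare (by rw [ha, hptr]; exact h.adj_iff _ hcur _ hi)

end VCL1.Algorithm

namespace VCL1.Algorithm

open Cmd HalfCover

variable {n i m : ℕ} {f : ℕ → ℕ} {G : SimpleGraph ℕ} {W : Finset ℕ} {σ : Store Var Arr}

/-- The state of an auction on the vertices marked in `f`: the variable `tau` counts the sold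
vertices. -/
structure Selling (n : ℕ) (G : SimpleGraph ℕ) (f : ℕ → ℕ) (σ : Store Var Arr) : Prop where
  env : Env n G σ
  array_eq : σ.a .T = f
  tau_eq : σ.v .tau = Finset.card {w ∈ supp n f | 0 < σ.a .price w}

/-- The state of an auction in which the vertices of `W` have been placed. -/
structure Placed (n : ℕ) (G : SimpleGraph ℕ) (f : ℕ → ℕ) (W : Finset ℕ) (σ : Store Var Arr) : Prop
    extends Selling n G f σ where
  auction : Auction G (supp n f) (n + 1) (σ.a .price) (σ.a .mate) W

/-- The state of an auction in which `cur` is the only vertex of `W` which has not been placed, and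
`m` bids have been made in the attempt to place it. -/
structure Running (n : ℕ) (G : SimpleGraph ℕ) (f : ℕ → ℕ) (W : Finset ℕ) (m : ℕ)
    (σ : Store Var Arr) : Prop extends Selling n G f σ where
  active : σ.v .active ≠ 0
  cur_mem : σ.v .cur ∈ W
  le_sum : m ≤ ∑ w ∈ supp n f, σ.a .price w
  auction : Auction G (supp n f) (n + 1) (σ.a .price) (σ.a .mate) (W.erase (σ.v .cur))

theorem Selling.eval {s : Cmd Var Arr} (h : Selling n G f σ)
    (hv : ∀ x ∈ [Var.n, .zero, .one, .level, .rounds], s.writesVar x = false := by decide)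
    (ha : ∀ c ∈ [Arr.row, .adj], s.writesArr c = false := by decide)
    (htau : s.writesVar .tau = false := by rfl) (hT : s.writesArr .T = false := by rfl)
    (hprice : s.writesArr .price = false := by rfl) : Selling n G f (s.eval σ) where
  env := h.env.eval hv ha
  array_eq := (eval_a_of_not_writesArr hT σ).trans h.array_eq
  tau_eq := by
    rw [eval_v_of_not_writesVar htau, eval_a_of_not_writesArr hprice]
    exact h.tau_eq

namespace Running

theorem eval_findMin (h : Running n G f W m σ) : Running n G f W m (findMin.eval σ) where
  toSelling := h.toSelling.eval
  active := by rw [eval_v_of_not_writesVar (by decide)]; exact h.active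
  cur_mem := by rw [eval_v_of_not_writesVar (by decide)]; exact h.cur_mem
  le_sum := by rw [eval_a_of_not_writesArr (by decide)]; exact h.le_sum
  auction := by
    rw [eval_v_of_not_writesVar (by decide), eval_a_of_not_writesArr (by decide),
      eval_a_of_not_writesArr (by decide)]
    exact h.auction

variable (h : Running n G f W m σ)
  (hmin : Cheapest G (supp n f) (σ.a .price) (n + 1) (σ.v .cur) (σ.v .best) (σ.v .price))

include h hmin

theorem placed_of_level_le (hp : n + 1 ≤ σ.v .price) : Placed n G f W (bid.eval σ) := by
  have hsub : n + 1 - σ.v .price = 0 := by omega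
  have hgive := h.auction.give_up fun w hw huw => hp.trans (hmin.le_price w hw huw)
  rw [Finset.insert_erase h.cur_mem] at hgive
  refine ⟨⟨h.env.eval, ?_, ?_⟩, ?_⟩
  · exact (eval_a_of_not_writesArr (by decide) σ).trans h.array_eq
  · simpa [bid, h.env.level_eq, hsub] using h.tau_eq
  · simpa [bid, h.env.level_eq, hsub] using hgive

theorem placed_of_price_eq_zero (hp : σ.v .price = 0) : Placed n G f W (bid.eval σ) := by
  obtain ⟨hbT, hadj, hbp⟩ := hmin.attained (by omega)
  have hbid := h.auction.bid (U' := W) (Finset.notMem_erase _ _) hbT hadj (by omega)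
    (by rw [hbp]; exact hmin.le_price) (by grind [h.cur_mem])
  rw [hbp, hp] at hbid
  refine ⟨⟨h.env.eval, ?_, ?_⟩, ?_⟩
  · exact (eval_a_of_not_writesArr (by decide) σ).trans h.array_eq
  · have hsold : {w ∈ supp n f | 0 < Function.update (σ.a .price) (σ.v .best) 1 w} =
        insert (σ.v .best) {w ∈ supp n f | 0 < σ.a .price w} := by
      grind [Function.update_apply]
    have hcard := Finset.card_insert_of_notMem (a := σ.v .best)
      (s := {w ∈ supp n f | 0 < σ.a .price w}) (by simp [hbp, hp])
    simpa [bid, h.env.level_eq, hp, hsold, hcard] using h.tau_eq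
  · simpa [bid, h.env.level_eq, hp] using hbid

theorem of_outbid (hp0 : 0 < σ.v .price) (hp : σ.v .price ≤ n) :
    Running n G f W (m + 1) (bid.eval σ) := by
  obtain ⟨hbT, hadj, hbp⟩ := hmin.attained (by omega)
  have hold := h.auction.mate_mem _ hbT (by omega)
  have hbid := h.auction.bid (U' := W.erase (σ.a .mate (σ.v .best))) (Finset.notMem_erase _ _)
    hbT hadj (by omega) (by rw [hbp]; exact hmin.le_price) (by grind [h.cur_mem])
  have hsub : n + 1 - σ.v .price ≠ 0 := by omega
  rw [hbp] at hbid
  refine ⟨⟨h.env.eval, ?_, ?_⟩, ?_, ?_, ?_, ?_⟩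
  · exact (eval_a_of_not_writesArr (by decide) σ).trans h.array_eq
  · have hsold : {w ∈ supp n f |
        0 < Function.update (σ.a .price) (σ.v .best) (σ.v .price + 1) w} =
        {w ∈ supp n f | 0 < σ.a .price w} := by
      grind [Function.update_apply]
    simpa [bid, h.env.level_eq, hp0.ne', hsub, hsold] using h.tau_eq
  · simpa [bid, h.env.level_eq, hp0.ne', hsub] using h.active
  · simpa [bid, h.env.level_eq, hp0.ne', hsub] using Finset.mem_of_mem_erase hold
  · have hsum : ∑ w ∈ supp n f, Function.update (σ.a .price) (σ.v .best) (σ.v .price + 1) w =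
        ∑ w ∈ supp n f, σ.a .price w + 1 := by
      rw [Finset.sum_update_of_mem hbT, ← Finset.add_sum_erase _ _ hbT, hbp,
        Finset.sdiff_singleton_eq_erase]
      omega
    simpa [bid, h.env.level_eq, hp0.ne', hsub, hsum] using h.le_sum
  · simpa [bid, h.env.level_eq, hp0.ne', hsub] using hbid

end Running

theorem round_spec (hW : W ⊆ supp n f)
    (h : σ.v .active = 0 ∧ Placed n G f W σ ∨ Running n G f W m σ) :
    (round.eval σ).v .active = 0 ∧ Placed n G f W (round.eval σ) ∨
      Running n G f W (m + 1) (round.eval σ) := by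
  rcases h with h | h
  · exact Or.inl (by simpa [round, h.1] using h)
  have hmin := findMin_spec h.env (mem_supp.1 (hW h.cur_mem)).1
  rw [h.array_eq] at hmin
  replace hmin : Cheapest G (supp n f) ((findMin.eval σ).a .price) (n + 1)
      ((findMin.eval σ).v .cur) ((findMin.eval σ).v .best) ((findMin.eval σ).v .price) := by
    rwa [eval_v_of_not_writesVar (x := Var.cur) (by decide), eval_a_of_not_writesArr (by decide)]
  have hround : round.eval σ = bid.eval (findMin.eval σ) := by simp [round, h.active]
  rw [hround]
  replace h := h.eval_findMin
  generalize findMin.eval σ = τ at *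
  rcases Nat.lt_or_ge n (τ.v .price) with hp | hp
  · exact Or.inl ⟨by simp [bid, h.env.level_eq, Nat.sub_eq_zero_of_le hp],
      h.placed_of_level_le hmin hp⟩
  rcases Nat.eq_zero_or_pos (τ.v .price) with hp0 | hp0
  · exact Or.inl ⟨by simp [bid, h.env.level_eq, hp0], h.placed_of_price_eq_zero hmin hp0⟩
  · exact Or.inr (h.of_outbid hmin hp0 hp)

theorem Running.lt_rounds (h : Running n G f W m σ) : m < n * (n + 1) + 1 :=
  calc m ≤ ∑ w ∈ supp n f, σ.a .price w := h.le_sum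
    _ ≤ (supp n f).card * (n + 1) := Finset.sum_le_card_nsmul _ _ _ h.auction.price_le
    _ < n * (n + 1) + 1 := Nat.lt_succ_of_le (Nat.mul_le_mul_right _ (card_supp_le n f))

theorem place_spec (h : Placed n G f (supp i f) σ) (hu : σ.v .u = i) (hi : i < n) :
    Placed n G f (supp (i + 1) f) (place.eval σ) := by
  by_cases hfi : f i = 0
  · rw [supp_succ_of_eq_zero hfi]
    refine ⟨⟨h.env.eval, ?_, ?_⟩, ?_⟩
    · exact (eval_a_of_not_writesArr (by decide) σ).trans h.array_eq
    · simpa [place, hu, h.array_eq, hfi] using h.tau_eq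
    · simpa [place, hu, h.array_eq, hfi] using h.auction
  let σ₀ := (block [load .t .T .u, copy .cur .u, const .active 1]).eval σ
  have h₀ : Running n G f (supp (i + 1) f) 0 σ₀ :=
    ⟨h.toSelling.eval, by simp [σ₀], by simp [σ₀, hu, hfi], Nat.zero_le _, by
      simpa [σ₀, hu, supp_succ_of_ne_zero hfi, Finset.erase_insert] using h.auction⟩
  have key := eval_loop_induction (x := .rounds) (s := round) (σ := σ₀)
    (fun m τ => τ.v .active = 0 ∧ Placed n G f (supp (i + 1) f) τ ∨
      Running n G f (supp (i + 1) f) m τ) (Or.inr h₀) fun m τ _ hτ =>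
        round_spec (supp_mono hi) hτ
  have heval : place.eval σ = (succ .u : Cmd Var Arr).eval ((loop .rounds round).eval σ₀) := by
    simp [place, σ₀, hu, h.array_eq, hfi]
  rw [h₀.env.rounds_eq] at key
  obtain ⟨-, key⟩ := key.resolve_right fun hrun => hrun.lt_rounds.false
  rw [heval]
  exact ⟨key.toSelling.eval, key.auction⟩

theorem auction_spec (h : Env n G σ) : (auction.eval σ).v .tau = tau G (supp n (σ.a .T)) := by
  let σ₀ := (block [const .tau 0, fill .n .price .zero, const .u 0]).eval σ
  have hprice : ∀ w < n, σ₀.a .price w = 0 := by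
    have := fill_spec (σ := (const .tau 0 : Cmd Var Arr).eval σ) (m := .n) (x := .zero)
      (c := .price) (by decide) (by decide)
    simpa [σ₀, h.n_eq, h.zero_eq] using this
  have h₀ : Placed n G (σ.a .T) (supp 0 (σ.a .T)) σ₀ := by
    have henv : Env n G σ₀ := h.eval
    refine ⟨⟨henv, eval_a_of_not_writesArr (by decide) σ, ?_⟩, ?_⟩
    · have hsold : {w ∈ supp n (σ.a .T) | 0 < σ₀.a .price w} = ∅ := by grind [mem_supp]
      rw [hsold, Finset.card_empty]
      simp (disch := decide) only [σ₀, eval_block_cons, eval_v_of_not_writesVar, eval_const,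
        Function.update_self, eval_block_nil, Function.update_of_ne]
    · exact Auction.start fun w hw => hprice w (mem_supp.1 hw).1
  have key := eval_loop_induction (x := .n) (s := place) (σ := σ₀)
    (fun i τ => τ.v .u = i ∧ Placed n G (σ.a .T) (supp i (σ.a .T)) τ) ⟨by simp [σ₀], h₀⟩
    fun i τ hi ⟨hu, hτ⟩ => ⟨?_, place_spec hτ hu (by rwa [h₀.env.n_eq] at hi)⟩
  · rw [h₀.env.n_eq] at key
    exact key.2.tau_eq.trans (key.2.auction.card_sold_eq_tau (Nat.lt_succ_of_le (card_supp_le ..)))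
  · simp (disch := decide) only [place, eval_block_cons, eval_block_nil, eval_succ,
      Function.update_self, eval_v_of_not_writesVar, hu]

end VCL1.Algorithm

/-! ### Correctness of a single attempt -/

namespace VCL1.Algorithm

open Cmd HalfCover Finset

variable {n i v : ℕ} {f : ℕ → ℕ} {G : SimpleGraph ℕ} {S : Finset ℕ} {σ : Store Var Arr}

theorem supp_copyArr {c d : Arr} (h : Env n G σ) (hcd : d ≠ c) :
    supp n (((copyArr c d).eval σ).a c) = supp n (σ.a d) := by
  have key := eval_loop_induction (x := .n) (s := block [load .t d .w, store c .w .t, succ .w])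
    (σ := (const Var.w 0 : Cmd Var Arr).eval σ) (fun i τ =>
    τ.v .w = i ∧ τ.a d = σ.a d ∧ ∀ w < i, τ.a c w = σ.a d w) ⟨by simp, by simp, by simp⟩ ?_
  · rw [eval_v_of_not_writesVar (x := Var.n) (by decide), h.n_eq] at key
    exact supp_congr key.2.2
  · rintro i τ - ⟨hw, hd, hc⟩
    refine ⟨by simp [hw], by simp [hd, hcd], fun w hwi => ?_⟩
    by_cases e : w = i
    · simp [hw, hd, e]
    · simpa [hw, hd, e] using hc w (by omega)

/-- The state after the neighbours of `v` below `i` have been removed from the set `T`, which was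
given by `f`. -/
structure Removed (n : ℕ) (G : SimpleGraph ℕ) (f : ℕ → ℕ) (v i : ℕ) (σ : Store Var Arr) :
    Prop where
  w_eq : σ.v .w = i
  ptr_eq : σ.v .ptr = v * n + i
  array_eq : ∀ w, σ.a .T w = if w ∈ nbrs G (supp i f) v then 0 else f w
  gain_eq : σ.v .gain = 2 * #(nbrs G (supp i f) v)
  cOut_eq : σ.v .cOut = σ.v .c + #(nbrs G (supp i f) v)

theorem Removed.eval_removeNbr (h : Removed n G f v i σ) (henv : Env n G σ) (hv : v < n)
    (hi : i < n) : Removed n G f v (i + 1) (removeNbr.eval σ) := by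
  have hadj := henv.adj_iff v hv i hi
  have hTi : σ.a .T i = f i := by rw [h.array_eq]; grind [mem_nbrs, mem_supp]
  have hw : (removeNbr.eval σ).v .w = i + 1 := by
    simp (disch := decide) only [removeNbr, eval_block_cons, eval_block_nil, eval_succ,
      Function.update_of_ne, Function.update_self, eval_v_of_not_writesVar, h.w_eq]
  have hptr : (removeNbr.eval σ).v .ptr = v * n + (i + 1) := by
    simp (disch := decide) only [removeNbr, eval_block_cons, eval_block_nil, eval_succ,
      Function.update_of_ne, Function.update_self, eval_v_of_not_writesVar, h.ptr_eq, add_assoc]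
  by_cases hmem : G.Adj v i ∧ f i ≠ 0
  · have hnbrs : nbrs G (supp (i + 1) f) v = insert i (nbrs G (supp i f) v) := by
      grind [mem_nbrs, mem_supp]
    have hcard : #(nbrs G (supp (i + 1) f) v) = #(nbrs G (supp i f) v) + 1 := by
      rw [hnbrs, card_insert_of_notMem (by simp)]
    have hadj' := hadj.2 hmem.1
    refine ⟨hw, hptr, fun w => ?_, ?_, ?_⟩
    · rw [hnbrs]
      by_cases e : w = i
      · simp [removeNbr, h.w_eq, h.ptr_eq, hadj', hTi, hmem.2, henv.zero_eq, e]
      · simpa [removeNbr, h.w_eq, h.ptr_eq, hadj', hTi, hmem.2, henv.zero_eq, e,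
          -mem_nbrs, mem_insert] using h.array_eq w
    · simp [removeNbr, h.w_eq, h.ptr_eq, hadj', hTi, hmem.2, hcard, h.gain_eq, mul_add]
    · simp [removeNbr, h.w_eq, h.ptr_eq, hadj', hTi, hmem.2, hcard, h.cOut_eq, add_assoc]
  · have hnbrs : nbrs G (supp (i + 1) f) v = nbrs G (supp i f) v := by
      grind [mem_nbrs, mem_supp]
    have heval : (removeNbr.eval σ).a = σ.a ∧ (removeNbr.eval σ).v .gain = σ.v .gain ∧
        (removeNbr.eval σ).v .cOut = σ.v .cOut ∧ (removeNbr.eval σ).v .c = σ.v .c := by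
      by_cases hvi : σ.a .adj (v * n + i) = 0
      · simp [removeNbr, h.ptr_eq, hvi]
      · have hfi : f i = 0 := by tauto
        simp [removeNbr, h.w_eq, h.ptr_eq, hvi, hTi, hfi]
    obtain ⟨ha, hgain, hcOut, hc⟩ := heval
    refine ⟨hw, hptr, ?_, ?_, ?_⟩ <;> rw [hnbrs]
    · rw [ha]; exact h.array_eq
    · rw [hgain, h.gain_eq]
    · rw [hcOut, hc, h.cOut_eq]

theorem removeNbrs_spec (h : Env n G σ) (hv : σ.v .v = v) (hvn : v < n) :
    Removed n G (σ.a .T) v n (removeNbrs.eval σ) := by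
  let σ₀ := (block [const .w 0, load .ptr .row .v, const .gain 0, copy .cOut .c]).eval σ
  have h₀ : Env n G σ₀ := h.eval
  have hnil : nbrs G (supp 0 (σ.a .T)) v = ∅ := by grind [mem_nbrs, mem_supp]
  have key := eval_loop_induction (x := .n) (s := removeNbr) (σ := σ₀)
    (fun i τ => Env n G τ ∧ Removed n G (σ.a .T) v i τ)
    ⟨h₀, ⟨by simp [σ₀], by simp [σ₀, hv, h.row_eq v hvn], by simp [σ₀, hnil],
      by simp [σ₀, hnil], by simp [σ₀, hnil]⟩⟩
    fun i τ hi ⟨henv, hτ⟩ => ⟨henv.eval, hτ.eval_removeNbr henv hvn (by rwa [h₀.n_eq] at hi)⟩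
  rw [h₀.n_eq] at key
  exact key.2

/-- The state after the evaluation of the possible decisions on the vertex `v` of `S`. -/
structure Evaluated (n : ℕ) (G : SimpleGraph ℕ) (S : Finset ℕ) (v : ℕ) (σ : Store Var Arr) :
    Prop where
  tau₀_eq : σ.v .tau₀ = tau G S
  tau₁_eq : σ.v .tau₁ = tau G (S.erase v)
  tau_eq : σ.v .tau = tau G (rest G S v)
  supp_eq : supp n (σ.a .T) = rest G S v
  gain_eq : σ.v .gain = 2 * #(nbrs G S v)
  cOut_eq : σ.v .cOut = σ.v .c + #(nbrs G S v)

theorem evaluate_spec (h : Env n G σ) (hS : supp n (σ.a .S) = S) (hv : σ.v .v = v) (hvn : v < n) :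
    Evaluated n G S v (evaluate.eval σ) := by
  obtain ⟨σ₁, hσ₁⟩ : ∃ τ, τ = (copyArr .T .S).eval σ := ⟨_, rfl⟩
  obtain ⟨σ₂, hσ₂⟩ : ∃ τ, τ = (block [auction, copy .tau₀ .tau, store .T .v .zero]).eval σ₁ :=
    ⟨_, rfl⟩
  obtain ⟨σ₃, hσ₃⟩ : ∃ τ, τ = (block [auction, copy .tau₁ .tau]).eval σ₂ := ⟨_, rfl⟩
  obtain ⟨σ₄, hσ₄⟩ : ∃ τ, τ = removeNbrs.eval σ₃ := ⟨_, rfl⟩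
  have hσ : evaluate.eval σ = auction.eval σ₄ := by rw [hσ₄, hσ₃, hσ₂, hσ₁]; rfl
  have h₁ : Env n G σ₁ := hσ₁ ▸ h.eval
  have h₂ : Env n G σ₂ := hσ₂ ▸ h₁.eval
  have h₃ : Env n G σ₃ := hσ₃ ▸ h₂.eval
  have h₄ : Env n G σ₄ := hσ₄ ▸ h₃.eval
  have hT₁ : supp n (σ₁.a .T) = S := by rw [hσ₁, supp_copyArr h (by decide), hS]
  have hv₁ : σ₁.v .v = v := by rw [hσ₁, eval_v_of_not_writesVar (by decide), hv]
  have hT₂ : supp n (σ₂.a .T) = S.erase v := by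
    rw [← hT₁, ← supp_update_zero, hσ₂]
    simp (disch := decide) [eval_v_of_not_writesVar, eval_a_of_not_writesArr, hv₁, h₁.zero_eq]
  have hT₃ : σ₃.a .T = σ₂.a .T := by rw [hσ₃, eval_a_of_not_writesArr (by decide)]
  have hv₃ : σ₃.v .v = v := by
    rw [hσ₃, eval_v_of_not_writesVar (by decide), hσ₂, eval_v_of_not_writesVar (by decide), hv₁]
  obtain ⟨-, -, hT₄, hgain, hcOut⟩ := hσ₄ ▸ removeNbrs_spec h₃ hv₃ hvn
  have hnbrs : nbrs G (S.erase v) v = nbrs G S v := by grind [mem_nbrs, G.irrefl]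
  rw [hT₃, hT₂, hnbrs] at hgain hcOut
  have hrest : supp n (σ₄.a .T) = rest G S v := by
    rw [rest, ← hT₂, ← hnbrs, ← hT₂]
    simp only [hT₃] at hT₄
    grind [mem_supp]
  rw [hσ]
  refine ⟨?_, ?_, ?_, ?_, ?_, ?_⟩
  · rw [← hT₁, ← auction_spec h₁]
    simp (disch := decide) [eval_v_of_not_writesVar, hσ₄, hσ₃, hσ₂]
  · rw [← hT₂, ← auction_spec h₂]
    simp (disch := decide) [eval_v_of_not_writesVar, hσ₄, hσ₃]
  · rw [auction_spec h₄, hrest]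
  · rw [eval_a_of_not_writesArr (by decide), hrest]
  · rw [eval_v_of_not_writesVar (by decide), hgain]
  · rw [eval_v_of_not_writesVar (by decide), hcOut, eval_v_of_not_writesVar (by decide)]

/-- The answers which have not yet been used. -/
def answers (σ : Store Var Arr) (j : ℕ) : Prop := σ.a .bits (σ.v .pos + j) ≠ 0

theorem answers_succ {τ : Store Var Arr} (hb : τ.a .bits = σ.a .bits)
    (hpos : τ.v .pos = σ.v .pos + 1) : (fun j => answers σ (j + 1)) = answers τ := by
  funext j
  rw [answers, answers, hb, hpos, add_assoc, add_comm 1 j]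

theorem answers_congr {τ : Store Var Arr} (hb : τ.a .bits = σ.a .bits)
    (hpos : τ.v .pos = σ.v .pos) : answers τ = answers σ := by
  funext j
  rw [answers, answers, hb, hpos]

theorem Evaluated.branch_eq (h : Evaluated n G S v σ) (hone : σ.v .one = 1) (hv : v ∈ S)
    (vs : List ℕ) : branch G (v :: vs) S (σ.v .c) (answers σ) =
      if (choose.eval σ).v .out = 0
      then branch G vs (S.erase v) (σ.v .c + 1) (answers (choose.eval σ))
      else branch G vs (rest G S v) (σ.v .cOut) (answers (choose.eval σ)) := by
  have hbits : (choose.eval σ).a .bits = σ.a .bits := eval_a_of_not_writesArr (by decide) σ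
  rw [branch, if_pos hv, ← h.cOut_eq]
  by_cases hin : tau G (S.erase v) + 2 ≤ tau G S
  · have hsub : tau G S - tau G (S.erase v) - 1 ≠ 0 := by omega
    have hout : (choose.eval σ).v .out = 0 := by simp [choose, h.tau₀_eq, h.tau₁_eq, hone, hsub]
    rw [if_pos hin, if_pos hout, answers_congr hbits]
    simp [choose, h.tau₀_eq, h.tau₁_eq, hone, hsub]
  have hsub : tau G S - tau G (S.erase v) - 1 = 0 := by omega
  have hmono : tau G (rest G S v) ≤ tau G S := tau_mono fun w hw => (mem_rest.1 hw).1
  rw [if_neg hin]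
  by_cases hout : tau G (rest G S v) + 2 * #(nbrs G S v) ≤ tau G S
  · have hsub' : 2 * #(nbrs G S v) - (tau G S - tau G (rest G S v)) = 0 := by omega
    have hout' : (choose.eval σ).v .out ≠ 0 := by
      simp [choose, h.tau₀_eq, h.tau₁_eq, h.tau_eq, h.gain_eq, hone, hsub, hsub']
    rw [if_pos hout, if_neg hout', answers_congr hbits]
    simp [choose, h.tau₀_eq, h.tau₁_eq, h.tau_eq, h.gain_eq, hone, hsub, hsub']
  have hsub' : 2 * #(nbrs G S v) - (tau G S - tau G (rest G S v)) ≠ 0 := by omega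
  have hpos : (choose.eval σ).v .pos = σ.v .pos + 1 := by
    simp [choose, h.tau₀_eq, h.tau₁_eq, h.tau_eq, h.gain_eq, hone, hsub, hsub']
  have hask : (choose.eval σ).v .out = σ.a .bits (σ.v .pos) := by
    simp [choose, h.tau₀_eq, h.tau₁_eq, h.tau_eq, h.gain_eq, hone, hsub, hsub']
  rw [if_neg hout, answers_succ hbits hpos, hask, answers, add_zero]
  split_ifs <;> first | rfl | contradiction

theorem update_spec (h : Env n G σ) :
    supp n ((update.eval σ).a .S) =
        (if σ.v .out = 0 then (supp n (σ.a .S)).erase (σ.v .v) else supp n (σ.a .T)) ∧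
      (update.eval σ).v .c = if σ.v .out = 0 then σ.v .c + 1 else σ.v .cOut := by
  by_cases hout : σ.v .out = 0
  · simp [update, hout, h.zero_eq, supp_update_zero]
  · simp (disch := decide) [update, hout, supp_copyArr h, eval_v_of_not_writesVar]

/-- The size of the cover obtained by going through the vertices `vs` from the state `σ`. -/
noncomputable def outcome (n : ℕ) (G : SimpleGraph ℕ) (vs : List ℕ) (σ : Store Var Arr) : ℕ :=
  branch G vs (supp n (σ.a .S)) (σ.v .c) (answers σ)

theorem outcome_congr {τ : Store Var Arr} (ha : τ.a = σ.a) (hc : τ.v .c = σ.v .c)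
    (hpos : τ.v .pos = σ.v .pos) (vs : List ℕ) : outcome n G vs τ = outcome n G vs σ := by
  rw [outcome, outcome, ha, hc, answers_congr (by rw [ha]) hpos]

theorem outcome_update_choose_evaluate (h : Env n G σ) (hv : σ.v .v < n) (hvS : σ.a .S (σ.v .v) ≠ 0)
    (vs : List ℕ) : outcome n G vs (update.eval (choose.eval (evaluate.eval σ))) =
      outcome n G (σ.v .v :: vs) σ := by
  have hev := evaluate_spec h rfl rfl hv
  have h₁ : Env n G (evaluate.eval σ) := h.eval
  have hc : (evaluate.eval σ).v .c = σ.v .c := eval_v_of_not_writesVar (by decide) σ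
  have hans : answers (evaluate.eval σ) = answers σ := answers_congr
    (eval_a_of_not_writesArr (by decide) σ) (eval_v_of_not_writesVar (by decide) σ)
  have hvS' : σ.v .v ∈ supp n (σ.a .S) := by simp [hv, hvS]
  have hbranch := hev.branch_eq h₁.one_eq hvS' vs
  rw [hc, hans] at hbranch
  have hS : (evaluate.eval σ).a .S = σ.a .S := eval_a_of_not_writesArr (by decide) σ
  have hv₁ : (evaluate.eval σ).v .v = σ.v .v := eval_v_of_not_writesVar (by decide) σ
  have hT := hev.supp_eq
  generalize evaluate.eval σ = σ₁ at *
  have h₂ : Env n G (choose.eval σ₁) := h₁.eval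
  obtain ⟨hS₃, hc₃⟩ := update_spec h₂
  have hans₃ : answers (update.eval (choose.eval σ₁)) = answers (choose.eval σ₁) := answers_congr
    (eval_a_of_not_writesArr (by decide) _) (eval_v_of_not_writesVar (by decide) _)
  rw [outcome, outcome, hbranch, hS₃, hc₃, hans₃]
  simp (disch := decide) only [eval_v_of_not_writesVar, eval_a_of_not_writesArr, hS, hv₁, hc, hT]
  split_ifs <;> rfl

theorem outcome_visit (h : Env n G σ) (hv : σ.v .v < n) (vs : List ℕ) :
    outcome n G vs (visit.eval σ) = outcome n G (σ.v .v :: vs) σ := by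
  by_cases hvS : σ.a .S (σ.v .v) = 0
  · have hnot : σ.v .v ∉ supp n (σ.a .S) := by simp [hvS]
    rw [outcome_congr (σ := σ) (by simp [visit, hvS]) (by simp [visit, hvS])
      (by simp [visit, hvS]), outcome, outcome, branch, if_neg hnot]
  have hload : outcome n G (σ.v .v :: vs) ((load .t .S .v : Cmd Var Arr).eval σ) =
      outcome n G (σ.v .v :: vs) σ := outcome_congr rfl (by simp) (by simp) _
  have h₀ : Env n G ((load .t .S .v : Cmd Var Arr).eval σ) := h.eval
  have hv₀ : ((load .t .S .v : Cmd Var Arr).eval σ).v .v = σ.v .v := by simp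
  have hS₀ : ((load .t .S .v : Cmd Var Arr).eval σ).a .S (σ.v .v) ≠ 0 := by simpa using hvS
  have hvisit : visit.eval σ = (succ Var.v : Cmd Var Arr).eval
      (update.eval (choose.eval (evaluate.eval ((load .t .S .v : Cmd Var Arr).eval σ)))) := by
    simp [visit, hvS]
  generalize (load .t .S .v : Cmd Var Arr).eval σ = σ₀ at hload h₀ hv₀ hS₀ hvisit
  rw [← hv₀] at hv hS₀
  rw [← hload, ← hv₀, hvisit, ← outcome_update_choose_evaluate h₀ hv hS₀]
  exact outcome_congr (by rw [eval_succ]) (by simp) (by simp) vs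

end VCL1.Algorithm

/-! ### Correctness of the search -/

namespace VCL1.Algorithm

open Cmd HalfCover Finset

variable {n i m x b : ℕ} {G : SimpleGraph ℕ} {σ : Store Var Arr}

/-- The size of the cover constructed by following the answers `b`. -/
noncomputable def coverSize (n : ℕ) (G : SimpleGraph ℕ) (b : ℕ → Prop) : ℕ :=
  branch G (List.range n) (range n) 0 b

theorem outcome_loop_visit (h : Env n G σ) (hv : σ.v .v = 0) :
    ((loop .n visit).eval σ).v .c = outcome n G (List.range n) σ := by
  have key := eval_loop_induction (x := .n) (s := visit) (σ := σ) (fun i τ =>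
    Env n G τ ∧ τ.v .v = i ∧
      outcome n G (List.range' i (n - i)) τ = outcome n G (List.range n) σ)
    ⟨h, hv, by rw [Nat.sub_zero, List.range_eq_range']⟩ ?_
  · rw [h.n_eq, Nat.sub_self] at key
    exact key.2.2
  · rintro i τ hi ⟨henv, rfl, hτ⟩
    rw [h.n_eq] at hi
    refine ⟨henv.eval, ?_, ?_⟩
    · simp (disch := decide) only [visit, eval_block_cons, eval_block_nil, eval_succ,
        Function.update_self, eval_v_of_not_writesVar]
    · rw [outcome_visit henv hi, ← hτ, show n - τ.v .v = n - (τ.v .v + 1) + 1 by omega,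
        List.range'_succ]

theorem attempt_spec (h : Env n G σ) : (attempt.eval σ).v .ans =
    if coverSize n G (fun j => σ.a .bits j ≠ 0) ≤ σ.v .b then 1 else σ.v .ans := by
  obtain ⟨ρ, hρ⟩ : ∃ ρ, ρ =
    (block [fill .n .S .one, const .c 0, const .pos 0, const .v 0]).eval σ := ⟨_, rfl⟩
  have hS : supp n (ρ.a .S) = range n := by
    rw [supp, filter_eq_self]
    intro w hw
    have := fill_spec (σ := σ) (m := .n) (x := .one) (c := .S) (by decide) (by decide) w
      (by rw [h.n_eq]; exact mem_range.1 hw)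
    simp [hρ, this, h.one_eq]
  have hbits : ρ.a .bits = σ.a .bits := by rw [hρ, eval_a_of_not_writesArr (by decide)]
  have houtcome : outcome n G (List.range n) ρ = coverSize n G (fun j => σ.a .bits j ≠ 0) := by
    have hans : answers ρ = fun j => σ.a .bits j ≠ 0 := by
      funext j
      rw [answers, hbits]
      simp [hρ]
    rw [outcome, hS, hans, coverSize]
    simp [hρ]
  have hc := outcome_loop_visit (hρ ▸ h.eval : Env n G ρ) (by simp [hρ])
  have hattempt : attempt.eval σ =
      (block [sub .t .c .b, ifz .t (const .ans 1) skip]).eval ((loop .n visit).eval ρ) := by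
    rw [hρ]; rfl
  have hb : ((loop .n visit).eval ρ).v .b = σ.v .b := by
    rw [eval_v_of_not_writesVar (by decide), hρ, eval_v_of_not_writesVar (by decide)]
  have hans : ((loop .n visit).eval ρ).v .ans = σ.v .ans := by
    rw [eval_v_of_not_writesVar (by decide), hρ, eval_v_of_not_writesVar (by decide)]
  rw [hattempt, ← houtcome, ← hc, ← hb, ← hans]
  generalize (loop .n visit).eval ρ = τ
  by_cases hle : τ.v .c ≤ τ.v .b
  · simp [hle, Nat.sub_eq_zero_of_le hle]
  · simp [hle, Nat.sub_ne_zero_of_lt (not_le.1 hle)]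

theorem two_pow_succ_dvd_succ_iff : 2 ^ (i + 1) ∣ x + 1 ↔ 2 ^ i ∣ x + 1 ∧ x / 2 ^ i % 2 = 1 := by
  rw [pow_succ]
  by_cases h : 2 ^ i ∣ x + 1
  · rw [← Nat.dvd_div_iff_mul_dvd h, Nat.succ_div, if_pos h]
    grind
  · exact iff_of_false (fun h' => h (dvd_of_mul_right_dvd h')) (fun h' => h h'.1)

/-- The state after the lowest `i` binary digits of `x` have been replaced by those of `x + 1`. -/
structure Incremented (m x i : ℕ) (σ : Store Var Arr) : Prop where
  w_eq : σ.v .w = i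
  carry_eq : σ.v .carry = if 2 ^ i ∣ x + 1 then 1 else 0
  bits_eq : ∀ w < m, σ.a .bits w = (if w < i then x + 1 else x) / 2 ^ w % 2

theorem Incremented.eval_addCarry (h : Incremented m x i σ) (henv : Env n G σ) (hi : i < m) :
    Incremented m x (i + 1) (addCarry.eval σ) := by
  have hbit : σ.a .bits i = x / 2 ^ i % 2 := by simpa using h.bits_eq i hi
  have hw : (addCarry.eval σ).v .w = i + 1 := by
    simp (disch := decide) only [addCarry, eval_block_cons, eval_block_nil, eval_succ,
      Function.update_self, eval_v_of_not_writesVar, h.w_eq]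
  suffices hsuff : (addCarry.eval σ).v .carry = (if 2 ^ (i + 1) ∣ x + 1 then 1 else 0) ∧
      (addCarry.eval σ).a .bits = Function.update (σ.a .bits) i ((x + 1) / 2 ^ i % 2) by
    refine ⟨hw, hsuff.1, fun w hwm => ?_⟩
    rw [hsuff.2, Function.update_apply, h.bits_eq w hwm]
    split_ifs <;> first | rfl | omega | simp_all
  have hcarry := h.carry_eq
  simp only [two_pow_succ_dvd_succ_iff, Nat.succ_div]
  by_cases hdvd : 2 ^ i ∣ x + 1
  · rw [if_pos hdvd] at hcarry
    obtain hx | hx := Nat.mod_two_eq_zero_or_one (x / 2 ^ i)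
    · have : (x / 2 ^ i + 1) % 2 = 1 := by omega
      simp [addCarry, h.w_eq, hcarry, hbit, hx, hdvd, henv.one_eq, this]
    · have : (x / 2 ^ i + 1) % 2 = 0 := by omega
      simp [addCarry, h.w_eq, hcarry, hbit, hx, hdvd, henv.zero_eq, this]
  · rw [if_neg hdvd] at hcarry
    simp [addCarry, hcarry, hdvd, ← hbit]

theorem increment_spec (h : Env n G σ) (hm : σ.v .bitCount = m)
    (hx : ∀ w < m, σ.a .bits w = x / 2 ^ w % 2) :
    ∀ w < m, (increment.eval σ).a .bits w = (x + 1) / 2 ^ w % 2 := by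
  let ρ := (block [const .carry 1, const .w 0]).eval σ
  have hρ : ρ.v .bitCount = m := by simp [ρ, hm]
  have key := eval_loop_induction (x := .bitCount) (s := addCarry) (σ := ρ)
    (fun i τ => Env n G τ ∧ Incremented m x i τ)
    ⟨h.eval, by simp [ρ], by simp [ρ], by simpa [ρ] using hx⟩
    fun i τ hi ⟨henv, hτ⟩ => ⟨henv.eval, hτ.eval_addCarry henv (hρ ▸ hi)⟩
  rw [hρ] at key
  intro w hw
  exact (key.2.bits_eq w hw).trans (by rw [if_pos hw])

theorem exists_bits (m : ℕ) (g : ℕ → Prop) :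
    ∃ x < 2 ^ m, ∀ i < m, (x / 2 ^ i % 2 ≠ 0 ↔ g i) := by
  classical
  refine ⟨Nat.ofBits fun i : Fin m => decide (g i), Nat.ofBits_lt_two_pow _, fun i hi => ?_⟩
  have := Nat.testBit_ofBits_lt (fun i : Fin m => decide (g i)) i hi
  rw [Nat.testBit_eq_decide_div_mod_eq, decide_eq_decide] at this
  rw [← this]
  omega

/-- The state after `i` attempts to find a cover of size `b`, with `m` answers each. -/
structure Searched (n : ℕ) (G : SimpleGraph ℕ) (m b i : ℕ) (σ : Store Var Arr) : Prop where
  env : Env n G σ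
  bitCount_eq : σ.v .bitCount = m
  b_eq : σ.v .b = b
  bits_eq : ∀ w < m, σ.a .bits w = i / 2 ^ w % 2
  ans_eq : σ.v .ans = 0 ∨ σ.v .ans = 1 ∧ ∃ g, coverSize n G g ≤ b
  complete : ∀ j < i, (∀ g : ℕ → Prop, (∀ w < m, g w ↔ j / 2 ^ w % 2 ≠ 0) → coverSize n G g ≤ b) →
    σ.v .ans = 1

theorem Searched.eval_attempt_increment (h : Searched n G m b i σ) :
    Searched n G m b (i + 1) ((block [attempt, increment]).eval σ) := by
  have hatt := attempt_spec h.env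
  have henv : Env n G (attempt.eval σ) := h.env.eval
  have hbits : (attempt.eval σ).a .bits = σ.a .bits := eval_a_of_not_writesArr (by decide) σ
  have hm : (attempt.eval σ).v .bitCount = m := by
    rw [eval_v_of_not_writesVar (by decide), h.bitCount_eq]
  have hans : ((block [attempt, increment]).eval σ).v .ans = (attempt.eval σ).v .ans :=
    eval_v_of_not_writesVar (s := increment) (by decide) _
  rw [h.b_eq] at hatt
  refine ⟨h.env.eval, ?_, ?_, increment_spec henv hm (by simpa only [hbits] using h.bits_eq),
    ?_, ?_⟩
  · rw [eval_v_of_not_writesVar (by decide), h.bitCount_eq]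
  · rw [eval_v_of_not_writesVar (by decide), h.b_eq]
  · rw [hans, hatt]
    split_ifs with hle
    · exact Or.inr ⟨rfl, _, hle⟩
    · exact h.ans_eq
  · intro j hj hg
    rw [hans, hatt]
    split_ifs with hle
    · rfl
    · refine h.complete j (lt_of_le_of_ne (Nat.le_of_lt_succ hj) ?_) hg
      rintro rfl
      exact hle (hg _ fun w hw => by rw [h.bits_eq w hw])

theorem search_spec (h : Env n G σ) (hm : σ.v .bitCount = m) (hcount : σ.v .count = 2 ^ m)
    (hb : 2 * σ.v .b ≤ m + tau G (range n)) :
    ((search.eval σ).v .ans = 0 ∨ (search.eval σ).v .ans = 1) ∧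
      ((search.eval σ).v .ans = 1 ↔ ∃ C, Covers G (range n) C ∧ #C ≤ σ.v .b) := by
  let ρ := (block [const .ans 0, fill .bitCount .bits .zero]).eval σ
  have hbits : ∀ w < m, ρ.a .bits w = 0 := fun w hw => by
    simpa [ρ, h.zero_eq] using fill_spec (σ := (const .ans 0 : Cmd Var Arr).eval σ) (m := .bitCount)
      (x := .zero) (c := .bits) (by decide) (by decide) w (by simpa [hm] using hw)
  have hans : ρ.v .ans = 0 := by simp (disch := decide) [ρ, eval_v_of_not_writesVar]
  have key := eval_loop_induction (x := .count) (s := block [attempt, increment]) (σ := ρ)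
    (fun i τ => Searched n G m (σ.v .b) i τ)
    ⟨h.eval, by rw [eval_v_of_not_writesVar (by decide), hm],
      by rw [eval_v_of_not_writesVar (by decide)], by simpa using hbits, Or.inl hans, by simp⟩
    fun _ _ _ hτ => hτ.eval_attempt_increment
  rw [eval_v_of_not_writesVar (by decide), hcount] at key
  have hsearch : search.eval σ = (loop .count (block [attempt, increment])).eval ρ := rfl
  rw [hsearch]
  refine ⟨key.ans_eq.imp_right And.left, fun hyes => ?_, ?_⟩
  · obtain hno | ⟨-, g, hg⟩ := key.ans_eq
    · omega
    · obtain ⟨C, hC, hc⟩ := exists_covers_le_branch G (List.range n) (range n) 0 g (by simp)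
      rw [coverSize] at hg
      exact ⟨C, hC, by omega⟩
  · rintro ⟨C, hC, hc⟩
    obtain ⟨g, hg⟩ := exists_answers_branch_le G (σ.v .b) (List.range n) (range n) C 0 m hC
      (by omega) (by omega)
    obtain ⟨x, hx, hxg⟩ := exists_bits m g
    exact key.complete x hx fun g' hg' => hg g' fun w hw => (hg' w hw).trans (hxg w hw)

end VCL1.Algorithm

/-! ### Correctness of the setup -/

namespace VCL1.Algorithm

open Cmd HalfCover Finset

variable {n B k m : ℕ} {G : SimpleGraph ℕ} {σ : Store Var Arr}

/-- The input of the program: `n` in the variable `n`, and the adjacency matrix in the array `adj`,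
with `B` and `k` at two positions which are on the diagonal or beyond the end. -/
structure Input (n B k : ℕ) (G : SimpleGraph ℕ) (σ : Store Var Arr) : Prop where
  n_eq : σ.v .n = n
  B_eq : σ.a .adj (n + 1) = B
  k_eq : σ.a .adj (2 * n + 2) = k
  adj_iff : ∀ u < n, ∀ w < n, u ≠ w → (σ.a .adj (u * n + w) ≠ 0 ↔ G.Adj u w)
  diag : ∀ u < n, u * n + u ≠ n + 1 → u * n + u ≠ 2 * n + 2 → σ.a .adj (u * n + u) = 0

theorem eq_of_mul_add_eq {u w c : ℕ} (hu : u < n) (hw : w < n) (h : u * n + w = c * n + c) :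
    u = w := by
  have hc : c < n := by
    by_contra! hc
    have := Nat.mul_le_mul_right n (hu.trans_le hc)
    rw [Nat.succ_mul] at this
    omega
  have hwc : w = c := by
    rw [← Nat.mul_add_mod_of_lt (a := u) hw, h, Nat.mul_add_mod_of_lt hc]
  subst hwc
  exact Nat.eq_of_mul_eq_mul_right (by omega) (Nat.add_right_cancel h)

theorem Input.v_readParams (h : Input n B k G σ) :
    (readParams.eval σ).v .B = B ∧ (readParams.eval σ).v .k = k := by
  have hpos : n + 1 + 1 + n = 2 * n + 2 := by omega
  have hne : 2 * n + 2 ≠ n + 1 := by omega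
  constructor
  · simp [readParams, eval_loop_succ, h.n_eq, h.B_eq]
  · simp [readParams, eval_loop_succ, h.n_eq, h.k_eq, hpos, hne]

theorem Input.adj_readParams (h : Input n B k G σ) :
    ∀ u < n, ∀ w < n, (readParams.eval σ).a .adj (u * n + w) ≠ 0 ↔ G.Adj u w := by
  intro u hu w hw
  have hpos : n + 1 + 1 + n = 2 * n + 2 := by omega
  have hadj : (readParams.eval σ).a .adj =
      Function.update (Function.update (σ.a .adj) (n + 1) 0) (2 * n + 2) 0 := by
    simp [readParams, eval_loop_succ, h.n_eq, hpos]
  rw [hadj]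
  by_cases huw : u = w
  · subst huw
    have hdiag := h.diag u hu
    simp only [SimpleGraph.irrefl, iff_false, not_not, Function.update_apply]
    split_ifs with h₂ h₁
    exacts [rfl, rfl, hdiag h₁ h₂]
  · rw [Function.update_of_ne, Function.update_of_ne]
    · exact h.adj_iff u hu w hw huw
    · exact fun h₁ => huw (eq_of_mul_add_eq (c := 1) hu hw (by omega))
    · exact fun h₂ => huw (eq_of_mul_add_eq (c := 2) hu hw (by omega))

theorem rounds_initRows (σ : Store Var Arr) :
    (initRows.eval σ).v .rounds = σ.v .n * (σ.v .n + 1) + 1 := by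
  let ρ := (block [copy .level .n, succ .level, const .rounds 1]).eval σ
  have key := eval_loop_induction (x := .n) (s := block [succ .rounds, loop .n (succ .rounds)])
    (σ := ρ) (fun i τ => τ.v .n = σ.v .n ∧ τ.v .rounds = i * (σ.v .n + 1) + 1)
    ⟨by simp [ρ], by simp [ρ]⟩ (by
      rintro i τ - ⟨hn, hr⟩
      refine ⟨by simp [eval_loop_succ, hn], ?_⟩
      simp only [eval_block_cons, eval_block_nil, eval_succ, eval_loop_succ, Function.update_self,
        hr, ne_eq, reduceCtorEq, not_false_eq_true, Function.update_of_ne, hn]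
      ring)
  have hρ : ρ.v .n = σ.v .n := by simp [ρ]
  rw [hρ] at key
  exact (eval_v_of_not_writesVar (s := block [const .t 0, const .w 0,
    loop .n (block [store .row .w .t, succ .w, loop .n (succ .t)])]) (by decide) _).trans key.2

theorem row_initRows (σ : Store Var Arr) :
    ∀ u < σ.v .n, (initRows.eval σ).a .row u = u * σ.v .n := by
  let ρ := (block [copy .level .n, succ .level, const .rounds 1,
    loop .n (block [succ .rounds, loop .n (succ .rounds)]), const .t 0, const .w 0]).eval σ
  have hρ : ρ.v .n = σ.v .n := eval_v_of_not_writesVar (by decide) σ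
  have key := eval_loop_induction (x := .n)
    (s := block [store .row .w .t, succ .w, loop .n (succ .t)]) (σ := ρ)
    (fun i τ => τ.v .n = σ.v .n ∧ τ.v .t = i * σ.v .n ∧ τ.v .w = i ∧
      ∀ u < i, τ.a .row u = u * σ.v .n) ⟨hρ, by simp [ρ], by simp [ρ], by simp⟩ (by
      rintro i τ - ⟨hn, ht, hw, hrow⟩
      refine ⟨by simp [eval_loop_succ, hn], by simp [eval_loop_succ, hn, ht, add_mul],
        by simp [eval_loop_succ, hw], fun u hu => ?_⟩
      by_cases e : u = i
      · simp [eval_loop_succ, hw, ht, e]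
      · simpa [eval_loop_succ, hw, e] using hrow u (by omega))
  rw [hρ] at key
  exact key.2.2.2

theorem Input.env (h : Input n B k G σ) : Env n G ((block [readParams, initRows]).eval σ) where
  n_eq := (eval_v_of_not_writesVar (by decide) σ).trans h.n_eq
  zero_eq := (eval_v_of_not_writesVar (s := initRows) (by decide) _).trans
    (by simp [readParams, eval_loop_succ])
  one_eq := (eval_v_of_not_writesVar (s := initRows) (by decide) _).trans
    (by simp [readParams, eval_loop_succ])
  level_eq := by simp (disch := decide) [initRows, eval_v_of_not_writesVar, h.n_eq]
  rounds_eq := (rounds_initRows _).trans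
    (by rw [eval_v_of_not_writesVar (by decide), h.n_eq])
  row_eq := by
    have := row_initRows (readParams.eval σ)
    rwa [eval_v_of_not_writesVar (by decide), h.n_eq] at this
  adj_iff u hu w hw := by
    rw [← h.adj_readParams u hu w hw]
    exact not_congr (Eq.congr_left (congrFun
      (eval_a_of_not_writesArr (s := initRows) (by decide) (readParams.eval σ)) _))

theorem sum_range_mul (f : ℕ → ℕ) (m n : ℕ) :
    ∑ i ∈ range (m * n), f i = ∑ u ∈ range m, ∑ w ∈ range n, f (u * n + w) := by
  induction m with
  | zero => simp
  | succ m ih => rw [add_mul, one_mul, sum_range_add, ih, sum_range_succ]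

/-- The sum of the degrees in the graph induced on the vertices below `n`, that is, twice the
number of its edges. -/
noncomputable def degreeSum (n : ℕ) (G : SimpleGraph ℕ) : ℕ :=
  ∑ u ∈ range n, #(nbrs G (range n) u)

/-- The largest integer that is at most `m / B + k`, where `m` is the number of edges of the graph
induced on the vertices below `n`. -/
noncomputable def budget (n B k : ℕ) (G : SimpleGraph ℕ) : ℕ :=
  k + degreeSum n G / (2 * B)

theorem degreeSum_le (n : ℕ) (G : SimpleGraph ℕ) : degreeSum n G ≤ n * n := by
  classical
  refine (sum_le_card_nsmul _ _ n fun u _ => ?_).trans_eq (by rw [card_range, smul_eq_mul])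
  exact (card_filter_le ..).trans_eq (card_range n)

theorem countEntries_spec (h : Env n G σ) :
    (countEntries.eval σ).v .twice = degreeSum n G := by
  classical
  have key := eval_loop_loop_induction (x := .n) (m := n)
    (s := block [load .t .adj .ptr, ifz .t skip (succ .twice), succ .ptr])
    (σ := (block [const .ptr 0, const .twice 0]).eval σ)
    (fun i τ => τ.a .adj = σ.a .adj ∧ τ.v .ptr = i ∧
      τ.v .twice = ∑ j ∈ range i, if σ.a .adj j ≠ 0 then 1 else 0)
    (by simp [h.n_eq]) (by decide) (by simp) (by
      rintro i τ - ⟨hadj, hptr, htwice⟩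
      rw [sum_range_succ]
      by_cases hi : σ.a .adj i = 0 <;> simp [hadj, hptr, htwice, hi])
  refine key.2.2.trans ?_
  rw [sum_range_mul, degreeSum]
  refine sum_congr rfl fun u hu => ?_
  rw [nbrs, card_filter]
  refine sum_congr rfl fun w hw => ?_
  simp only [h.adj_iff u (mem_range.1 hu) w (mem_range.1 hw)]

/-- The state of the division of `m` by `2 * B`, with the quotient added to `k`, after `i`
rounds. -/
structure Dividing (m B k i : ℕ) (τ : Store Var Arr) : Prop where
  one_eq : τ.v .one = 1
  B_eq : τ.v .B = B
  exists_quotient : ∃ q, τ.v .b = k + q ∧ 2 * B * q + τ.v .r = m ∧ (τ.v .r < 2 * B ∨ q = i)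

theorem Dividing.eval_divide {i : ℕ} (h : Dividing m B k i σ) :
    Dividing m B k (i + 1) (divide.eval σ) := by
  obtain ⟨q, hb, hr, hq⟩ := h.exists_quotient
  refine ⟨?_, ?_, ?_⟩
  · rw [eval_v_of_not_writesVar (by decide), h.one_eq]
  · rw [eval_v_of_not_writesVar (by decide), h.B_eq]
  by_cases hlt : σ.v .r < 2 * B
  · have ht : σ.v .r + 1 - B - B = 0 := by omega
    exact ⟨q, by simpa [divide, h.B_eq, ht] using hb, by simpa [divide, h.B_eq, ht] using hr,
      Or.inl (by simpa [divide, h.B_eq, ht] using hlt)⟩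
  · have ht : σ.v .r + 1 - B - B ≠ 0 := by omega
    refine ⟨q + 1, by simp [divide, h.B_eq, ht, hb, add_assoc], ?_, by omega⟩
    have hr' : (divide.eval σ).v .r = σ.v .r - 2 * B := by
      simpa [divide, h.B_eq, ht, h.one_eq] using by omega
    rw [hr', mul_add]
    omega

theorem computeBound_spec (h : Env n G σ) (hB : σ.v .B = B) (hm : σ.v .twice = m) (hB0 : 0 < B)
    (hmn : m ≤ n * n) : (computeBound.eval σ).v .b = σ.v .k + m / (2 * B) ∧
      (computeBound.eval σ).v .t = m - 2 * (σ.v .k + m / (2 * B)) := by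
  obtain ⟨ρ, hρ⟩ : ∃ ρ, ρ = (block [copy .b .k, copy .r .twice,
    loop .n (loop .n divide)]).eval σ := ⟨_, rfl⟩
  have key := eval_loop_loop_induction (x := .n) (m := n) (s := divide)
    (σ := (block [copy .b .k, copy .r .twice]).eval σ) (Dividing m B (σ.v .k))
    (by simp [h.n_eq]) (by decide)
    ⟨by simp [h.one_eq], by simp [hB], 0, by simp, by simp [hm], by simp⟩
    fun _ _ _ hτ => hτ.eval_divide
  obtain ⟨q, hb, hr, hlt⟩ : ∃ q, ρ.v .b = σ.v .k + q ∧ 2 * B * q + ρ.v .r = m ∧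
    (ρ.v .r < 2 * B ∨ q = n * n) := hρ ▸ key.exists_quotient
  replace hlt : ρ.v .r < 2 * B := by
    obtain hlt | rfl := hlt
    · exact hlt
    · by_contra
      nlinarith
  have hq : m / (2 * B) = q := by
    rw [← hr, Nat.mul_add_div (by omega), Nat.div_eq_of_lt hlt, add_zero]
  have htwice : ρ.v .twice = m := by rw [hρ, eval_v_of_not_writesVar (by decide), hm]
  have hfin : computeBound.eval σ = (block [sub .t .twice .b, sub .t .t .b]).eval ρ := by
    rw [hρ]; rfl
  rw [hfin, hq]
  refine ⟨by simp [hb], ?_⟩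
  simpa [hb, htwice] using by omega

theorem setup_spec (h : Input n B k G σ) (hB : 0 < B) :
    Env n G (setup.eval σ) ∧ (setup.eval σ).v .k = k ∧
      (setup.eval σ).v .b = budget n B k G ∧
      (setup.eval σ).v .t = degreeSum n G - 2 * budget n B k G := by
  obtain ⟨ρ, hρ⟩ : ∃ ρ, ρ = (block [readParams, initRows, countEntries]).eval σ := ⟨_, rfl⟩
  have htwice : ρ.v .twice = degreeSum n G := hρ ▸ countEntries_spec h.env
  have henv : Env n G ρ := hρ ▸ h.env.eval (s := countEntries)
  have hρB : ρ.v .B = B := by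
    rw [hρ, eval_block_cons, eval_v_of_not_writesVar (by decide), h.v_readParams.1]
  have hρk : ρ.v .k = k := by
    rw [hρ, eval_block_cons, eval_v_of_not_writesVar (by decide), h.v_readParams.2]
  have hsetup : setup.eval σ = computeBound.eval ρ := by rw [hρ]; rfl
  rw [hsetup, budget, ← hρk]
  exact ⟨henv.eval, eval_v_of_not_writesVar (by decide) ρ,
    computeBound_spec henv hρB htwice hB (degreeSum_le n G)⟩

theorem bitCount_prepare (σ : Store Var Arr) :
    (prepare.eval σ).v .bitCount = 2 * σ.v .k := by
  have key := eval_loop_induction (x := .k) (s := block [succ .bitCount, succ .bitCount])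
    (σ := (const .bitCount 0 : Cmd Var Arr).eval σ) (fun i τ => τ.v .bitCount = 2 * i)
    (by simp) (by
      rintro i τ - h
      simp [h, mul_add])
  simp only [eval_const, ne_eq, reduceCtorEq, not_false_eq_true, Function.update_of_ne] at key
  simp (disch := decide) only [prepare, eval_block_cons, eval_block_nil,
    eval_v_of_not_writesVar]
  exact key

theorem count_prepare (σ : Store Var Arr) :
    (prepare.eval σ).v .count = 2 ^ (prepare.eval σ).v .bitCount := by
  obtain ⟨ρ, hρ⟩ : ∃ ρ, ρ = (block [const .bitCount 0,
    loop .k (block [succ .bitCount, succ .bitCount]), const .count 1]).eval σ := ⟨_, rfl⟩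
  have key := eval_loop_induction (x := .bitCount) (s := doubleCount) (σ := ρ)
    (fun i τ => τ.v .count = 2 ^ i) (by simp [hρ]) (by
      rintro i τ - h
      simp [doubleCount, eval_loop_succ, h, pow_succ, mul_two])
  have hprepare : prepare.eval σ = (loop .bitCount doubleCount).eval ρ := by rw [hρ]; rfl
  rw [hprepare, key, eval_v_of_not_writesVar (by decide)]

end VCL1.Algorithm

/-! ### Correctness and running time of the program -/

namespace VCL1.Algorithm

open Cmd HalfCover Finset

variable {n B k m : ℕ} {G : SimpleGraph ℕ} {σ : Store Var Arr}

theorem card_filter_nonempty_le {α β : Type*} (s : Finset α) (f : α → Finset β) :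
    #{u ∈ s | (f u).Nonempty} ≤ ∑ u ∈ s, #(f u) := by
  classical
  rw [card_filter]
  refine sum_le_sum fun u _ => ?_
  split_ifs with h
  · exact h.card_pos
  · exact Nat.zero_le _

theorem exists_covers_two_mul_card_le (n : ℕ) (G : SimpleGraph ℕ) :
    ∃ C, Covers G (range n) C ∧ 2 * #C ≤ degreeSum n G := by
  -- The larger ends of the edges form a cover, and so do the smaller ones.
  let lower (u : ℕ) : Finset ℕ := {w ∈ nbrs G (range n) u | w < u}
  let upper (u : ℕ) : Finset ℕ := {w ∈ nbrs G (range n) u | ¬ w < u}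
  have hlower : Covers G (range n) {u ∈ range n | (lower u).Nonempty} := by
    intro u hu w hw huw
    rcases huw.ne.lt_or_gt with hlt | hlt
    · exact Or.inr (mem_filter.2 ⟨hw, u, mem_filter.2 ⟨mem_nbrs.2 ⟨hu, huw.symm⟩, hlt⟩⟩)
    · exact Or.inl (mem_filter.2 ⟨hu, w, mem_filter.2 ⟨mem_nbrs.2 ⟨hw, huw⟩, hlt⟩⟩)
  have hupper : Covers G (range n) {u ∈ range n | (upper u).Nonempty} := by
    intro u hu w hw huw
    rcases huw.ne.lt_or_gt with hlt | hlt
    · exact Or.inl (mem_filter.2 ⟨hu, w, mem_filter.2 ⟨mem_nbrs.2 ⟨hw, huw⟩, hlt.not_gt⟩⟩)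
    · exact Or.inr (mem_filter.2 ⟨hw, u, mem_filter.2 ⟨mem_nbrs.2 ⟨hu, huw.symm⟩, hlt.not_gt⟩⟩)
  have hsum : ∑ u ∈ range n, #(lower u) + ∑ u ∈ range n, #(upper u) = degreeSum n G := by
    rw [← sum_add_distrib]
    exact sum_congr rfl fun u _ => card_filter_add_card_filter_not _
  have hcl := card_filter_nonempty_le (range n) lower
  have hcu := card_filter_nonempty_le (range n) upper
  rcases le_total #{u ∈ range n | (lower u).Nonempty} #{u ∈ range n | (upper u).Nonempty} with h | h
  · exact ⟨_, hlower, by omega⟩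
  · exact ⟨_, hupper, by omega⟩

theorem degreeSum_le_mul_tau (hdeg : ∀ u < n, #(nbrs G (range n) u) ≤ B) :
    degreeSum n G ≤ B * tau G (range n) := by
  obtain ⟨z, hz, hsum⟩ := exists_sum_eq_tau G (range n)
  have hswap : ∑ u ∈ range n, ∑ w ∈ nbrs G (range n) u, z w =
      ∑ u ∈ range n, ∑ _w ∈ nbrs G (range n) u, z u :=
    sum_comm' fun u w => by grind [mem_nbrs, G.adj_comm]
  have hle : 2 * degreeSum n G ≤ 2 * ∑ u ∈ range n, ∑ _w ∈ nbrs G (range n) u, z u :=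
    calc 2 * degreeSum n G = ∑ u ∈ range n, ∑ _w ∈ nbrs G (range n) u, 2 := by
          simp only [degreeSum, mul_sum, sum_const, smul_eq_mul, mul_comm]
      _ ≤ ∑ u ∈ range n, ∑ w ∈ nbrs G (range n) u, (z u + z w) :=
          sum_le_sum fun u hu => sum_le_sum fun w hw =>
            hz u hu w (mem_nbrs.1 hw).1 (mem_nbrs.1 hw).2
      _ = 2 * ∑ u ∈ range n, ∑ _w ∈ nbrs G (range n) u, z u := by
          simp only [sum_add_distrib, hswap, two_mul]
  calc degreeSum n G ≤ ∑ u ∈ range n, ∑ _w ∈ nbrs G (range n) u, z u := by omega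
    _ ≤ ∑ u ∈ range n, B * z u := sum_le_sum fun u hu => by
        rw [sum_const, smul_eq_mul]
        exact Nat.mul_le_mul_right _ (hdeg u (mem_range.1 hu))
    _ = B * tau G (range n) := by rw [← mul_sum, hsum]

theorem two_mul_budget_le (hB : 0 < B) (hdeg : ∀ u < n, #(nbrs G (range n) u) ≤ B) :
    2 * budget n B k G ≤ 2 * k + tau G (range n) := by
  have h : B * (2 * (degreeSum n G / (2 * B))) ≤ B * tau G (range n) :=
    calc B * (2 * (degreeSum n G / (2 * B))) = degreeSum n G / (2 * B) * (2 * B) := by ring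
      _ ≤ degreeSum n G := Nat.div_mul_le_self ..
      _ ≤ B * tau G (range n) := degreeSum_le_mul_tau hdeg
  rw [budget, mul_add]
  exact Nat.add_le_add_left (Nat.le_of_mul_le_mul_left h hB) _

theorem program_spec (h : Input n B k G σ) (hB : 0 < B)
    (hdeg : ∀ u < n, #(nbrs G (range n) u) ≤ B) :
    ((∃ C, Covers G (range n) C ∧ #C ≤ budget n B k G) ∧ (program.eval σ).v .n = 1) ∨
      (¬ (∃ C, Covers G (range n) C ∧ #C ≤ budget n B k G) ∧ (program.eval σ).v .n = 0) := by
  obtain ⟨henv, hk, hb, ht⟩ := setup_spec h hB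
  by_cases hsmall : degreeSum n G - 2 * budget n B k G = 0
  · obtain ⟨C, hC, hcard⟩ := exists_covers_two_mul_card_le n G
    exact Or.inl ⟨⟨C, hC, by omega⟩, by simp [program, ht, hsmall]⟩
  · obtain ⟨ρ, hρ⟩ : ∃ ρ, ρ = prepare.eval (setup.eval σ) := ⟨_, rfl⟩
    have hm : ρ.v .bitCount = 2 * k := by rw [hρ, bitCount_prepare, hk]
    have hρb : ρ.v .b = budget n B k G := by rw [hρ, eval_v_of_not_writesVar (by decide), hb]
    have hprogram : (program.eval σ).v .n = (search.eval ρ).v .ans := by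
      simp only [program, eval_block_cons, eval_block_nil, eval_copy, eval_ifz, ht, if_neg hsmall,
        ← hρ, Function.update_self]
    obtain ⟨hans, hiff⟩ := search_spec (hρ ▸ henv.eval) hm (by rw [hρ, count_prepare, ← hρ, hm])
      (hρb ▸ two_mul_budget_le hB hdeg)
    rw [hρb] at hiff
    rw [hprogram, ← hiff]
    omega

theorem steps_prepare_le (σ : Store Var Arr) : prepare.steps σ ≤ 20 * 4 ^ σ.v .k := by
  obtain ⟨ρ, hρ⟩ : ∃ ρ, ρ = (block [const .bitCount 0,
    loop .k (block [succ .bitCount, succ .bitCount]), const .count 1]).eval σ := ⟨_, rfl⟩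
  have hm : ρ.v .bitCount = 2 * σ.v .k := by
    rw [← bitCount_prepare, hρ]
    exact (eval_v_of_not_writesVar (s := loop .bitCount doubleCount)
      (x := .bitCount) (by decide) _).symm
  have hbits : (loop .k (block [succ .bitCount, succ .bitCount])).steps
      ((const .bitCount 0 : Cmd Var Arr).eval σ) ≤ 1 + ∑ _i ∈ range (σ.v .k), (1 + 2) :=
    steps_loop_le (fun _ _ => True) (fun _ => 2) trivial (fun _ _ _ => trivial)
      fun _ _ _ => le_rfl
  have hcount : (loop .bitCount doubleCount).steps ρ ≤
      1 + ∑ i ∈ range (2 * σ.v .k), (1 + (2 + 2 ^ i * 2)) := by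
    rw [← hm]
    refine steps_loop_le (fun i τ => τ.v .count = 2 ^ i) (fun i => 2 + 2 ^ i * 2)
      (by simp [hρ]) (fun i τ h => ?_) fun i τ h => ?_
    · simp [doubleCount, eval_loop_succ, h, pow_succ, mul_two]
    · simpa [doubleCount, block, Cmd.steps, h] using by omega
  have hsteps : prepare.steps σ =
      1 + ((loop .k (block [succ .bitCount, succ .bitCount])).steps
        ((const .bitCount 0 : Cmd Var Arr).eval σ) +
          (1 + ((loop .bitCount doubleCount).steps ρ + 0))) := by
    rw [hρ]; rfl
  have hgeom : ∑ i ∈ range (2 * σ.v .k), 2 ^ i = 4 ^ σ.v .k - 1 := by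
    rw [Nat.geomSum_eq le_rfl, Nat.div_one, pow_mul]; rfl
  simp only [sum_add_distrib, ← sum_mul, hgeom, sum_const, card_range, smul_eq_mul] at hbits hcount
  have hk : σ.v .k < 4 ^ σ.v .k := Nat.lt_pow_self (by norm_num)
  omega

/-- The variables which govern the loops of an attempt. -/
def isLoopVar : Var → Bool
  | .n | .rounds | .bitCount => true
  | _ => false

theorem Env.le_of_isLoopVar {N : ℕ} (h : Env n G σ) (hN : n * (n + 1) + 1 ≤ N)
    (hm : σ.v .bitCount ≤ N) (x : Var) (hx : isLoopVar x = true) : σ.v x ≤ N := by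
  cases x <;> simp only [isLoopVar, Bool.false_eq_true] at hx
  · rw [h.n_eq]
    nlinarith
  · rwa [h.rounds_eq]
  · exact hm

theorem steps_search_le {N : ℕ} (h : Env n G σ) (hN : n * (n + 1) + 1 ≤ N)
    (hm : σ.v .bitCount ≤ N) :
    search.steps σ ≤ 2 + (fill .bitCount .bits .zero).bound N +
      σ.v .count * (1 + (block [attempt, increment]).bound N) := by
  obtain ⟨ρ, hρ⟩ : ∃ ρ, ρ = (const .ans 0 : Cmd Var Arr).eval σ := ⟨_, rfl⟩
  have hρenv : Env n G ρ := hρ ▸ h.eval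
  have hρm : ρ.v .bitCount ≤ N := by rwa [hρ, eval_v_of_not_writesVar (by decide)]
  obtain ⟨τ, hτ⟩ : ∃ τ, τ = (fill .bitCount .bits .zero).eval ρ := ⟨_, rfl⟩
  have hfill : (fill .bitCount .bits .zero).steps ρ ≤ (fill .bitCount .bits .zero).bound N :=
    steps_le_bound (by decide) ρ (hρenv.le_of_isLoopVar hN hρm)
  have hcount : τ.v .count = σ.v .count := by
    rw [hτ, eval_v_of_not_writesVar (by decide), hρ, eval_v_of_not_writesVar (by decide)]
  have hloop : (loop .count (block [attempt, increment])).steps τ ≤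
      1 + ∑ _i ∈ range (τ.v .count), (1 + (block [attempt, increment]).bound N) := by
    refine steps_loop_le (fun _ τ => Env n G τ ∧ τ.v .bitCount ≤ N)
      (fun _ => (block [attempt, increment]).bound N) ⟨hτ ▸ hρenv.eval, ?_⟩ ?_ ?_
    · rwa [hτ, eval_v_of_not_writesVar (by decide)]
    · rintro - τ ⟨henv, hm⟩
      exact ⟨henv.eval, by rwa [eval_v_of_not_writesVar (by decide)]⟩
    · rintro - τ ⟨henv, hm⟩
      exact steps_le_bound (by decide) τ (henv.le_of_isLoopVar hN hm)
  have hsteps : search.steps σ = 1 + ((fill .bitCount .bits .zero).steps ρ +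
      ((loop .count (block [attempt, increment])).steps τ + 0)) := by
    rw [hτ, hρ]; rfl
  rw [sum_const, card_range, smul_eq_mul, hcount] at hloop
  omega

/-- The factor in the running time which is not polynomial in `n`. It is `1` when the setup finds
that there is a cover within the budget. -/
noncomputable def trials (n B k : ℕ) (G : SimpleGraph ℕ) : ℕ :=
  if degreeSum n G ≤ 2 * budget n B k G then 1 else 4 ^ k

theorem trials_pos (n B k : ℕ) (G : SimpleGraph ℕ) : 0 < trials n B k G := by
  rw [trials]
  split_ifs <;> positivity

theorem steps_setup_le (h : Input n B k G σ) : setup.steps σ ≤ setup.bound n :=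
  steps_le_bound (Z := fun x => decide (x = .n)) (by decide) σ fun x hx => by
    rw [of_decide_eq_true hx, h.n_eq]

theorem steps_program_le (h : Input n B k G σ) (hB : 0 < B) :
    program.steps σ ≤ trials n B k G * (setup.bound n + (30 +
      (seq (fill .bitCount .bits .zero) (block [attempt, increment])).bound ((n + 1) ^ 2))) := by
  obtain ⟨ρ, hρ⟩ : ∃ ρ, ρ = setup.eval σ := ⟨_, rfl⟩
  obtain ⟨henv, hk, -, ht⟩ := setup_spec h hB
  rw [← hρ] at henv hk ht
  have hsetup := steps_setup_le h
  have hsteps : program.steps σ = setup.steps σ + ((1 + if ρ.v .t = 0 then 1 else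
      prepare.steps ρ + (search.steps (prepare.eval ρ) + 0)) + (1 + 0)) := by rw [hρ]; rfl
  rw [hsteps, ht, trials, Cmd.bound]
  split_ifs with hzero hsmall hsmall
  · omega
  · omega
  · omega
  have hkn : 2 * k ≤ n * n := by
    have := degreeSum_le n G
    have : k ≤ budget n B k G := Nat.le_add_right ..
    omega
  have hm : (prepare.eval ρ).v .bitCount = 2 * k := by rw [bitCount_prepare, hk]
  have hprepare := steps_prepare_le ρ
  have hsearch := steps_search_le (henv.eval (s := prepare)) (N := (n + 1) ^ 2) (by nlinarith)
    (by rw [hm]; nlinarith)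
  rw [count_prepare, hm, pow_mul] at hsearch
  rw [hk] at hprepare
  norm_num1 at hsearch
  have hpos : 1 ≤ 4 ^ k := Nat.one_le_pow _ _ (by norm_num)
  nlinarith

theorem exists_steps_program_le : ∃ e : ℕ, ∀ (n B k : ℕ) (G : SimpleGraph ℕ) (σ : Store Var Arr),
    Input n B k G σ → 0 < B → program.steps σ ≤ trials n B k G * (n + 2) ^ e := by
  obtain ⟨e₁, h₁⟩ := setup.exists_bound_le_pow
  obtain ⟨e₂, h₂⟩ := (seq (fill .bitCount .bits .zero)
    (block [attempt, increment]) : Cmd Var Arr).exists_bound_le_pow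
  refine ⟨e₁ + (5 + 2 * e₂ + 1) + 1, fun n B k G σ h hB =>
    (steps_program_le h hB).trans (Nat.mul_le_mul_left _ ?_)⟩
  have hadd := pow_add_pow_le_pow (b := n + 2) (by omega)
  refine (Nat.add_le_add (h₁ n) (Nat.add_le_add ?_ ?_ |>.trans (hadd 5 (2 * e₂)))).trans (hadd _ _)
  · calc 30 ≤ 2 ^ 5 := by norm_num
      _ ≤ (n + 2) ^ 5 := Nat.pow_le_pow_left (by omega) 5
  · calc _ ≤ ((n + 1) ^ 2 + 2) ^ e₂ := h₂ _
      _ ≤ ((n + 2) ^ 2) ^ e₂ := Nat.pow_le_pow_left (by nlinarith [n.zero_le]) _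
      _ = (n + 2) ^ (2 * e₂) := by rw [pow_mul]

end VCL1.Algorithm

/-! ### Instances as inputs -/

namespace VCL1

open Finset HalfCover Algorithm

variable (x : VCL1)

/-- The graph of an instance as a graph on the natural numbers, which the algorithm works with. -/
def graph : SimpleGraph ℕ := x.G.map Fin.valEmbedding

variable {x}

theorem graph_adj {u w : Fin x.n} : x.graph.Adj u w ↔ x.G.Adj u w :=
  SimpleGraph.map_adj_apply

variable (x)

open scoped Classical in
theorem card_nbrs_graph (u : Fin x.n) : #(nbrs x.graph (range x.n) u) = x.G.degree u := by
  rw [← SimpleGraph.card_neighborFinset_eq_degree, ← card_map Fin.valEmbedding]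
  congr 1
  ext w
  simp only [mem_nbrs, mem_range, mem_map, SimpleGraph.mem_neighborFinset, Fin.valEmbedding_apply]
  constructor
  · rintro ⟨hw, h⟩
    exact ⟨⟨w, hw⟩, graph_adj.1 h, rfl⟩
  · rintro ⟨w, h, rfl⟩
    exact ⟨w.2, graph_adj.2 h⟩

open scoped Classical in
theorem degreeSum_graph : degreeSum x.n x.graph = 2 * #x.G.edgeFinset := by
  simp only [degreeSum, sum_range, card_nbrs_graph, SimpleGraph.sum_degrees_eq_twice_card_edges]

theorem exists_isVertexCover_iff (c : ℕ) :
    (∃ C : Finset (Fin x.n), x.G.IsVertexCover (C : Set (Fin x.n)) ∧ #C ≤ c) ↔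
      ∃ C, Covers x.graph (range x.n) C ∧ #C ≤ c := by
  constructor
  · rintro ⟨C, hC, hc⟩
    refine ⟨C.map Fin.valEmbedding, fun u hu w hw h => ?_, by rwa [card_map]⟩
    lift u to Fin x.n using mem_range.1 hu
    lift w to Fin x.n using mem_range.1 hw
    exact (hC (graph_adj.1 h)).imp (mem_map_of_mem Fin.valEmbedding)
      (mem_map_of_mem Fin.valEmbedding)
  · rintro ⟨C, hC, hc⟩
    refine ⟨univ.filter fun i => (i : ℕ) ∈ C, fun u w h => ?_, le_trans ?_ hc⟩
    · simpa using hC u (mem_range.2 u.2) w (mem_range.2 w.2) (graph_adj.2 h)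
    · exact card_le_card_of_injOn Fin.val (by simp [Set.MapsTo]) Fin.val_injective.injOn

theorem isYes_iff :
    x.IsYes ↔ ∃ C, Covers x.graph (range x.n) C ∧ #C ≤ budget x.n x.B x.k x.graph := by
  classical
  have hfloor (c : ℕ) : (c : ℚ) ≤ #x.G.edgeFinset / x.B + x.k ↔
      c ≤ x.k + #x.G.edgeFinset / x.B := by
    rw [← Nat.le_floor_iff (by positivity), Nat.floor_add_natCast (by positivity),
      Nat.floor_div_eq_div, add_comm]
  rw [← exists_isVertexCover_iff, budget, degreeSum_graph, Nat.mul_div_mul_left _ _ two_pos]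
  simp only [IsYes, ← hfloor]

theorem getElem?_flatMap_of_length {α β : Type*} {g : α → List β} {m w : ℕ}
    (hg : ∀ a, (g a).length = m) (hw : w < m) (l : List α) (u : ℕ) :
    (l.flatMap g)[u * m + w]? = l[u]?.bind fun a => (g a)[w]? := by
  induction l generalizing u with
  | nil => simp
  | cons a l ih =>
    rw [List.flatMap_cons]
    cases u with
    | zero => rw [List.getElem?_append_left (by rw [hg]; omega)]; simp
    | succ u =>
      have hsub : (u + 1) * m + w - m = u * m + w := by rw [Nat.succ_mul]; omega
      rw [List.getElem?_append_right (by rw [hg, Nat.succ_mul]; omega), hg, hsub, ih,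
        List.getElem?_cons_succ]

open scoped Classical in
theorem encode_matrix {u w : ℕ} (hu : u < x.n) (hw : w < x.n) :
    x.encode.getD (3 + (u * x.n + w)) 0 = if x.graph.Adj u w then 1 else 0 := by
  have hadj : x.graph.Adj u w ↔ x.G.Adj ⟨u, hu⟩ ⟨w, hw⟩ :=
    graph_adj (u := ⟨u, hu⟩) (w := ⟨w, hw⟩)
  have hdrop : 3 + (u * x.n + w) - [x.n, x.B, x.k].length = u * x.n + w := by simp
  rw [encode, List.getD_eq_getElem?_getD, List.getElem?_append_right (by simp), hdrop,
    getElem?_flatMap_of_length (by simp) hw]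
  simp [hu, hw, hadj]

theorem length_encode : x.encode.length = 3 + x.n * x.n := by
  simp only [encode, List.length_append, List.length_cons, List.length_nil, List.length_flatMap,
    List.length_map, List.length_finRange, List.map_const', List.sum_replicate, smul_eq_mul]

theorem encode_three : x.encode.getD 3 0 = 0 := by
  classical
  rcases Nat.eq_zero_or_pos x.n with hn | hn
  · exact List.getD_eq_default _ _ (by rw [length_encode, hn])
  · have h := x.encode_matrix hn hn
    rwa [if_neg x.graph.irrefl, zero_mul] at h

theorem encode_le (r : ℕ) : x.encode.getD r 0 ≤ x.n + x.B + x.k + 1 := by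
  have hmem : ∀ a ∈ x.encode, a ≤ x.n + x.B + x.k + 1 := by
    intro a ha
    simp only [encode, List.mem_append, List.mem_cons, List.not_mem_nil, or_false,
      List.mem_flatMap, List.mem_map] at ha
    rcases ha with (rfl | rfl | rfl) | ⟨i, -, j, -, rfl⟩
    iterate 3 omega
    split_ifs <;> omega
  rcases lt_or_ge r x.encode.length with hr | hr
  · exact (List.getD_eq_getElem _ 0 hr).trans_le (hmem _ (List.getElem_mem hr))
  · exact (List.getD_eq_default _ 0 hr).trans_le (Nat.zero_le _)

theorem succ_n_le_inputSize : x.n + 1 ≤ RAM.inputSize x.encode := by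
  have h : x.encode.length ≤ RAM.inputSize x.encode := by
    rw [RAM.inputSize, ← List.length_map (f := RAM.len)]
    exact List.length_le_sum_of_one_le _ (by simp [RAM.len])
  have hlen := x.length_encode
  nlinarith

end VCL1

/-! ### The time bound -/

namespace RAM

theorem size_mul_le (x y : ℕ) : (x * y).size ≤ x.size + y.size := by
  rw [Nat.size_le, pow_add]
  exact Nat.mul_lt_mul'' (Nat.lt_size_self x) (Nat.lt_size_self y)

theorem size_le_self (x : ℕ) : x.size ≤ x := Nat.size_le.2 Nat.lt_two_pow_self

theorem len_mul_le {c w F k : ℕ} (hk : k < w) (hF : F.size ≤ 2 * k + 1) :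
    len (c * (w * F)) ≤ (c + 3) * w := by
  have h := (size_mul_le c (w * F)).trans (Nat.add_le_add_left (size_mul_le w F) _)
  have hc := (size_le_self c).trans (Nat.le_mul_of_pos_right c (by omega : 0 < w))
  have hw := size_le_self w
  rw [len, add_mul]
  omega

theorem exists_weight_le (P : Program) : ∃ W, ∀ i ∈ P, i.weight ≤ W :=
  ⟨(P.map Instr.weight).sum, fun _ hi => List.single_le_sum (fun _ _ => Nat.zero_le _) _
    (List.mem_map_of_mem hi)⟩

end RAM

namespace VCL1.Algorithm

open Finset HalfCover Cmd

variable {n B k : ℕ} {G : SimpleGraph ℕ}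

theorem size_trials_le : (trials n B k G).size ≤ 2 * k + 1 := by
  have h : trials n B k G ≤ 4 ^ k := by
    rw [trials]
    split_ifs
    exacts [Nat.one_le_pow _ _ (by norm_num), le_rfl]
  have hpow : 4 ^ k = 2 ^ (2 * k) := by rw [pow_mul]; rfl
  exact (Nat.size_le_size (h.trans_eq hpow)).trans_eq Nat.size_pow

theorem mul_four_pow_le (hB : 2 ≤ B) (hk : 0 < k) : B * 4 ^ k ≤ 4 * 2 ^ (k * B) := by
  obtain ⟨d, rfl⟩ := Nat.exists_eq_add_of_le hB
  have hd : 2 + d ≤ 2 ^ 2 * 2 ^ (k * d) :=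
    calc 2 + d ≤ 2 ^ (2 + d) := Nat.lt_two_pow_self.le
      _ = 2 ^ 2 * 2 ^ d := pow_add ..
      _ ≤ 2 ^ 2 * 2 ^ (k * d) := by gcongr; exacts [one_le_two, Nat.le_mul_of_pos_left d hk]
  calc (2 + d) * 4 ^ k ≤ 2 ^ 2 * 2 ^ (k * d) * 4 ^ k := Nat.mul_le_mul_right _ hd
    _ = 2 ^ 2 * (2 ^ (k * d) * (2 ^ 2) ^ k) := mul_assoc ..
    _ = 4 * 2 ^ (k * (2 + d)) := by rw [← pow_mul, ← pow_add]; congr 2; ring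

theorem mul_trials_le (hB : 0 < B) (hk : 0 < k) :
    (n + B + k + 1) * trials n B k G ≤ 8 * (n + 1) ^ 2 * 2 ^ (k * B) := by
  rw [trials]
  split_ifs with hsmall
  · have hB' : B ≤ k * B := Nat.le_mul_of_pos_left B hk
    have hk' : k ≤ k * B := Nat.le_mul_of_pos_right k hB
    have hpow : k * B < 2 ^ (k * B) := Nat.lt_two_pow_self
    nlinarith [Nat.zero_le (n * 2 ^ (k * B)), Nat.zero_le (n ^ 2 * 2 ^ (k * B))]
  · have hsum := degreeSum_le n G
    have hB₂ : 2 ≤ B := by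
      by_contra! h
      obtain rfl : B = 1 := by omega
      rw [budget] at hsmall
      omega
    have hkn : k ≤ budget n B k G := Nat.le_add_right _ _
    have hfactor : n + B + k + 1 ≤ 2 * (n + 1) ^ 2 * B := by nlinarith [Nat.zero_le (n * B)]
    calc (n + B + k + 1) * 4 ^ k ≤ 2 * (n + 1) ^ 2 * B * 4 ^ k := Nat.mul_le_mul_right _ hfactor
      _ = 2 * (n + 1) ^ 2 * (B * 4 ^ k) := mul_assoc ..
      _ ≤ 2 * (n + 1) ^ 2 * (4 * 2 ^ (k * B)) := Nat.mul_le_mul_left _ (mul_four_pow_le hB₂ hk)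
      _ = 8 * (n + 1) ^ 2 * 2 ^ (k * B) := by ring

/-- The cost of a run is the number of steps times the length of the largest number involved. The
length grows with the logarithm of the number `F` of trials, hence linearly in `k`, which is
absorbed by `w`. -/
theorem mul_len_le {w W q F N k : ℕ} (hk : k < w) (hF : 0 < F) (hsize : F.size ≤ 2 * k + 1)
    (hq : 4 ≤ q) (hN : N ≤ 2 * q) :
    (22 * N + 12 * (F * q)) * (5 * RAM.len (2 ^ 12 * (w + W + 1 + 16 * N + 16 + F * q))) ≤
      280 * (2 ^ 12 * (W + 39) + 3) * q ^ 2 * (w * F) := by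
  have hqF : q ≤ F * q := Nat.le_mul_of_pos_left q hF
  have hFw : F * q ≤ w * q * F := by
    rw [mul_comm F, mul_assoc]
    exact Nat.le_mul_of_pos_left _ (by omega)
  have hw : w ≤ w * q * F := by
    rw [mul_assoc]
    exact Nat.le_mul_of_pos_right w (Nat.mul_pos (by omega) hF)
  have hW : W ≤ W * (w * q * F) := Nat.le_mul_of_pos_right W (by omega)
  have hU : 2 ^ 12 * (w + W + 1 + 16 * N + 16 + F * q) ≤ 2 ^ 12 * (W + 39) * (w * q * F) := by
    rw [mul_assoc, add_mul W]
    omega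
  have hkq : k < w * q := hk.trans_le (Nat.le_mul_of_pos_right w (by omega))
  calc _ ≤ 56 * (F * q) * (5 * ((2 ^ 12 * (W + 39) + 3) * (w * q))) :=
        Nat.mul_le_mul (by omega)
          (Nat.mul_le_mul_left 5 ((RAM.len_mono hU).trans (RAM.len_mul_le hkq hsize)))
    _ = _ := by ring

/-! ### The machine program -/

/-- The placement of the variables and the arrays of the algorithm in the registers. -/
def layout : RAM.Layout Var Arr where
  var := Var.ctorIdx
  arr := Arr.ctorIdx
  var_inj := Function.LeftInverse.injective Var.ofNat_ctorIdx
  arr_inj := Function.LeftInverse.injective Arr.ofNat_ctorIdx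
  arr_lt c := by cases c <;> decide

/-- The machine program: spread out the input, then run the algorithm. -/
def code : RAM.Program := RAM.spread ++ layout.code program 0 RAM.spread.length

theorem input_view (x : VCL1) {reg : ℕ → ℕ} (h0 : reg 0 = x.n) (h3 : reg 3 = 0)
    (h : ∀ i, 1 ≤ i → i ≤ x.n * x.n + 2 * x.n + 5 →
      reg (16 * i + 3) = RAM.stowed (fun r => x.encode.getD r 0) (3 + i)) :
    Input x.n x.B x.k x.graph (layout.view reg) := by
  classical
  have hadj (i : ℕ) : (layout.view reg).a .adj i = reg (16 * i + 3) := rfl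
  have hstowed : RAM.stowed (fun r => x.encode.getD r 0) = Function.update (Function.update
    (fun r => x.encode.getD r 0) (x.n + 4) x.B) (2 * x.n + 5) x.k := rfl
  have hentry {u w : ℕ} (hu : u < x.n) (hw : w < x.n) (h₁ : u * x.n + w ≠ x.n + 1)
      (h₂ : u * x.n + w ≠ 2 * x.n + 2) :
      (layout.view reg).a .adj (u * x.n + w) = if x.graph.Adj u w then 1 else 0 := by
    rw [hadj, ← x.encode_matrix hu hw]
    rcases Nat.eq_zero_or_pos (u * x.n + w) with hi | hi
    · rw [hi, x.encode_three]
      exact h3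
    · rw [h _ hi (by nlinarith), hstowed, Function.update_of_ne (by omega),
        Function.update_of_ne (by omega)]
  refine ⟨h0, ?_, ?_, fun u hu w hw huw => ?_, fun u hu h₁ h₂ => ?_⟩
  · rw [hadj, h _ (by omega) (by nlinarith), hstowed, Function.update_of_ne (by omega),
      Function.update_apply, if_pos (by omega)]
  · rw [hadj, h _ (by omega) (by nlinarith), hstowed, Function.update_apply, if_pos (by omega)]
  · rw [hentry hu hw (fun h₁ => huw (eq_of_mul_add_eq hu hw (c := 1) (by omega)))
      (fun h₂ => huw (eq_of_mul_add_eq hu hw (c := 2) (by omega)))]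
    simp
  · rw [hentry hu hu h₁ h₂, if_neg x.graph.irrefl]

theorem exists_reaches_code (x : VCL1) {v S N U : ℕ} (hP : ∀ i ∈ code, i.weight < v)
    (hv : x.n + x.B + x.k + 1 < v) (hN : N = x.n * x.n + 2 * x.n + 5)
    (hS : ∀ σ, Input x.n x.B x.k x.graph σ → program.steps σ ≤ S)
    (hU : 2 ^ 12 * (v + 16 * N + 16 + S) ≤ U) :
    ∃ reg, RAM.Reaches code U (RAM.init x.encode) (22 * N + 12 * S) ⟨code.length, reg⟩ ∧
      (x.IsYes ∧ reg 0 = 1 ∨ ¬ x.IsYes ∧ reg 0 = 0) := by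
  obtain ⟨reg₁, hspread, h0, h3, hlt, hreg⟩ := RAM.exists_reaches_spread (P := code) (U := U)
    (reg := fun r => x.encode.getD r 0) (n := x.n) (List.prefix_append _ _) hP
    (fun r => (x.encode_le r).trans_lt hv) rfl hN (by omega)
  have hinput := input_view x h0 h3 (hN ▸ hreg)
  have hsteps := hS _ hinput
  have hcode : RAM.CodeAt code RAM.spread.length (layout.code program 0 RAM.spread.length) := by
    rw [RAM.CodeAt, code, List.drop_left]
  obtain ⟨reg₂, hrun, hview, -, -⟩ := layout.compiles (U := U) program 0 _ (v + 16 * N + 16) reg₁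
    hcode (fun i hi => (hP i hi).trans_le (by omega)) hlt (by omega)
  have hanswer : reg₂ 0 = (program.eval (layout.view reg₁)).v .n := hview ▸ rfl
  refine ⟨reg₂, ?_, ?_⟩
  · rw [code, List.length_append, layout.length_code]
    exact (hspread.trans hrun).mono (by omega)
  · rw [x.isYes_iff, hanswer]
    exact program_spec hinput x.B_pos fun u hu =>
      (x.card_nbrs_graph ⟨u, hu⟩).trans_le (x.degree_le _)

theorem exists_decidesWithin : ∃ a e : ℕ, ∀ x : VCL1,
    RAM.DecidesWithin code x.encode x.IsYes (a * 2 ^ (x.k * x.B) * (x.n + 1) ^ e) := by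
  obtain ⟨e, hsteps⟩ := exists_steps_program_le
  obtain ⟨W, hW⟩ := RAM.exists_weight_le code
  refine ⟨280 * (2 ^ 12 * (W + 39) + 3) * 8 * 2 ^ (2 * e + 4), 2 * e + 6, fun x => ?_⟩
  have hlt : ∀ i ∈ code, i.weight < x.n + x.B + x.k + 1 + W + 1 := fun i hi =>
    (hW i hi).trans_lt (by omega)
  obtain ⟨reg, hrun, hanswer⟩ := exists_reaches_code x hlt (by omega) rfl
    (S := trials x.n x.B x.k x.graph * (x.n + 2) ^ (e + 2)) (fun σ h =>
      (hsteps _ _ _ _ σ h x.B_pos).trans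
        (Nat.mul_le_mul_left _ (Nat.pow_le_pow_right (by omega) (by omega)))) le_rfl
  obtain ⟨t, ht, hruns⟩ := hrun.exists_runs fun i hi => (hlt i hi).trans_le (by omega)
  refine ⟨t, _, hruns, le_rfl, ht.trans ?_, hanswer⟩
  have hsq : (x.n + 2) ^ 2 ≤ (x.n + 2) ^ (e + 2) := Nat.pow_le_pow_right (by omega) (by omega)
  have hbase : ((x.n + 2) ^ (e + 2)) ^ 2 ≤ 2 ^ (2 * e + 4) * (x.n + 1) ^ (2 * e + 4) := by
    rw [← pow_mul, ← mul_pow, add_mul, mul_comm e]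
    exact Nat.pow_le_pow_left (by omega) _
  calc _ ≤ 280 * (2 ^ 12 * (W + 39) + 3) * ((x.n + 2) ^ (e + 2)) ^ 2 *
          ((x.n + x.B + x.k + 1) * trials x.n x.B x.k x.graph) :=
        mul_len_le (by omega) (trials_pos ..) size_trials_le (by nlinarith) (by nlinarith)
    _ ≤ 280 * (2 ^ 12 * (W + 39) + 3) * (2 ^ (2 * e + 4) * (x.n + 1) ^ (2 * e + 4)) *
          (8 * (x.n + 1) ^ 2 * 2 ^ (x.k * x.B)) :=
        Nat.mul_le_mul (Nat.mul_le_mul_left _ hbase) (mul_trials_le x.B_pos x.k_pos)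
    _ = _ := by ring

end VCL1.Algorithm

theorem computable_two_pow_mul : Computable fun p : ℕ × ℕ => 2 ^ (p.1 * p.2) := by
  have hpow : Primrec₂ fun a b : ℕ => a ^ b := Primrec₂.unpaired'.1 Nat.Primrec.pow
  exact (hpow.comp (Primrec.const 2) (Primrec.nat_mul.comp Primrec.fst Primrec.snd)).to_comp

theorem theorem1 :
    (∃ (P : RAM.Program) (a e : ℕ), ∀ x : VCL1,
      RAM.DecidesWithin P x.encode x.IsYes (a * 2 ^ (x.k * x.B) * (x.n + 1) ^ e)) ∧
    RAM.FPT VCL1.encode (fun x => (x.k, x.B)) VCL1.IsYes := by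
  obtain ⟨a, e, h⟩ := VCL1.Algorithm.exists_decidesWithin
  refine ⟨⟨_, a, e, h⟩, _, computable_two_pow_mul, VCL1.Algorithm.code, a, e, fun x => ?_⟩
  obtain ⟨t, c, hruns, hhalt, ht, hanswer⟩ := h x
  exact ⟨t, c, hruns, hhalt, ht.trans (Nat.mul_le_mul_left _
    (Nat.pow_le_pow_left x.succ_n_le_inputSize _)), hanswer⟩
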